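/- **Setting.** Let $K$ be a local field of characteristic $p>0$ with ring of integers $\mathfrak D=\{|x|\le 1\}$, prime ideal $\mathfrak B=\{|x|<1\}$ and residue field of order $q=p^c$; let $dx$ be the Haar measure of $K$ with $|\mathfrak D|=1$, and let $\mathfrak p$ be a prime element. Let $1=\zeta_0,\dots,\zeta_{c-1}\in\mathfrak D$ be such that the $p^c$ sums $\sum_i a_i\zeta_i$ ($0\le a_i<p$) form a subfield of $K$ and a full set of distinct coset representatives of $\mathfrak B$ in $\mathfrak D$. Let $\chi$ be the continuous additive character of $K$ with $\chi(\zeta_i\mathfrak p^{-j})=e^{2\pi i/p}$ if $i=0$ and $j=1$ (where the $i$ in the exponential is the imaginary unit), and $\chi(\zeta_i\mathfrak p^{-j})=1$ for all other $0\le i<c$, $j\in\mathbb Z$. For $n=\sum_i a_ip^i<q$ (base $p$) put $u(n)=\big(\sum_i a_i\zeta_i\big)\mathfrak p^{-1}$, for $n=\sum_s b_sq^s$ (base $q$) put $u(n)=\sum_s u(b_s)\mathfrak p^{-s}$, and let $\chi_k(\xi)=\chi(u(k)\xi)$. The Fourier transform on $L^2(K)$ extends $\hat f(\xi)=\int_K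 f(x)\chi(-\xi x)\,dx$. For $\Psi=\{\psi_1,\dots,\psi_N\}\subset L^2(K)$ let $\psi_{\ell,j,k}(x)=q^{j/2}\psi_\ell(\mathfrak p^{-j}x-u(k))$, $j\in\mathbb Z$, $k\in\mathbb N_0$. The system $X(\Psi)=\{\psi_{\ell,j,k}\}$ is a *wavelet frame* if there are $a,b>0$ with $a\|f\|^2\le\sum_{\ell,j,k}|\langle f,\psi_{\ell,j,k}\rangle|^2\le b\|f\|^2$ for all $f\in L^2(K)$, and *Parseval* if $a=b=1$ is possible. Two wavelet frames $X(\Psi)$, $X(\Phi)$ with the same number of generators are *orthogonal* if $\sum_{\ell,j,k}\langle f,\psi_{\ell,j,k}\rangle\,\phi_{\ell,j,k}=0$ in $L^2(K)$ for all $f\in L^2(K)$. **UEP systems.** A *UEP system* with $L$ framelets consists of $\varphi\in L^2(K)$ and coefficient sequences $h^0,\dots,h^L$ such that - $\varphi(x)=\sqrt q\sum_{k}h^0_k\,\varphi(\mathfrak p^{-1}x-u(k))$ in $L^2(K)$, and $\lim_{j\to\infty}|\hat\varphi(\mathfrak p^j\xi)|=1$ for a.e. $\xi$; - the polyphase components $f^\ell_r(\eta)=\sum_k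 h^\ell_{r+qk}\overline{\chi_k(\eta)}$, $0\le\ell\le L$, $0\le r<q$, converge in $L^2$ on compact sets; - the polyphase matrix $\Gamma=(f^\ell_r)$ (row $\ell$, column $r$) satisfies $\Gamma(\mathfrak p^{-1}\xi)^*\,\Gamma(\mathfrak p^{-1}\xi)=I_q$ for a.e. $\xi\in\mathfrak D$. Its masks are $m_\ell(\xi)=q^{-1/2}\sum_{r<q}\overline{\chi_r(\xi)}\,f^\ell_r(\mathfrak p^{-1}\xi)$, and its framelets are $\psi_\ell(x)=\sqrt q\sum_k h^\ell_k\,\varphi(\mathfrak p^{-1}x-u(k))$, $1\le\ell\le L$. **Theorem 3.4.** Let $(\varphi,h)$ and $(\tilde\varphi,\tilde h)$ be UEP systems with $L$ framelets each (they may be equal), with polyphase matrices $\Gamma$ and $\tilde\Gamma$ and masks $m_\ell$ and $\tilde m_\ell$. Let $A(\eta)=(a_{k,\ell}(\eta))$ be a $2L\times 2L$ paraunitary matrix, that is, its entries are measurable functions on $K$ periodic under all $u(n)$ (for example polynomials in the characters $\chi_k$) and $A(\eta)^*A(\eta)=I$ for a.e. $\eta$. Write $A=(A_1:A_2)$, where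 $A_1$ and $A_2$ consist of the first and the last $L$ columns, and put $B=\operatorname{diag}(1,A_1)$, $C=\operatorname{diag}(1,A_2)$, $\Gamma_1=B\Gamma$ and $\Gamma_2=C\tilde\Gamma$. For $k=1,\dots,2L$ let $$G_k(\xi)=\frac1{\sqrt q}\sum_{r<q}\overline{\chi_r(\xi)}\,\big(\Gamma_1(\mathfrak p^{-1}\xi)\big)_{k,r}=\sum_{\ell=1}^{L}a_{k,\ell}(\mathfrak p^{-1}\xi)\,m_\ell(\xi),$$ $$\tilde G_k(\xi)=\frac1{\sqrt q}\sum_{r<q}\overline{\chi_r(\xi)}\,\big(\Gamma_2(\mathfrak p^{-1}\xi)\big)_{k,r}=\sum_{\ell=1}^{L}a_{k,L+\ell}(\mathfrak p^{-1}\xi)\,\tilde m_\ell(\xi)$$ be the new masks, where the rows of $\Gamma_1$, $\Gamma_2$ are numbered from $0$. Then there are $\psi^*_k,\phi^*_k\in L^2(K)$ with $$\hat\psi^*_k(\mathfrak p^{-1}\xi)=G_k(\xi)\,\hat\varphi(\xi),\qquad \hat\phi^*_k(\mathfrak p^{-1}\xi)=\tilde G_k(\xi)\,\hat{\tilde\varphi}(\xi),\qquad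 k=1,\dots,2L,$$ and the systems $X(\Psi^*)$ and $X(\Phi^*)$ generated by $\Psi^*=\{\psi^*_1,\dots,\psi^*_{2L}\}$ and $\Phi^*=\{\phi^*_1,\dots,\phi^*_{2L}\}$ are a pair of orthogonal wavelet frames for $L^2(K)$; both are Parseval frames. -/

import Mathlib

open MeasureTheory Filter Topology
open scoped ENNReal Matrix ComplexConjugate

noncomputable section

namespace LocalFieldWavelet

/-- The choices that fix the harmonic analysis on a local field `K` of characteristic `p`
with residue field of order `q = p ^ c`: a prime element `𝔭`, a basis `ζ` over the prime field of
the copy of `GF(q)` inside the ring of integers, with `ζ 0 = 1`, and the standard additive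
character `χ`. The ring of integers is the closed unit ball and its prime ideal is the open unit
ball. -/
structure FieldData (K : Type*) [NontriviallyNormedField K] (p c : ℕ) [NeZero c] where
  /-- the prime element -/
  𝔭 : K
  norm_prime_lt : ‖𝔭‖ < 1
  norm_prime_max : ∀ x : K, ‖x‖ < 1 → ‖x‖ ≤ ‖𝔭‖
  /-- the basis of the field of constants -/
  ζ : Fin c → K
  zeta_zero : ζ 0 = 1
  /-- the `p ^ c` combinations of the `ζ i` form a subfield of `K` -/
  span_subfield : ∃ F : Subfield K,
    (F : Set K) = Set.range fun a : Fin c → Fin p => ∑ i, ((a i : ℕ) : K) * ζ i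
  /-- the `p ^ c` combinations of the `ζ i` are a full set of distinct coset representatives of
  the prime ideal in the ring of integers -/
  span_residue : ∀ x : K, ‖x‖ ≤ 1 →
    ∃! a : Fin c → Fin p, ‖x - ∑ i, ((a i : ℕ) : K) * ζ i‖ < 1
  /-- the additive character; it is determined by the two properties below -/
  χ : AddChar K Circle
  continuous_char : Continuous χ
  char_apply : ∀ (i : Fin c) (j : ℤ), ((χ (ζ i * 𝔭 ^ (-j)) : Circle) : ℂ) =
    if i = 0 ∧ j = 1 then Complex.exp (2 * Real.pi * Complex.I / p) else 1

section

variable {K : Type*} [NontriviallyNormedField K] {p c : ℕ} [NeZero c]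

namespace FieldData

/-- The order `q` of the residue field. -/
abbrev q (_S : FieldData K p c) : ℕ := p ^ c

/-- `u(n)` for `0 ≤ n < q`, from the base `p` digits of `n`. -/
def uDigit (S : FieldData K p c) (n : ℕ) : K :=
  (∑ i : Fin c, ((n / p ^ (i : ℕ) % p : ℕ) : K) * S.ζ i) * S.𝔭⁻¹

/-- `u(n) = u(b₀) + u(b₁) 𝔭⁻¹ + ⋯ + u(bₛ) 𝔭⁻ˢ` for `n = b₀ + b₁ q + ⋯ + bₛ qˢ` in base `q`.
All base `q` digits of `n` from position `n + 1` on are zero. -/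
def u (S : FieldData K p c) (n : ℕ) : K :=
  ∑ s ∈ Finset.range (n + 1), S.uDigit (n / S.q ^ s % S.q) * S.𝔭 ^ (-(s : ℤ))

/-- The character `χ_k(ξ) = χ(u(k) ξ)`, as a complex number. -/
def chi (S : FieldData K p c) (k : ℕ) (ξ : K) : ℂ := ((S.χ (S.u k * ξ) : Circle) : ℂ)

/-- The wavelet `ψ_{j,k}(x) = q^{j/2} ψ(𝔭^{-j} x - u(k))`. -/
def wavelet (S : FieldData K p c) (ψ : K → ℂ) (j : ℤ) (k : ℕ) (x : K) : ℂ :=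
  (((S.q : ℝ) ^ ((j : ℝ) / 2) : ℝ) : ℂ) * ψ (S.𝔭 ^ (-j) * x - S.u k)

/-- The masks that belong to a polyphase matrix `Γ` (one row per mask, entries
`f_r`, argument `𝔭⁻¹ ξ`):
`m(ξ) = q^{-1/2} ∑_{r < q} conj (χ_r(ξ)) f_r(𝔭⁻¹ ξ)`. -/
def mask (S : FieldData K p c) {n : ℕ} (Γ : K → Matrix (Fin n) (Fin S.q) ℂ)
    (k : Fin n) (ξ : K) : ℂ :=
  ((1 / Real.sqrt S.q : ℝ) : ℂ) * ∑ r : Fin S.q, conj (S.chi r ξ) * Γ (S.𝔭⁻¹ * ξ) k r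

/-- A `N × N` matrix function is paraunitary: measurable entries, periodic under all `u(n)`,
unitary almost everywhere. -/
structure IsParaunitary [MeasurableSpace K] (S : FieldData K p c) (μ : Measure K) {N : ℕ}
    (A : K → Matrix (Fin N) (Fin N) ℂ) : Prop where
  measurable : ∀ i j, Measurable fun ξ => A ξ i j
  periodic : ∀ (n : ℕ) (ξ : K), A (ξ + S.u n) = A ξ
  unitary : ∀ᵐ ξ ∂μ, (A ξ)ᴴ * A ξ = 1

variable [MeasurableSpace K]

/-- `f = ∑_k d_k conj χ_k`, with convergence in `L²` on every compact set. -/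
def IsCharSeries (S : FieldData K p c) (μ : Measure K) (d : ℕ → ℂ) (f : K → ℂ) : Prop :=
  AEStronglyMeasurable f μ ∧ ∀ C : Set K, IsCompact C →
    Tendsto (fun N : ℕ =>
      eLpNorm (fun ξ => f ξ - ∑ k ∈ Finset.range N, d k * conj (S.chi k ξ)) 2 (μ.restrict C))
      atTop (𝓝 0)

/-- `g` is the `L²` Fourier transform of `f ∈ L²(K)`: the limit in `L²` of the integrals
`∫_{|x| ≤ n} f(x) χ(-ξ x) dx`. -/
def IsFourierL2 (S : FieldData K p c) (μ : Measure K) (f g : K → ℂ) : Prop :=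
  MemLp f 2 μ ∧ MemLp g 2 μ ∧
    Tendsto (fun n : ℕ => eLpNorm (fun ξ => g ξ -
      Fourier.fourierIntegral S.χ μ ((Metric.closedBall (0 : K) n).indicator f) ξ) 2 μ)
      atTop (𝓝 0)

/-- The data of a wavelet system obtained from the unitary extension principle: a refinable
function `φ ∈ L²(K)` with Fourier transform `φhat`, the coefficients `h 0` of the refinement
equation, the coefficients `h ℓ`, `1 ≤ ℓ ≤ L`, of the framelets
`ψ_ℓ(x) = √q ∑_k h ℓ k φ(𝔭⁻¹ x - u(k))`, and the polyphase matrix `Γ` with entries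
`f_r^ℓ = ∑_k h ℓ (r + q k) conj χ_k`, in row `ℓ` and column `r`. -/
structure IsUEPSystem (S : FieldData K p c) (μ : Measure K) {L : ℕ} (φ φhat : K → ℂ)
    (h : Fin (L + 1) → ℕ → ℂ) (Γ : K → Matrix (Fin (L + 1)) (Fin S.q) ℂ) : Prop where
  fourier : S.IsFourierL2 μ φ φhat
  /-- the refinement equation `φ(x) = √q ∑_k h 0 k φ(𝔭⁻¹ x - u(k))` in `L²(K)` -/
  refinement : Tendsto (fun N : ℕ => eLpNorm (fun x => φ x -
      ((Real.sqrt S.q : ℝ) : ℂ) * ∑ k ∈ Finset.range N, h 0 k * φ (S.𝔭⁻¹ * x - S.u k)) 2 μ)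
      atTop (𝓝 0)
  tendsto_one : ∀ᵐ ξ ∂μ, Tendsto (fun j : ℕ => ‖φhat (S.𝔭 ^ j * ξ)‖) atTop (𝓝 1)
  polyphase : ∀ (ℓ : Fin (L + 1)) (r : Fin S.q),
    S.IsCharSeries μ (fun k => h ℓ (r + S.q * k)) fun η => Γ η ℓ r
  /-- the UEP condition: the polyphase matrix is unitary,
  `∑_ℓ conj (f_r^ℓ) f_{r'}^ℓ = δ_{r r'}`, at `𝔭⁻¹ ξ` for almost every integer `ξ` -/
  uep : ∀ᵐ ξ ∂μ.restrict (Metric.closedBall (0 : K) 1),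
    (Γ (S.𝔭⁻¹ * ξ))ᴴ * Γ (S.𝔭⁻¹ * ξ) = 1

/-- The wavelet system generated by `Ψ ⊂ L²(K)` satisfies the frame inequalities with bounds
`a` and `b`. -/
def IsWaveletFrameWith (S : FieldData K p c) (μ : Measure K) {N : ℕ} (Ψ : Fin N → K → ℂ)
    (a b : ℝ) : Prop :=
  (∀ ℓ, MemLp (Ψ ℓ) 2 μ) ∧ ∀ f : K → ℂ, MemLp f 2 μ →
    ENNReal.ofReal a * eLpNorm f 2 μ ^ 2 ≤
        ∑' i : Fin N × ℤ × ℕ, ‖∫ x, f x * conj (S.wavelet (Ψ i.1) i.2.1 i.2.2 x) ∂μ‖ₑ ^ 2 ∧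
      ∑' i : Fin N × ℤ × ℕ, ‖∫ x, f x * conj (S.wavelet (Ψ i.1) i.2.1 i.2.2 x) ∂μ‖ₑ ^ 2 ≤
        ENNReal.ofReal b * eLpNorm f 2 μ ^ 2

/-- The wavelet system generated by `Ψ` is a wavelet frame for `L²(K)`. -/
def IsWaveletFrame (S : FieldData K p c) (μ : Measure K) {N : ℕ} (Ψ : Fin N → K → ℂ) : Prop :=
  ∃ a b : ℝ, 0 < a ∧ 0 < b ∧ S.IsWaveletFrameWith μ Ψ a b

/-- The wavelet systems generated by `Ψ` and `Φ` are a pair of orthogonal wavelet frames: both are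
wavelet frames and `∑ ⟨f, ψ_{ℓ,j,k}⟩ φ_{ℓ,j,k} = 0` for every `f ∈ L²(K)`, with unconditional
convergence in `L²(K)`. -/
def IsOrthogonalFramePair (S : FieldData K p c) (μ : Measure K) {N : ℕ}
    (Ψ Φ : Fin N → K → ℂ) : Prop :=
  S.IsWaveletFrame μ Ψ ∧ S.IsWaveletFrame μ Φ ∧
    ∀ f : K → ℂ, MemLp f 2 μ →
      Tendsto (fun s : Finset (Fin N × ℤ × ℕ) => eLpNorm (fun x => ∑ i ∈ s,
        (∫ y, f y * conj (S.wavelet (Ψ i.1) i.2.1 i.2.2 y) ∂μ) *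
          S.wavelet (Φ i.1) i.2.1 i.2.2 x) 2 μ) atTop (𝓝 0)

end FieldData

end

/-- The first `L` columns `A₁` of a `2L × 2L` matrix. -/
def firstCols {L : ℕ} (A : Matrix (Fin (2 * L)) (Fin (2 * L)) ℂ) :
    Matrix (Fin (2 * L)) (Fin L) ℂ :=
  Matrix.of fun k l => A k ⟨l, by omega⟩

/-- The last `L` columns `A₂` of a `2L × 2L` matrix. -/
def lastCols {L : ℕ} (A : Matrix (Fin (2 * L)) (Fin (2 * L)) ℂ) :
    Matrix (Fin (2 * L)) (Fin L) ℂ :=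
  Matrix.of fun k l => A k ⟨L + l, by omega⟩

/-- The block diagonal matrix `diag(1, M)`. -/
def oneBlock {m n : ℕ} (M : Matrix (Fin m) (Fin n) ℂ) :
    Matrix (Fin (m + 1)) (Fin (n + 1)) ℂ :=
  Matrix.of fun i j =>
    Fin.cases (Fin.cases 1 (fun _ => 0) j) (fun k => Fin.cases 0 (fun l => M k l) j) i

end LocalFieldWavelet

end

/-! Everything happens on the Fourier side and one level at a time. Write $\theta=\hat\varphi$ and
$g=\hat f$, and take a matrix function $\Delta$ that is periodic under all $u(n)$ and isometric
a.e., and whose row $0$ gives the refinement mask of $\theta$ (`IsExtensionPair`). Periodizing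
$q^{-1/2}g\,\overline{\theta(\mathfrak p\,\cdot)}\,\chi_r(\mathfrak p\,\cdot)$ over the $u(n)$ gives
functions $W_r$ on $\mathfrak D$. Their Fourier coefficients are the level-one coefficients of $f$
against $\varphi$, while the level-zero coefficients against the generator of row $i$ are the
Fourier coefficients of $\overline{(\Delta\overline W)_i}$. This is
`IsExtensionPair.exists_bracket`.

Since the $\chi_k$ form an orthonormal basis of $L^2(\mathfrak D)$ (`charBasis`), the isometry
$\Delta^*\Delta=I$ becomes an energy identity: the energy of $\varphi$ at level $j+1$ is its energy
at level $j$ plus that of all generators at level $j$ (`IsExtensionPair.energy_succ`). For $f$ and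
$\hat f$ of bounded support the energy of $\varphi$ tends to $\|f\|^2$ as $j\to\infty$ and to $0$ as
$j\to-\infty$. Telescoping gives Parseval's identity (`IsExtensionPair.tsum_energy`), which extends
from this dense space to $L^2(K)$.

Left multiplication of $\Gamma$ by $\operatorname{diag}(1,A_1)$, or of $\tilde\Gamma$ by
$\operatorname{diag}(1,A_2)$, keeps row $0$ and the isometry property, because
$A_1^*A_1=A_2^*A_2=I$. So both new systems are Parseval. Moreover $A_1^*A_2=0$ makes the rows of
$\Gamma_1W$ and $\Gamma_2W'$ other than row $0$ orthogonal pointwise. By Parseval on $\mathfrak D$,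
the two coefficient sequences are then orthogonal on each level
(`IsExtensionPair.hasSum_coef_mul_conj`). Hence the analysis operators $T,T'$ satisfy $T'^*T=0$,
which is the orthogonality of the frames (`hasSum_inner_smul_zero_of_dense`). The generators exist
because the masks are bounded by $1$ and the Fourier transform is onto $L^2(K)$
(`surjective_fourierLp`). -/

noncomputable section

namespace LocalFieldWavelet

namespace FieldData

/-! ### Digits, the elements $u(n)$, and the additive character. -/

section Algebra

set_option linter.unusedSectionVars false

variable {K : Type*} [NontriviallyNormedField K] {p c : ℕ} [NeZero c] (S : FieldData K p c)

theorem norm_prime_pos : 0 < ‖S.𝔭‖ := by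
  obtain ⟨x, hx0, hx1⟩ := NormedField.exists_norm_lt_one K
  exact hx0.trans_le (S.norm_prime_max x hx1)

theorem prime_ne_zero : S.𝔭 ≠ 0 := norm_pos_iff.1 S.norm_prime_pos

/-- The element of the field of constants with base `p` digits those of `n`. -/
def digit (n : ℕ) : K := ∑ i : Fin c, ((n / p ^ (i : ℕ) % p : ℕ) : K) * S.ζ i

theorem uDigit_eq (n : ℕ) : S.uDigit n = S.digit n * S.𝔭⁻¹ := rfl

theorem digit_zero : S.digit 0 = 0 := by simp [digit]

theorem digit_eq_sum (n : Fin (p ^ c)) :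
    S.digit n = ∑ i, ((finFunctionFinEquiv.symm n i : ℕ) : K) * S.ζ i := rfl

/-- The field of constants. -/
def constants : Subfield K := S.span_subfield.choose

theorem mem_constants {x : K} : x ∈ S.constants ↔ ∃ n : Fin (p ^ c), S.digit n = x := by
  have h : (S.constants : Set K) = _ := S.span_subfield.choose_spec
  rw [← SetLike.mem_coe, h]
  constructor
  · rintro ⟨a, rfl⟩
    exact ⟨finFunctionFinEquiv a, by rw [digit_eq_sum, Equiv.symm_apply_apply]⟩
  · rintro ⟨n, rfl⟩
    exact ⟨finFunctionFinEquiv.symm n, (S.digit_eq_sum n).symm⟩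

theorem finite_constants : Finite S.constants := by
  have : Function.Surjective fun n : Fin (p ^ c) =>
      (⟨S.digit n, S.mem_constants.2 ⟨n, rfl⟩⟩ : S.constants) := by
    rintro ⟨x, hx⟩
    obtain ⟨n, rfl⟩ := S.mem_constants.1 hx
    exact ⟨n, rfl⟩
  exact Finite.of_surjective _ this

/-- The powers of an element of norm greater than $1$ would be infinitely many elements of a finite
field. -/
theorem norm_le_one_of_mem_constants {x : K} (hx : x ∈ S.constants) : ‖x‖ ≤ 1 := by
  by_contra! h
  have := S.finite_constants
  have hinj : Function.Injective fun n : ℕ => (⟨x, hx⟩ : S.constants) ^ n := by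
    intro m n hmn
    have h1 : ‖x‖ ^ m = ‖x‖ ^ n := by
      rw [← norm_pow, ← norm_pow]
      exact congrArg (fun y : S.constants => ‖(y : K)‖) hmn
    exact pow_right_injective₀ (by linarith) h.ne' h1
  exact not_injective_infinite_finite _ hinj

theorem digit_mem (n : Fin (p ^ c)) : S.digit n ∈ S.constants := S.mem_constants.2 ⟨n, rfl⟩

theorem norm_digit_le (n : Fin (p ^ c)) : ‖S.digit n‖ ≤ 1 :=
  S.norm_le_one_of_mem_constants (S.digit_mem n)

theorem exists_digit {x : K} (hx : ‖x‖ ≤ 1) : ∃ n : Fin (p ^ c), ‖x - S.digit n‖ ≤ ‖S.𝔭‖ := by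
  obtain ⟨a, ha, -⟩ := S.span_residue x hx
  exact ⟨finFunctionFinEquiv a, S.norm_prime_max _ (by
    rwa [digit_eq_sum, Equiv.symm_apply_apply])⟩

theorem digit_injOn {m n : Fin (p ^ c)} (h : ‖S.digit m - S.digit n‖ < 1) : m = n := by
  have := (S.span_residue (S.digit m) (S.norm_digit_le m)).unique
    (y₁ := finFunctionFinEquiv.symm m) (y₂ := finFunctionFinEquiv.symm n)
    (by rw [← digit_eq_sum]; simp) (by rwa [← digit_eq_sum])
  exact finFunctionFinEquiv.symm.injective this

theorem norm_inv_prime_mul {x : K} : ‖S.𝔭⁻¹ * x‖ ≤ 1 ↔ ‖x‖ ≤ ‖S.𝔭‖ := by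
  rw [norm_mul, norm_inv, inv_mul_le_iff₀ S.norm_prime_pos, mul_one]

variable [Fact p.Prime]

theorem one_lt_q (_S : FieldData K p c) : 1 < p ^ c :=
  Nat.one_lt_pow (NeZero.ne c) (Fact.out : p.Prime).one_lt

theorem q_pos (S : FieldData K p c) : 0 < p ^ c := (S.one_lt_q).le

/-- The digits beyond position $n$ vanish because $n<q^n$, so the range of summation can be enlarged
at will; this lets sums for different indices be compared. -/
theorem u_eq_sum {n N : ℕ} (h : n < N) :
    S.u n = ∑ s ∈ Finset.range N, S.uDigit (n / S.q ^ s % S.q) * S.𝔭 ^ (-(s : ℤ)) := by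
  refine Finset.sum_subset (Finset.range_mono h) fun s _ hs => ?_
  have : n < S.q ^ s :=
    lt_of_lt_of_le (by simpa using hs) (Nat.lt_pow_self S.one_lt_q).le
  rw [Nat.div_eq_of_lt this, Nat.zero_mod, uDigit_eq, digit_zero, zero_mul, zero_mul]

/-- Splitting off the lowest base $q$ digit. Together with `index_induction` this recursion replaces
the digit sum in nearly all that follows. -/
theorem u_add_mul {r : ℕ} (hr : r < p ^ c) (k : ℕ) :
    S.u (r + p ^ c * k) = S.digit r * S.𝔭⁻¹ + S.𝔭⁻¹ * S.u k := by
  have hk : k ≤ p ^ c * k := Nat.le_mul_of_pos_left k S.q_pos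
  rw [S.u_eq_sum (Nat.lt_succ_self _), Finset.sum_range_succ',
    S.u_eq_sum (N := r + p ^ c * k + 1) (n := k) (by omega), Finset.sum_range_succ]
  have h0 : k / S.q ^ (r + p ^ c * k) = 0 := by
    apply Nat.div_eq_of_lt
    exact lt_of_le_of_lt (by omega) (Nat.lt_pow_self S.one_lt_q)
  rw [h0, Nat.zero_mod, uDigit_eq, uDigit_eq, digit_zero, add_comm]
  simp only [zero_mul, add_zero, pow_zero, Nat.div_one, Nat.add_mul_mod_self_left,
    Nat.mod_eq_of_lt hr, CharP.cast_eq_zero, neg_zero, zpow_zero, mul_one]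
  congr 1
  rw [Finset.mul_sum]
  refine Finset.sum_congr rfl fun s _ => ?_
  have : (r + p ^ c * k) / S.q ^ (s + 1) = k / S.q ^ s := by
    rw [pow_succ', ← Nat.div_div_eq_div_mul, Nat.add_mul_div_left _ _ S.q_pos,
      Nat.div_eq_of_lt hr, zero_add]
  rw [this, mul_left_comm, Nat.cast_succ, neg_add, zpow_add₀ S.prime_ne_zero, zpow_neg_one]
  ring

theorem u_zero : S.u 0 = 0 := by simp [u, uDigit_eq, digit_zero]

theorem u_of_lt {r : ℕ} (hr : r < p ^ c) : S.u r = S.digit r * S.𝔭⁻¹ := by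
  simpa [u_zero] using S.u_add_mul hr 0

theorem u_add_mul' {r : ℕ} (hr : r < p ^ c) (k : ℕ) :
    S.u (r + p ^ c * k) = S.u r + S.𝔭⁻¹ * S.u k := by
  rw [S.u_add_mul hr, S.u_of_lt hr]

theorem index_induction (S : FieldData K p c) {P : ℕ → Prop} (h0 : P 0)
    (h : ∀ r : Fin (p ^ c), ∀ k, P k → P (r + p ^ c * k)) (n : ℕ) : P n := by
  induction n using Nat.strong_induction_on with
  | _ n ih =>
    rcases Nat.eq_zero_or_pos n with rfl | hn
    · exact h0
    · have := h ⟨n % p ^ c, Nat.mod_lt _ S.q_pos⟩ (n / p ^ c)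
        (ih _ (Nat.div_lt_self hn S.one_lt_q))
      rwa [Nat.mod_add_div] at this

variable [IsUltrametricDist K]

theorem norm_add_le' {x y : K} {r : ℝ} (hx : ‖x‖ ≤ r) (hy : ‖y‖ ≤ r) : ‖x + y‖ ≤ r :=
  (IsUltrametricDist.norm_add_le_max x y).trans (max_le hx hy)

theorem norm_sub_le' {x y : K} {r : ℝ} (hx : ‖x‖ ≤ r) (hy : ‖y‖ ≤ r) : ‖x - y‖ ≤ r := by
  rw [sub_eq_add_neg]
  exact norm_add_le' hx (by rwa [norm_neg])

/-- Different $u(k)$ lie in different cosets of $\mathfrak D$. Multiplying a difference in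
$\mathfrak D$ by $\mathfrak p$ shows that the higher parts again differ by an integer; once these
agree, the lowest digits agree modulo $\mathfrak B$. -/
theorem u_injective {k : ℕ} : ∀ {l : ℕ}, ‖S.u k - S.u l‖ ≤ 1 → k = l := by
  have key : ∀ {r s : Fin (p ^ c)} {k l : ℕ}, ‖S.u (r + p ^ c * k) - S.u (s + p ^ c * l)‖ ≤ 1 →
      ‖S.u k - S.u l‖ ≤ 1 ∧ (S.u k = S.u l → r = s) := by
    intro r s k l h
    rw [S.u_add_mul r.2, S.u_add_mul s.2] at h
    have h' : ‖S.𝔭⁻¹ * ((S.digit r - S.digit s) + (S.u k - S.u l))‖ ≤ 1 := by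
      convert h using 2; ring
    rw [norm_inv_prime_mul] at h'
    have h1 := norm_sub_le' (h'.trans S.norm_prime_lt.le)
      (norm_sub_le' (S.norm_digit_le r) (S.norm_digit_le s))
    rw [add_sub_cancel_left] at h1
    refine ⟨h1, fun h2 => S.digit_injOn ?_⟩
    rw [h2, sub_self, add_zero] at h'
    exact h'.trans_lt S.norm_prime_lt
  induction k using Nat.strong_induction_on with
  | _ k ih =>
    intro l h
    have hk := Nat.mod_add_div k (p ^ c)
    have hl := Nat.mod_add_div l (p ^ c)
    have h1 := key (r := ⟨k % p ^ c, Nat.mod_lt _ S.q_pos⟩) (s := ⟨l % p ^ c, Nat.mod_lt _ S.q_pos⟩)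
      (k := k / p ^ c) (l := l / p ^ c) (by simpa only [hk, hl] using h)
    have h2 : k / p ^ c = l / p ^ c := by
      -- Division by $q$ does not make $0$ smaller, so $k=0$ needs a separate induction on the other
      -- index.
      rcases Nat.eq_zero_or_pos k with rfl | hk0
      · by_contra hne
        rw [Nat.zero_div] at hne h1
        rcases Nat.eq_zero_or_pos l with rfl | hl0
        · simp at hne
        · have : ∀ n, ‖S.u n‖ ≤ 1 → n = 0 := by
            intro n
            induction n using Nat.strong_induction_on with
            | _ n ihn =>
              intro hn
              by_contra hn0
              have hn' := Nat.mod_add_div n (p ^ c)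
              have h3 := key (r := ⟨n % p ^ c, Nat.mod_lt _ S.q_pos⟩) (s := ⟨0, S.q_pos⟩)
                (k := n / p ^ c) (l := 0)
                (by simpa only [hn', mul_zero, add_zero, u_zero, sub_zero] using hn)
              rw [u_zero, sub_zero] at h3
              have h4 := ihn _ (Nat.div_lt_self (Nat.pos_of_ne_zero hn0) S.one_lt_q) h3.1
              have h5 := h3.2 (by rw [h4, u_zero])
              rw [Fin.mk.injEq] at h5
              rw [h5, h4] at hn'
              simp at hn'
              exact hn0 hn'.symm
          have h6 := this (l / p ^ c) (by simpa [u_zero] using h1.1)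
          exact hne h6.symm
      · exact ih _ (Nat.div_lt_self hk0 S.one_lt_q) h1.1
    have h3 := h1.2 (by rw [h2])
    rw [Fin.mk.injEq] at h3
    rw [← hk, ← hl, h3, h2]

theorem norm_u_le {n M : ℕ} (h : n < (p ^ c) ^ M) : ‖S.u n‖ ≤ ‖S.𝔭‖ ^ (-(M : ℤ)) := by
  induction M generalizing n with
  | zero =>
    obtain rfl : n = 0 := by simpa using h
    simp [u_zero]
  | succ M ih =>
    have hn := Nat.mod_add_div n (p ^ c)
    have hlt : n % p ^ c < p ^ c := Nat.mod_lt _ S.q_pos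
    rw [← hn, S.u_add_mul hlt, mul_comm (S.digit _), ← mul_add, norm_mul, norm_inv, Nat.cast_succ,
      neg_add, zpow_add₀ S.norm_prime_pos.ne', zpow_neg_one, mul_comm]
    refine mul_le_mul_of_nonneg_right (norm_add_le' ?_ (ih ?_)) (by positivity)
    · refine (S.norm_digit_le ⟨_, hlt⟩).trans ?_
      rw [zpow_neg, zpow_natCast]
      exact (one_le_inv₀ (pow_pos S.norm_prime_pos _)).2
        (pow_le_one₀ S.norm_prime_pos.le S.norm_prime_lt.le)
    · rw [Nat.div_lt_iff_lt_mul S.q_pos]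
      rwa [pow_succ] at h

/-- With `norm_u_le` and `u_injective`, this says that the $u(n)$, $n<q^M$, represent $\mathfrak
p^{-M}\mathfrak D/\mathfrak D$. -/
theorem exists_norm_sub_u_le {x : K} {M : ℕ} (hx : ‖x‖ ≤ ‖S.𝔭‖ ^ (-(M : ℤ))) :
    ∃ n < (p ^ c) ^ M, ‖x - S.u n‖ ≤ 1 := by
  induction M generalizing x with
  | zero => exact ⟨0, by simp, by simpa [u_zero] using hx⟩
  | succ M ih =>
    obtain ⟨k, hk, hk'⟩ := ih (x := S.𝔭 * x) (by
      rw [norm_mul]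
      refine (mul_le_mul_of_nonneg_left hx (norm_nonneg _)).trans_eq ?_
      rw [Nat.cast_succ, neg_add, zpow_add₀ S.norm_prime_pos.ne', zpow_neg_one]
      field_simp [S.norm_prime_pos.ne'])
    obtain ⟨r, hr⟩ := S.exists_digit hk'
    refine ⟨r + p ^ c * k, ?_, ?_⟩
    · calc (r : ℕ) + p ^ c * k < p ^ c + p ^ c * k := by have := r.2; omega
        _ = p ^ c * (k + 1) := by ring
        _ ≤ p ^ c * (p ^ c) ^ M := Nat.mul_le_mul_left _ hk
        _ = _ := by rw [pow_succ']
    · rw [S.u_add_mul r.2]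
      have : x - (S.digit r * S.𝔭⁻¹ + S.𝔭⁻¹ * S.u k) =
          S.𝔭⁻¹ * (S.𝔭 * x - S.u k - S.digit r) := by
        field_simp [S.prime_ne_zero]; ring
      rw [this, norm_inv_prime_mul]
      exact hr

theorem exists_le_zpow_neg (R : ℝ) : ∃ M : ℕ, R ≤ ‖S.𝔭‖ ^ (-(M : ℤ)) := by
  have h : 1 < ‖S.𝔭‖⁻¹ := (one_lt_inv₀ S.norm_prime_pos).2 S.norm_prime_lt
  obtain ⟨n, hn⟩ := pow_unbounded_of_one_lt R h
  exact ⟨n, by rw [zpow_neg, zpow_natCast, ← inv_pow]; exact hn.le⟩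

/-! ### The additive character -/

theorem map_sum_char {ι : Type*} (s : Finset ι) (f : ι → K) :
    S.χ (∑ i ∈ s, f i) = ∏ i ∈ s, S.χ (f i) := by
  classical
  induction s using Finset.induction_on with
  | empty => simp
  | insert a s ha ih => rw [Finset.sum_insert ha, Finset.prod_insert ha, ← ih,
      AddChar.map_add_eq_mul]

theorem char_constant {x : K} (hx : x ∈ S.constants) {s : ℤ} (hs : s ≠ 1) :
    S.χ (x * S.𝔭 ^ (-s)) = 1 := by
  obtain ⟨n, rfl⟩ := S.mem_constants.1 hx
  rw [digit_eq_sum, Finset.sum_mul, map_sum_char]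
  refine Finset.prod_eq_one fun i _ => ?_
  rw [mul_assoc, ← nsmul_eq_mul, AddChar.map_nsmul_eq_pow]
  have : S.χ (S.ζ i * S.𝔭 ^ (-s)) = 1 := by
    apply Subtype.ext
    rw [S.char_apply, if_neg fun h => hs h.2]; rfl
  rw [this, one_pow]

theorem char_inv_prime_ne_one : S.χ S.𝔭⁻¹ ≠ 1 := by
  intro h
  have := S.char_apply 0 1
  rw [S.zeta_zero, one_mul, zpow_neg_one, h] at this
  simp only [and_self, if_true] at this
  have hp := (Fact.out : p.Prime)
  have h2 := (Complex.isPrimitiveRoot_exp p hp.ne_zero).ne_one hp.one_lt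
  exact h2 this.symm

/-- Each term of the $\mathfrak p$-adic expansion of an integer has a nonnegative power of
$\mathfrak p$ and is killed by $\chi$; the remainder tends to $0$, and $\chi$ is continuous. -/
theorem char_eq_one_of_norm_le {x : K} (hx : ‖x‖ ≤ 1) : S.χ x = 1 := by
  have key : ∀ M : ℕ, ∃ y : K, ‖y‖ ≤ 1 ∧ S.χ x = S.χ (S.𝔭 ^ M * y) := by
    intro M
    induction M with
    | zero => exact ⟨x, hx, by simp⟩
    | succ M ih =>
      obtain ⟨y, hy, hxy⟩ := ih
      obtain ⟨n, hn⟩ := S.exists_digit hy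
      refine ⟨S.𝔭⁻¹ * (y - S.digit n), by rwa [norm_inv_prime_mul], ?_⟩
      have h1 : S.𝔭 ^ M * y = S.digit n * S.𝔭 ^ (-(-(M : ℤ))) +
          S.𝔭 ^ (M + 1) * (S.𝔭⁻¹ * (y - S.digit n)) := by
        rw [neg_neg, zpow_natCast, pow_succ, mul_assoc, mul_inv_cancel_left₀ S.prime_ne_zero]
        ring
      rw [hxy, h1, AddChar.map_add_eq_mul, S.char_constant (S.digit_mem n) (by omega), one_mul]
  choose y hy hxy using key
  have hlim : Tendsto (fun M : ℕ => S.𝔭 ^ M * y M) atTop (𝓝 0) := by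
    refine squeeze_zero_norm (a := fun M => ‖S.𝔭‖ ^ M) (fun M => ?_)
      (tendsto_pow_atTop_nhds_zero_of_lt_one (norm_nonneg _) S.norm_prime_lt)
    rw [norm_mul, norm_pow]
    exact mul_le_of_le_one_right (by positivity) (hy M)
  have h1 := (S.continuous_char.tendsto 0).comp hlim
  rw [AddChar.map_zero_eq_one] at h1
  refine tendsto_nhds_unique (tendsto_const_nhds (x := S.χ x) (f := (atTop : Filter ℕ))) ?_
  exact h1.congr fun M => (hxy M).symm

/-- The product expands into constants times $\mathfrak p^{-j}$ with $j\ge2$, so $\mathfrak p^{-1}$,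
the only power that $\chi$ sees, never occurs. Products of constants are constants because these
form a field. -/
theorem char_constant_mul_u {x : K} (hx : x ∈ S.constants) (n : ℕ) :
    ∀ s : ℕ, S.χ (x * S.𝔭⁻¹ * S.𝔭⁻¹ ^ s * S.u n) = 1 := by
  induction n using S.index_induction with
  | h0 => simp [u_zero]
  | h r k ih =>
    intro s
    have : x * S.𝔭⁻¹ * S.𝔭⁻¹ ^ s * S.u (r + p ^ c * k) =
        (x * S.digit r) * S.𝔭 ^ (-((s : ℤ) + 2)) + x * S.𝔭⁻¹ * S.𝔭⁻¹ ^ (s + 1) * S.u k := by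
      have h1 : S.𝔭 ^ (-((s : ℤ) + 2)) = S.𝔭⁻¹ * S.𝔭⁻¹ * S.𝔭⁻¹ ^ s := by
        rw [← inv_zpow', zpow_add₀ (inv_ne_zero S.prime_ne_zero), zpow_natCast]
        rw [zpow_ofNat]; ring
      rw [S.u_add_mul r.2, h1]; ring
    rw [this, AddChar.map_add_eq_mul, ih, mul_one]
    exact S.char_constant (mul_mem hx (S.digit_mem r)) (by omega)

/-- This is what makes every $\chi_k$ periodic under all $u(n)$. -/
theorem char_u_mul_u (k l : ℕ) : S.χ (S.u k * S.u l) = 1 := by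
  have : ∀ s : ℕ, S.χ (S.𝔭⁻¹ ^ s * S.u k * S.u l) = 1 := by
    induction k using S.index_induction with
    | h0 => simp [u_zero]
    | h r k ih =>
      intro s
      have h1 := S.char_constant_mul_u (S.digit_mem r) l s
      have h2 := ih (s + 1)
      rw [S.u_add_mul r.2]
      have : S.𝔭⁻¹ ^ s * (S.digit r * S.𝔭⁻¹ + S.𝔭⁻¹ * S.u k) * S.u l =
        S.digit r * S.𝔭⁻¹ * S.𝔭⁻¹ ^ s * S.u l + S.𝔭⁻¹ ^ (s + 1) * S.u k * S.u l := by ring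
      rw [this, AddChar.map_add_eq_mul, h1, h2, one_mul]
  simpa using this 0

theorem continuous_chi (k : ℕ) : Continuous (S.chi k) :=
  continuous_subtype_val.comp (S.continuous_char.comp (continuous_const.mul continuous_id))

theorem norm_chi (k : ℕ) (x : K) : ‖S.chi k x‖ = 1 := Circle.norm_coe _

theorem chi_add (k : ℕ) (x y : K) : S.chi k (x + y) = S.chi k x * S.chi k y := by
  simp [chi, mul_add, AddChar.map_add_eq_mul]

theorem chi_periodic (k n : ℕ) (x : K) : S.chi k (x + S.u n) = S.chi k x := by
  rw [chi_add]; simp [chi, char_u_mul_u]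

theorem chi_add_mul {r : ℕ} (hr : r < p ^ c) (k : ℕ) (x : K) :
    S.chi (r + p ^ c * k) x = S.chi r x * S.chi k (S.𝔭⁻¹ * x) := by
  have : S.u (r + p ^ c * k) * x = S.u r * x + S.u k * (S.𝔭⁻¹ * x) := by
    rw [S.u_add_mul' hr]; ring
  simp [chi, this, AddChar.map_add_eq_mul]

/-- The sum runs over the values of an additive character of the field of constants, so it vanishes
unless that character is trivial. -/
theorem sum_chi_fin {x : K} (hx : ‖x‖ ≤ 1) :
    ∑ r : Fin (p ^ c), S.chi r x = if ‖x‖ ≤ ‖S.𝔭‖ then ((p ^ c : ℕ) : ℂ) else 0 := by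
  split_ifs with h
  · have : ∀ r : Fin (p ^ c), S.chi r x = 1 := by
      intro r
      rw [chi, S.u_of_lt r.2, S.char_eq_one_of_norm_le]; · rfl
      rw [mul_assoc, norm_mul]
      exact mul_le_one₀ (S.norm_digit_le r) (norm_nonneg _) (S.norm_inv_prime_mul.2 h)
    simp [this]
  · have := S.finite_constants
    have := Fintype.ofFinite S.constants
    let e : Fin (p ^ c) ≃ S.constants := Equiv.ofBijective
      (fun n => ⟨S.digit n, S.digit_mem n⟩)
      ⟨fun m n hmn => S.digit_injOn (by
          have : S.digit m = S.digit n := congrArg Subtype.val hmn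
          simp [this]),
        fun ⟨y, hy⟩ => by
          obtain ⟨n, rfl⟩ := S.mem_constants.1 hy
          exact ⟨n, rfl⟩⟩
    let ψ : AddChar S.constants ℂ :=
      { toFun := fun a => ((S.χ ((a : K) * (S.𝔭⁻¹ * x)) : Circle) : ℂ)
        map_zero_eq_one' := by simp
        map_add_eq_mul' := fun a b => by simp [add_mul, AddChar.map_add_eq_mul] }
    have hsum : ∑ r : Fin (p ^ c), S.chi r x = ∑ a, ψ a := by
      rw [← e.sum_comp]
      refine Finset.sum_congr rfl fun r _ => ?_
      simp only [chi, S.u_of_lt r.2, mul_assoc]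
      rfl
    rw [hsum]
    apply AddChar.sum_eq_zero_of_ne_one
    intro hψ
    obtain ⟨n, hn⟩ := S.exists_digit hx
    have hb : S.digit n ≠ 0 := by
      intro h0
      rw [h0, sub_zero] at hn
      exact h hn
    -- At the inverse of the leading digit of $x$ the argument of $\chi$ is $\mathfrak p^{-1}$ plus
    -- an integer, so the value is $\chi(\mathfrak p^{-1})\ne1$.
    have h1 := DFunLike.congr_fun hψ (⟨S.digit n, S.digit_mem n⟩⁻¹ : S.constants)
    have h2 : S.χ ((S.digit n)⁻¹ * (S.𝔭⁻¹ * x)) = 1 := Subtype.ext h1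
    have h3 : (S.digit n)⁻¹ * (S.𝔭⁻¹ * x) =
        S.𝔭⁻¹ + (S.digit n)⁻¹ * (S.𝔭⁻¹ * (x - S.digit n)) := by
      field_simp; ring
    rw [h3, AddChar.map_add_eq_mul, S.char_eq_one_of_norm_le (x := _ * _), mul_one] at h2
    · exact S.char_inv_prime_ne_one h2
    · rw [norm_mul]
      exact mul_le_one₀ (S.norm_le_one_of_mem_constants (inv_mem (S.digit_mem n)))
        (norm_nonneg _) (S.norm_inv_prime_mul.2 hn)

theorem sum_range_mul {M : Type*} [AddCommMonoid M] (f : ℕ → M) (N : ℕ) :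
    ∑ k ∈ Finset.range (p ^ c * N), f k =
      ∑ k ∈ Finset.range N, ∑ r : Fin (p ^ c), f (r + p ^ c * k) := by
  induction N with
  | zero => simp
  | succ N ih =>
    rw [mul_add, mul_one, Finset.sum_range_add, ih, Finset.sum_range_succ,
      ← Fin.sum_univ_eq_sum_range (fun x => f (p ^ c * N + x))]
    simp only [add_comm]

/-- The Dirichlet kernel of length $q^M$ on $\mathfrak D$ is a multiple of the indicator of
$\mathfrak p^M\mathfrak D$. This makes indicators of small balls trigonometric polynomials. -/
theorem sum_chi {x : K} (hx : ‖x‖ ≤ 1) (M : ℕ) :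
    ∑ k ∈ Finset.range ((p ^ c) ^ M), S.chi k x =
      if ‖x‖ ≤ ‖S.𝔭‖ ^ M then (((p ^ c) ^ M : ℕ) : ℂ) else 0 := by
  induction M generalizing x with
  | zero => simp [hx, chi, u_zero]
  | succ M ih =>
    rw [pow_succ', sum_range_mul]
    simp_rw [S.chi_add_mul (Fin.is_lt _), ← Finset.sum_mul]
    rw [← Finset.mul_sum, S.sum_chi_fin hx]
    split_ifs with h1 h2 h2
    · rw [ih (S.norm_inv_prime_mul.2 h1), if_pos]
      · push_cast; ring
      · rwa [norm_mul, norm_inv, inv_mul_le_iff₀ S.norm_prime_pos, ← pow_succ']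
    · rw [ih (S.norm_inv_prime_mul.2 h1), if_neg, mul_zero]
      rwa [norm_mul, norm_inv, inv_mul_le_iff₀ S.norm_prime_pos, ← pow_succ']
    · refine absurd (h2.trans ?_) h1
      exact pow_le_of_le_one S.norm_prime_pos.le S.norm_prime_lt.le (by omega)
    · rw [zero_mul]

end Algebra


/-! ### Haar measure: tiling by cosets of $\mathfrak D$, dilations, periodization. -/

section MeasureTheory

set_option linter.unusedSectionVars false

variable {K : Type*} [NontriviallyNormedField K] {p c : ℕ} [NeZero c] (S : FieldData K p c)
  [Fact p.Prime] [IsUltrametricDist K] [ProperSpace K] [MeasurableSpace K] [BorelSpace K]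
  (μ : Measure K) [μ.IsAddHaarMeasure] [hμ : Fact (μ (Metric.closedBall 0 1) = 1)]

theorem iUnion_closedBall_u : ⋃ n, Metric.closedBall (S.u n) 1 = Set.univ := by
  refine Set.eq_univ_of_forall fun x => ?_
  obtain ⟨M, hM⟩ := S.exists_le_zpow_neg ‖x‖
  obtain ⟨n, -, hn⟩ := S.exists_norm_sub_u_le hM
  exact Set.mem_iUnion.2 ⟨n, by rwa [mem_closedBall_iff_norm]⟩

theorem pairwise_disjoint_closedBall_u :
    Pairwise (Function.onFun Disjoint fun n => Metric.closedBall (S.u n) 1) := by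
  intro m n hmn
  refine Set.disjoint_left.2 fun x hx hy => hmn (S.u_injective ?_)
  rw [mem_closedBall_iff_norm] at hx hy
  simpa using norm_sub_le' hy hx

theorem closedBall_zpow_neg_eq (M : ℕ) : Metric.closedBall (0 : K) (‖S.𝔭‖ ^ (-(M : ℤ))) =
    ⋃ n ∈ Finset.range ((p ^ c) ^ M), Metric.closedBall (S.u n) 1 := by
  ext x
  simp only [Set.mem_iUnion, Finset.mem_range, mem_closedBall_iff_norm, sub_zero, exists_prop]
  refine ⟨fun h => S.exists_norm_sub_u_le h, ?_⟩
  rintro ⟨n, hn, hx⟩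
  have h1 : (1 : ℝ) ≤ ‖S.𝔭‖ ^ (-(M : ℤ)) := by
    rw [zpow_neg, zpow_natCast]
    exact (one_le_inv₀ (pow_pos S.norm_prime_pos _)).2
      (pow_le_one₀ S.norm_prime_pos.le S.norm_prime_lt.le)
  simpa using norm_add_le' (hx.trans h1) (S.norm_u_le hn)

theorem measure_closedBall_one (a : K) : μ (Metric.closedBall a 1) = 1 := by
  rw [Measure.addHaar_closedBall_center, hμ.out]

theorem measure_closedBall_inv :
    μ (Metric.closedBall 0 (‖S.𝔭‖ ^ (-1 : ℤ))) = ((p ^ c : ℕ) : ℝ≥0∞) := by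
  have := S.closedBall_zpow_neg_eq 1
  rw [Nat.cast_one] at this
  rw [this, measure_biUnion_finset (S.pairwise_disjoint_closedBall_u.set_pairwise _)
    fun _ _ => measurableSet_closedBall]
  simp [measure_closedBall_one]

/-- Multiplication by `a ≠ 0` as a measurable equivalence. -/
abbrev dilation (j : ℤ) : K ≃ᵐ K :=
  MeasurableEquiv.mulLeft₀ (S.𝔭 ^ j) (zpow_ne_zero _ S.prime_ne_zero)

/-- By uniqueness of Haar measure the image is a multiple of $\mu$. The factor is $\mu(\mathfrak
p^{-1}\mathfrak D)=q$, a count of cosets. -/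
theorem map_mul_prime :
    μ.map (fun x => S.𝔭 * x) = ENNReal.ofReal ((p ^ c : ℕ) : ℝ) • μ := by
  let e : K ≃+ K :=
    { toFun := fun x => S.𝔭 * x
      invFun := fun x => S.𝔭⁻¹ * x
      left_inv := inv_mul_cancel_left₀ S.prime_ne_zero
      right_inv := mul_inv_cancel_left₀ S.prime_ne_zero
      map_add' := mul_add _ }
  have hc : Continuous e := continuous_const.mul continuous_id
  have hc' : Continuous e.symm := continuous_const.mul continuous_id
  have := e.isAddHaarMeasure_map μ hc hc'
  obtain ⟨r, hr⟩ : ∃ r : ℝ≥0∞, μ.map e = r • μ :=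
    ⟨_, Measure.isAddLeftInvariant_eq_smul (μ.map e) μ⟩
  have h1 : (μ.map e) (Metric.closedBall 0 1) = r := by
    rw [hr, Measure.smul_apply, hμ.out, smul_eq_mul, mul_one]
  rw [Measure.map_apply hc.measurable measurableSet_closedBall] at h1
  have h2 : e ⁻¹' Metric.closedBall 0 1 = Metric.closedBall 0 (‖S.𝔭‖ ^ (-1 : ℤ)) := by
    ext x
    simp only [Set.mem_preimage, mem_closedBall_iff_norm, sub_zero, zpow_neg_one]
    change ‖S.𝔭 * x‖ ≤ 1 ↔ _
    rw [norm_mul, ← le_inv_mul_iff₀ S.norm_prime_pos, mul_one]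
  rw [h2, S.measure_closedBall_inv μ] at h1
  change μ.map e = _
  rw [hr, ← h1, ENNReal.ofReal_natCast]

theorem q_real_pos (S : FieldData K p c) : (0 : ℝ) < ((p ^ c : ℕ) : ℝ) := by exact_mod_cast S.q_pos

theorem map_dilation (j : ℤ) :
    μ.map (S.dilation j) = ENNReal.ofReal (((p ^ c : ℕ) : ℝ) ^ j) • μ := by
  have hq := S.q_real_pos
  have hm : ∀ a : K, Measurable fun x : K => a * x := fun a => measurable_const_mul a
  change μ.map (fun x => S.𝔭 ^ j * x) = _
  have step : ∀ j : ℤ, μ.map (fun x => S.𝔭 ^ (j + 1) * x) =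
      ENNReal.ofReal ((p ^ c : ℕ) : ℝ) • μ.map (fun x => S.𝔭 ^ j * x) := by
    intro j
    have : (fun x => S.𝔭 ^ (j + 1) * x) = (fun x => S.𝔭 ^ j * x) ∘ fun x => S.𝔭 * x := by
      funext x
      simp [zpow_add₀ S.prime_ne_zero, mul_assoc]
    rw [this, ← Measure.map_map (hm _) (hm _), S.map_mul_prime μ, Measure.map_smul]
  induction j using Int.induction_on with
  | zero => simp
  | succ j ih =>
    rw [step, ih, smul_smul, ← ENNReal.ofReal_mul hq.le, zpow_add₀ hq.ne', zpow_one, mul_comm]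
  | pred j ih =>
    have h := step (-(j : ℤ) - 1)
    rw [sub_add_cancel, ih] at h
    have h2 := congrArg (fun ν => ENNReal.ofReal (((p ^ c : ℕ) : ℝ)⁻¹) • ν) h
    simp only [smul_smul] at h2
    rw [← ENNReal.ofReal_mul (by positivity), ← ENNReal.ofReal_mul (by positivity),
      inv_mul_cancel₀ hq.ne', ENNReal.ofReal_one, one_smul] at h2
    rw [← h2, zpow_sub₀ hq.ne', zpow_one, div_eq_inv_mul]

theorem integral_dilation {E : Type*} [NormedAddCommGroup E] [NormedSpace ℝ E] (j : ℤ)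
    (f : K → E) : ∫ x, f (S.𝔭 ^ j * x) ∂μ = ((p ^ c : ℕ) : ℝ) ^ j • ∫ x, f x ∂μ := by
  have := (S.dilation j).measurableEmbedding.integral_map (μ := μ) f
  rw [S.map_dilation μ, integral_smul_measure, ENNReal.toReal_ofReal (by positivity)] at this
  exact this.symm

theorem lintegral_dilation (j : ℤ) (f : K → ℝ≥0∞) :
    ∫⁻ x, f (S.𝔭 ^ j * x) ∂μ = ENNReal.ofReal (((p ^ c : ℕ) : ℝ) ^ j) * ∫⁻ x, f x ∂μ := by
  have := (S.dilation j).measurableEmbedding.lintegral_map (μ := μ) f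
  rw [S.map_dilation μ, lintegral_smul_measure] at this
  exact this.symm

theorem eLpNorm_dilation (j : ℤ) (f : K → ℂ) :
    eLpNorm (fun x => f (S.𝔭 ^ j * x)) 2 μ =
      ENNReal.ofReal (((p ^ c : ℕ) : ℝ) ^ ((j : ℝ) / 2)) * eLpNorm f 2 μ := by
  have hq := S.q_real_pos
  have := (S.dilation j).measurableEmbedding.eLpNorm_map_measure (μ := μ) (g := f) (p := 2)
  rw [S.map_dilation μ, eLpNorm_smul_measure_of_ne_top (by simp)] at this
  refine this.symm.trans ?_
  rw [smul_eq_mul, ENNReal.ofReal_rpow_of_pos (by positivity), ← Real.rpow_intCast,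
    ← Real.rpow_mul hq.le]
  simp [div_eq_mul_inv]

theorem quasiMeasurePreserving_dilation (j : ℤ) :
    Measure.QuasiMeasurePreserving (fun x => S.𝔭 ^ j * x) μ μ := by
  refine ⟨measurable_const_mul _, ?_⟩
  have := S.map_dilation μ j
  change μ.map (fun x => S.𝔭 ^ j * x) = _ at this
  rw [this]
  exact Measure.smul_absolutelyContinuous

theorem memLp_dilation (j : ℤ) {f : K → ℂ} (hf : MemLp f 2 μ) :
    MemLp (fun x => f (S.𝔭 ^ j * x)) 2 μ :=
  ⟨hf.1.comp_quasiMeasurePreserving (S.quasiMeasurePreserving_dilation μ j), by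
    rw [S.eLpNorm_dilation μ]
    exact ENNReal.mul_lt_top ENNReal.ofReal_lt_top hf.2⟩

theorem setIntegral_closedBall_u (F : K → ℂ) (n : ℕ) :
    ∫ x in Metric.closedBall (S.u n) 1, F x ∂μ =
      ∫ x in Metric.closedBall 0 1, F (x + S.u n) ∂μ := by
  have h := (measurePreserving_add_right μ (S.u n)).setIntegral_preimage_emb
    (MeasurableEquiv.addRight (S.u n)).measurableEmbedding F (Metric.closedBall (S.u n) 1)
  rw [← h]
  congr 2
  ext x
  simp

/-- Periodization of an integral over `𝔭^{-M} 𝔇`. -/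
theorem setIntegral_eq_sum_u (M : ℕ) {F : K → ℂ} (hF : Integrable F μ) :
    ∫ x in Metric.closedBall 0 (‖S.𝔭‖ ^ (-(M : ℤ))), F x ∂μ =
      ∑ n ∈ Finset.range ((p ^ c) ^ M), ∫ x in Metric.closedBall 0 1, F (x + S.u n) ∂μ := by
  rw [S.closedBall_zpow_neg_eq M, integral_biUnion_finset _ (fun _ _ => measurableSet_closedBall)
    (S.pairwise_disjoint_closedBall_u.set_pairwise _) fun _ _ => hF.integrableOn]
  exact Finset.sum_congr rfl fun n _ => S.setIntegral_closedBall_u μ F n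

/-- The integral of a function that is constant on the cosets of the ring of integers. -/
theorem lintegral_eq_tsum_u {H : K → ℝ≥0∞} (hH : ∀ x y, ‖y‖ ≤ 1 → H (x + y) = H x) :
    ∫⁻ x, H x ∂μ = ∑' n, H (S.u n) := by
  rw [← setLIntegral_univ, ← S.iUnion_closedBall_u, lintegral_iUnion
    (fun _ => measurableSet_closedBall) S.pairwise_disjoint_closedBall_u]
  refine tsum_congr fun n => ?_
  rw [setLIntegral_congr_fun (g := fun _ => H (S.u n)) measurableSet_closedBall,
    setLIntegral_const, measure_closedBall_one, mul_one]
  intro x hx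
  rw [mem_closedBall_iff_norm] at hx
  simpa using hH (S.u n) (x - S.u n) hx

theorem ae_of_forall_u {P : K → Prop}
    (h : ∀ n, ∀ᵐ x ∂μ.restrict (Metric.closedBall 0 1), P (x + S.u n)) : ∀ᵐ x ∂μ, P x := by
  rw [← Measure.restrict_univ (μ := μ), ← S.iUnion_closedBall_u, ae_restrict_iUnion_iff]
  intro n
  have := (measurePreserving_add_right μ (S.u n)).restrict_preimage_emb
    (MeasurableEquiv.addRight (S.u n)).measurableEmbedding (Metric.closedBall (S.u n) 1)
  have hpre : (fun x => x + S.u n) ⁻¹' Metric.closedBall (S.u n) 1 =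
      Metric.closedBall 0 1 := by
    ext x
    simp
  rw [hpre] at this
  rw [← this.map_eq]
  exact (MeasurableEquiv.addRight (S.u n)).measurableEmbedding.ae_map_iff.2 (h n)

theorem setIntegral_char {η : K} :
    ∫ x in Metric.closedBall 0 1, ((S.χ (η * x) : Circle) : ℂ) ∂μ = if ‖η‖ ≤ 1 then 1 else 0 := by
  split_ifs with h
  · rw [setIntegral_congr_fun (g := fun _ => 1) measurableSet_closedBall]
    · simp [Measure.real, hμ.out]
    · intro x hx
      rw [mem_closedBall_iff_norm, sub_zero] at hx
      simp only
      rw [S.char_eq_one_of_norm_le]; · rfl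
      rw [norm_mul]
      exact mul_le_one₀ h (norm_nonneg _) hx
  · push Not at h
    have hη : η ≠ 0 := by rintro rfl; simp at h; linarith
    -- Since $|\eta|>1$, this $y$ is an integer; translation by $y$ preserves $\mathfrak D$ and
    -- multiplies the integral by $\chi(\mathfrak p^{-1})\ne1$.
    set y : K := η⁻¹ * S.𝔭⁻¹ with hy
    have hy1 : ‖y‖ ≤ 1 := by
      rw [hy, mul_comm, norm_inv_prime_mul]
      exact S.norm_prime_max _ (by rw [norm_inv]; exact inv_lt_one_of_one_lt₀ h)
    set I := ∫ x in Metric.closedBall 0 1, ((S.χ (η * x) : Circle) : ℂ) ∂μ with hI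
    have h1 : I = ((S.χ S.𝔭⁻¹ : Circle) : ℂ) * I := by
      have h := (measurePreserving_add_right μ y).setIntegral_preimage_emb
        (MeasurableEquiv.addRight y).measurableEmbedding
        (fun x => ((S.χ (η * x) : Circle) : ℂ)) (Metric.closedBall 0 1)
      have hpre : (fun x => x + y) ⁻¹' Metric.closedBall 0 1 = Metric.closedBall (0 : K) 1 := by
        ext x
        simp only [Set.mem_preimage, mem_closedBall_iff_norm, sub_zero]
        refine ⟨fun h => ?_, fun h => norm_add_le' h hy1⟩
        simpa using norm_sub_le' h hy1
      rw [hpre] at h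
      rw [hI]
      conv_lhs => rw [← h]
      rw [← integral_const_mul]
      refine integral_congr_ae (ae_of_all _ fun x => ?_)
      simp only [mul_add, AddChar.map_add_eq_mul, hy, mul_inv_cancel_left₀ hη, Circle.coe_mul]
      exact mul_comm _ _
    have h2 : (((S.χ S.𝔭⁻¹ : Circle) : ℂ) - 1) * I = 0 := by rw [sub_mul, ← h1, one_mul, sub_self]
    rcases mul_eq_zero.1 h2 with h3 | h3
    · exact absurd (Subtype.ext (sub_eq_zero.1 h3)) S.char_inv_prime_ne_one
    · exact h3

end MeasureTheory

end FieldData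

/-! ### Inner products and norms in $L^2$. -/

section L2

variable {α : Type*} {m : MeasurableSpace α} {ν : Measure α}

theorem inner_toLp {f g : α → ℂ} (hf : MemLp f 2 ν) (hg : MemLp g 2 ν) :
    inner ℂ (hf.toLp f) (hg.toLp g) = ∫ x, g x * conj (f x) ∂ν := by
  rw [L2.inner_def]
  refine integral_congr_ae ?_
  filter_upwards [hf.coeFn_toLp, hg.coeFn_toLp] with x hx hy
  rw [hx, hy]; rfl

theorem eLpNorm_two_sq (f : α → ℂ) : eLpNorm f 2 ν ^ 2 = ∫⁻ x, ‖f x‖ₑ ^ 2 ∂ν := by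
  have := eLpNorm_nnreal_pow_eq_lintegral (f := f) (μ := ν) (p := 2) (by norm_num)
  simpa using this

theorem tsum_enorm_inner_sq {ι E : Type*} [NormedAddCommGroup E] [InnerProductSpace ℂ E]
    (b : HilbertBasis ι ℂ E) (x : E) : ∑' i, ‖inner ℂ (b i) x‖ₑ ^ 2 = ‖x‖ₑ ^ 2 := by
  have h := Complex.hasSum_re (b.hasSum_inner_mul_inner x x)
  have h1 : ∀ i, (inner ℂ x (b i) * inner ℂ (b i) x).re = ‖inner ℂ (b i) x‖ ^ 2 := by
    intro i
    rw [← inner_conj_symm, ← Complex.normSq_eq_conj_mul_self, Complex.normSq_eq_norm_sq,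
      Complex.ofReal_re]
  have h2 : (inner ℂ x x).re = ‖x‖ ^ 2 := by
    have := inner_self_eq_norm_sq (𝕜 := ℂ) x
    simpa using this
  simp_rw [h1, h2] at h
  have h3 := ENNReal.ofReal_tsum_of_nonneg (fun i => by positivity) h.summable
  rw [h.tsum_eq] at h3
  simpa [ENNReal.ofReal_pow] using h3.symm

end L2

namespace FieldData

/-! ### The characters $\chi_k$ as an orthonormal basis of $L^2(\mathfrak D)$. -/

section Parseval

set_option linter.unusedSectionVars false

variable {K : Type*} [NontriviallyNormedField K] {p c : ℕ} [NeZero c] (S : FieldData K p c)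
  [Fact p.Prime] [IsUltrametricDist K] [ProperSpace K] [MeasurableSpace K] [BorelSpace K]
  (μ : Measure K) [μ.IsAddHaarMeasure] [hμ : Fact (μ (Metric.closedBall 0 1) = 1)]

/-- The balls of radius `|𝔭|^n`, `n ∈ ℕ`. -/
def smallBalls : Set (Set K) := {s | ∃ (a : K) (n : ℕ), s = Metric.closedBall a (‖S.𝔭‖ ^ n)}

theorem isTopologicalBasis_smallBalls : TopologicalSpace.IsTopologicalBasis S.smallBalls := by
  refine TopologicalSpace.isTopologicalBasis_of_isOpen_of_nhds ?_ ?_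
  · rintro _ ⟨a, n, rfl⟩
    exact IsUltrametricDist.isOpen_closedBall _ (pow_pos S.norm_prime_pos n).ne'
  · intro a U ha hU
    obtain ⟨ε, hε, hball⟩ := Metric.isOpen_iff.1 hU a ha
    obtain ⟨n, hn⟩ := exists_pow_lt_of_lt_one hε S.norm_prime_lt
    exact ⟨_, ⟨a, n, rfl⟩, Metric.mem_closedBall_self (pow_pos S.norm_prime_pos n).le,
      (Metric.closedBall_subset_ball hn).trans hball⟩

theorem isPiSystem_smallBalls : IsPiSystem S.smallBalls := by
  rintro _ ⟨a, m, rfl⟩ _ ⟨b, n, rfl⟩ ⟨x, hx⟩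
  rcases IsUltrametricDist.closedBall_subset_trichotomy (x := a) (r := ‖S.𝔭‖ ^ m) (y := b)
    (s := ‖S.𝔭‖ ^ n) with h | h | h
  · rw [Set.inter_eq_left.2 h]; exact ⟨a, m, rfl⟩
  · rw [Set.inter_eq_right.2 h]; exact ⟨b, n, rfl⟩
  · exact absurd hx.2 (Set.disjoint_left.1 h hx.1)

/-- An integrable function whose integrals over all small balls vanish is zero. -/
theorem ae_eq_zero_of_setIntegral_closedBall {ν : Measure K} {f : K → ℂ} (hf : Integrable f ν)
    (h0 : ∫ x, f x ∂ν = 0)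
    (h : ∀ (a : K) (n : ℕ), ∫ x in Metric.closedBall a (‖S.𝔭‖ ^ n), f x ∂ν = 0) :
    f =ᵐ[ν] 0 := by
  have hgen : (inferInstance : MeasurableSpace K) = MeasurableSpace.generateFrom S.smallBalls := by
    rw [← S.isTopologicalBasis_smallBalls.borel_eq_generateFrom]
    exact BorelSpace.measurable_eq
  refine hf.ae_eq_zero_of_forall_setIntegral_eq_zero fun s hs hlt => ?_
  clear hlt
  induction s, hs using MeasurableSpace.induction_on_inter hgen S.isPiSystem_smallBalls with
  | empty => simp
  | basic t ht =>
    obtain ⟨a, n, rfl⟩ := ht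
    exact h a n
  -- The whole space is not a small ball, so complements need the vanishing of the total integral.
  | compl t ht ih =>
    have := integral_add_compl ht hf
    rwa [ih, zero_add, h0] at this
  | iUnion g hd hm ih =>
    rw [integral_iUnion hm hd hf.integrableOn]
    simp [ih]

/-- Haar measure on the ring of integers. -/
abbrev unitMeasure (μ : Measure K) : Measure K := μ.restrict (Metric.closedBall 0 1)

theorem memLp_conj_chi (k : ℕ) :
    MemLp (fun x => conj (S.chi k x)) 2 (unitMeasure μ) := by
  have : IsFiniteMeasure (unitMeasure μ) := ⟨by simp [hμ.out]⟩
  refine MemLp.of_bound (C := 1) ?_ (ae_of_all _ fun x => ?_)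
  · exact (Complex.continuous_conj.comp (S.continuous_chi k)).aestronglyMeasurable
  · rw [RCLike.norm_conj, norm_chi]

/-- The conjugate characters, in `L²` of the ring of integers. -/
def charLp (k : ℕ) : Lp ℂ 2 (unitMeasure μ) := (S.memLp_conj_chi μ k).toLp _

theorem inner_charLp {f : K → ℂ} (hf : MemLp f 2 (unitMeasure μ)) (k : ℕ) :
    inner ℂ (S.charLp μ k) (hf.toLp f) = ∫ x, f x * S.chi k x ∂(unitMeasure μ) := by
  rw [charLp, inner_toLp]
  simp

theorem orthonormal_charLp : Orthonormal ℂ (S.charLp μ) := by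
  rw [orthonormal_iff_ite]
  intro k l
  conv_lhs => rw [charLp.eq_1 S μ l, inner_charLp]
  have : ∀ x, conj (S.chi l x) * S.chi k x = ((S.χ ((S.u k - S.u l) * x) : Circle) : ℂ) := by
    intro x
    rw [sub_mul, sub_eq_add_neg, AddChar.map_add_eq_mul, AddChar.map_neg_eq_inv, Circle.coe_mul,
      Circle.coe_inv_eq_conj, mul_comm]
    rfl
  simp_rw [this]
  rw [S.setIntegral_char μ]
  by_cases h : k = l
  · simp [h]
  · rw [if_neg h, if_neg fun h' => h (S.u_injective h')]

theorem indicator_closedBall_eq_sum {a x : K} (hx : ‖x - a‖ ≤ 1) (n : ℕ) :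
    (Metric.closedBall a (‖S.𝔭‖ ^ n)).indicator (fun _ => (1 : ℂ)) x =
      (((p ^ c) ^ n : ℕ) : ℂ)⁻¹ * ∑ k ∈ Finset.range ((p ^ c) ^ n), S.chi k (-a) * S.chi k x := by
  have h1 : ∀ k, S.chi k (-a) * S.chi k x = S.chi k (x - a) := fun k => by
    rw [← chi_add, neg_add_eq_sub]
  have hq : (((p ^ c) ^ n : ℕ) : ℂ) ≠ 0 := by exact_mod_cast (pow_pos S.q_pos n).ne'
  simp_rw [h1, S.sum_chi hx]
  split_ifs with h
  · rw [inv_mul_cancel₀ hq, Set.indicator_of_mem (mem_closedBall_iff_norm.2 h)]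
  · rw [mul_zero, Set.indicator_of_notMem fun h' => h (mem_closedBall_iff_norm.1 h')]

/-- Completeness: a small ball that meets $\mathfrak D$ has an indicator which on $\mathfrak D$ is a
finite combination of the $\chi_k$, so vanishing coefficients force vanishing integrals over all
small balls. -/
theorem ae_eq_zero_of_coeff_eq_zero {f : K → ℂ} (hf : MemLp f 2 (unitMeasure μ))
    (h : ∀ k, ∫ x, f x * S.chi k x ∂(unitMeasure μ) = 0) : f =ᵐ[unitMeasure μ] 0 := by
  have : IsFiniteMeasure (unitMeasure μ) := ⟨by simp [hμ.out]⟩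
  have hi : Integrable f (unitMeasure μ) := hf.integrable (by norm_num)
  have hik : ∀ k, Integrable (fun x => f x * S.chi k x) (unitMeasure μ) := fun k =>
    hi.mul_bdd (c := 1) (S.continuous_chi k).aestronglyMeasurable
      (ae_of_all _ fun x => (S.norm_chi k x).le)
  have h0 : ∫ x, f x ∂(unitMeasure μ) = 0 := by simpa [chi, u_zero] using h 0
  refine S.ae_eq_zero_of_setIntegral_closedBall hi h0 fun a n => ?_
  by_cases hdis : Disjoint (Metric.closedBall a (‖S.𝔭‖ ^ n)) (Metric.closedBall (0 : K) 1)
  · rw [Measure.restrict_restrict measurableSet_closedBall, hdis.inter_eq]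
    simp
  · obtain ⟨b, hb, hb1⟩ := Set.not_disjoint_iff.1 hdis
    rw [IsUltrametricDist.closedBall_eq_of_mem hb, ← integral_indicator measurableSet_closedBall]
    rw [mem_closedBall_iff_norm, sub_zero] at hb1
    have h2 : ∀ᵐ x ∂(unitMeasure μ),
        (Metric.closedBall b (‖S.𝔭‖ ^ n)).indicator f x = (((p ^ c) ^ n : ℕ) : ℂ)⁻¹ *
          ∑ k ∈ Finset.range ((p ^ c) ^ n), S.chi k (-b) * (f x * S.chi k x) := by
      filter_upwards [ae_restrict_mem measurableSet_closedBall] with x hx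
      rw [mem_closedBall_iff_norm, sub_zero] at hx
      have h3 : (Metric.closedBall b (‖S.𝔭‖ ^ n)).indicator f x =
          (Metric.closedBall b (‖S.𝔭‖ ^ n)).indicator (fun _ => (1 : ℂ)) x * f x := by
        by_cases hxb : x ∈ Metric.closedBall b (‖S.𝔭‖ ^ n) <;> simp [hxb]
      rw [h3, S.indicator_closedBall_eq_sum (norm_sub_le' hx hb1), mul_assoc, Finset.sum_mul]
      congr 1
      exact Finset.sum_congr rfl fun k _ => by ring
    rw [integral_congr_ae h2, integral_const_mul, integral_finsetSum _
      fun k _ => (hik k).const_mul _]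
    simp [integral_const_mul, h]

/-- The characters `χ_k` form a Hilbert basis of `L²` of the ring of integers. -/
def charBasis : HilbertBasis ℕ ℂ (Lp ℂ 2 (unitMeasure μ)) :=
  HilbertBasis.mkOfOrthogonalEqBot (S.orthonormal_charLp μ) (by
    rw [Submodule.eq_bot_iff]
    intro f hf
    have hf' : MemLp f 2 (unitMeasure μ) := Lp.memLp f
    refine (Lp.eq_zero_iff_ae_eq_zero).2 (S.ae_eq_zero_of_coeff_eq_zero μ hf' fun k => ?_)
    rw [← S.inner_charLp μ hf', Lp.toLp_coeFn]
    exact hf _ (Submodule.subset_span ⟨k, rfl⟩))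

theorem charBasis_apply (k : ℕ) : S.charBasis μ k = S.charLp μ k := by
  rw [charBasis, HilbertBasis.coe_mkOfOrthogonalEqBot]

/-- Parseval's identity on the ring of integers. -/
theorem hasSum_coeff_mul_conj {X Y : K → ℂ} (hX : MemLp X 2 (unitMeasure μ))
    (hY : MemLp Y 2 (unitMeasure μ)) :
    HasSum (fun k => (∫ x, X x * S.chi k x ∂(unitMeasure μ)) *
      conj (∫ x, Y x * S.chi k x ∂(unitMeasure μ))) (∫ x, X x * conj (Y x) ∂(unitMeasure μ)) := by
  have h := (S.charBasis μ).hasSum_inner_mul_inner (hY.toLp Y) (hX.toLp X)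
  rw [inner_toLp] at h
  convert! h using 2 with k
  rw [charBasis_apply, ← inner_conj_symm (hY.toLp Y), inner_charLp, inner_charLp, mul_comm]

theorem tsum_enorm_coeff_sq {X : K → ℂ} (hX : MemLp X 2 (unitMeasure μ)) :
    ∑' k, ‖∫ x, X x * S.chi k x ∂(unitMeasure μ)‖ₑ ^ 2 = ∫⁻ x, ‖X x‖ₑ ^ 2 ∂(unitMeasure μ) := by
  have h := tsum_enorm_inner_sq (S.charBasis μ) (hX.toLp X)
  rw [Lp.enorm_toLp, eLpNorm_two_sq] at h
  simpa only [charBasis_apply, inner_charLp] using h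

end Parseval


/-! ### The Fourier integral and Plancherel's formula for bounded support. -/

section Fourier

set_option linter.unusedSectionVars false

variable {K : Type*} [NontriviallyNormedField K] {p c : ℕ} [NeZero c] (S : FieldData K p c)
  [Fact p.Prime] [IsUltrametricDist K] [ProperSpace K] [MeasurableSpace K] [BorelSpace K]
  (μ : Measure K) [μ.IsAddHaarMeasure] [hμ : Fact (μ (Metric.closedBall 0 1) = 1)]

/-- The Fourier integral `∫ f(x) χ(-ξ x) dx`. -/
abbrev fint (f : K → ℂ) : K → ℂ := Fourier.fourierIntegral S.χ μ f

theorem fint_apply (f : K → ℂ) (ξ : K) :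
    S.fint μ f ξ = ∫ x, ((S.χ (-(x * ξ)) : Circle) : ℂ) * f x ∂μ := rfl

theorem fint_congr {f g : K → ℂ} (h : f =ᵐ[μ] g) : S.fint μ f = S.fint μ g :=
  VectorFourier.fourierIntegral_congr_ae _ _ _ h

theorem fint_add {f g : K → ℂ} (hf : Integrable f μ) (hg : Integrable g μ) :
    S.fint μ (f + g) = S.fint μ f + S.fint μ g :=
  VectorFourier.fourierIntegral_add S.continuous_char continuous_mul hf hg

theorem continuous_fint {f : K → ℂ} (hf : Integrable f μ) : Continuous (S.fint μ f) :=
  VectorFourier.fourierIntegral_continuous S.continuous_char continuous_mul hf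

theorem fint_dilation (j : ℤ) (f : K → ℂ) (ξ : K) : S.fint μ (fun x => f (S.𝔭 ^ j * x)) ξ =
    (((p ^ c : ℕ) : ℝ) ^ j : ℝ) • S.fint μ f (S.𝔭 ^ (-j) * ξ) := by
  have h := S.integral_dilation μ j
    fun y => ((S.χ (-(y * (S.𝔭 ^ (-j) * ξ))) : Circle) : ℂ) * f y
  rw [fint_apply, fint_apply, ← h]
  refine integral_congr_ae (ae_of_all _ fun x => ?_)
  have : x * ξ = S.𝔭 ^ j * x * (S.𝔭 ^ (-j) * ξ) := by
    rw [zpow_neg]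
    field_simp [S.prime_ne_zero]
  simp only [this]

theorem fint_translate (a : K) (f : K → ℂ) (ξ : K) :
    S.fint μ (fun x => f (x - a)) ξ = ((S.χ (-(a * ξ)) : Circle) : ℂ) * S.fint μ f ξ := by
  have h := congrFun (Fourier.fourierIntegral_comp_add_right S.χ μ f (-a)) ξ
  simp only [neg_mul, ← sub_eq_add_neg] at h
  exact h

theorem memLp_indicator_closedBall {f : K → ℂ} (hf : MemLp f 2 μ) (r : ℝ) :
    MemLp ((Metric.closedBall (0 : K) r).indicator f) 2 μ := hf.indicator measurableSet_closedBall

theorem integrable_of_bounded_support {f : K → ℂ} (hf : MemLp f 2 μ) {r : ℝ}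
    (hr : ∀ x, r < ‖x‖ → f x = 0) : Integrable f μ := by
  have : IsFiniteMeasure (μ.restrict (Metric.closedBall (0 : K) r)) :=
    ⟨by simpa using (isCompact_closedBall (0 : K) r).measure_lt_top⟩
  have h1 : IntegrableOn f (Metric.closedBall 0 r) μ := (hf.restrict _).integrable (by norm_num)
  refine h1.integrable_of_forall_notMem_eq_zero fun x hx => hr x ?_
  simpa using hx

theorem integrable_indicator_closedBall {f : K → ℂ} (hf : MemLp f 2 μ) (r : ℝ) :
    Integrable ((Metric.closedBall (0 : K) r).indicator f) μ :=
  integrable_of_bounded_support μ (memLp_indicator_closedBall μ hf r) fun x hx =>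
    Set.indicator_of_notMem (by simpa using hx) _

/-- If $f$ lives on $\mathfrak D$, then $\hat f$ is constant on cosets of $\mathfrak D$, and its
values at the $u(k)$ are the Fourier coefficients of $f$ on $\mathfrak D$. Plancherel is then
Parseval's identity on $\mathfrak D$. -/
theorem eLpNorm_fint_of_unit {f : K → ℂ} (hf : MemLp f 2 μ) (h1 : ∀ x, 1 < ‖x‖ → f x = 0) :
    eLpNorm (S.fint μ f) 2 μ = eLpNorm f 2 μ := by
  have hsupp : ∀ ξ, S.fint μ f ξ =
      ∫ x, ((S.χ (-(x * ξ)) : Circle) : ℂ) * f x ∂(unitMeasure μ) := by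
    intro ξ
    rw [fint_apply, setIntegral_eq_integral_of_forall_compl_eq_zero]
    intro x hx
    rw [h1 x (by simpa using hx), mul_zero]
  have hper : ∀ x y, ‖y‖ ≤ 1 → ‖S.fint μ f (x + y)‖ₑ ^ 2 = ‖S.fint μ f x‖ₑ ^ 2 := by
    intro x y hy
    rw [hsupp, hsupp]
    congr 2
    refine setIntegral_congr_fun measurableSet_closedBall fun v hv => ?_
    rw [mem_closedBall_iff_norm, sub_zero] at hv
    rw [mul_add, neg_add, AddChar.map_add_eq_mul, S.char_eq_one_of_norm_le (x := -(v * y)), mul_one]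
    rw [norm_neg, norm_mul]
    exact mul_le_one₀ hv (norm_nonneg _) hy
  have hsq : eLpNorm (S.fint μ f) 2 μ ^ 2 = eLpNorm f 2 μ ^ 2 := by
    rw [eLpNorm_two_sq, eLpNorm_two_sq, S.lintegral_eq_tsum_u μ hper]
    have hP := S.tsum_enorm_coeff_sq μ (X := fun x => conj (f x)) (hf.restrict _).star
    calc ∑' n, ‖S.fint μ f (S.u n)‖ₑ ^ 2
        = ∑' k, ‖∫ x, conj (f x) * S.chi k x ∂(unitMeasure μ)‖ₑ ^ 2 := by
          refine tsum_congr fun k => ?_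
          rw [hsupp, ← RCLike.enorm_conj (∫ x, conj (f x) * S.chi k x ∂(unitMeasure μ)),
            ← integral_conj]
          congr 3
          funext x
          rw [map_mul, Complex.conj_conj, mul_comm (f x), AddChar.map_neg_eq_inv,
            Circle.coe_inv_eq_conj, mul_comm x]
          rfl
      _ = ∫⁻ x, ‖f x‖ₑ ^ 2 ∂(unitMeasure μ) := by
          rw [hP]
          simp only [RCLike.enorm_conj]
      _ = ∫⁻ x, ‖f x‖ₑ ^ 2 ∂μ := by
          refine setLIntegral_eq_of_support_subset fun x hx => ?_
          by_contra h
          exact hx (by simp [h1 x (by simpa using h)])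
  exact (ENNReal.pow_right_strictMono two_ne_zero).injective hsq

/-- Plancherel's formula for functions with bounded support. -/
theorem eLpNorm_fint {f : K → ℂ} (hf : MemLp f 2 μ) {r : ℝ} (hr : ∀ x, r < ‖x‖ → f x = 0) :
    eLpNorm (S.fint μ f) 2 μ = eLpNorm f 2 μ := by
  obtain ⟨M, hM⟩ := S.exists_le_zpow_neg r
  have hq := S.q_real_pos
  -- The dilation moves the support into $\mathfrak D$; it scales both norms by $q^{-M/2}$, and this
  -- factor cancels.
  have h1 := S.eLpNorm_fint_of_unit μ (f := fun x => f (S.𝔭 ^ (-(M : ℤ)) * x))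
    (S.memLp_dilation μ _ hf) (fun x hx => hr _ (hM.trans_lt (by
      rw [norm_mul, norm_zpow]
      exact lt_mul_of_one_lt_right (zpow_pos S.norm_prime_pos _) hx)))
  have h2 : S.fint μ (fun x => f (S.𝔭 ^ (-(M : ℤ)) * x)) =
      ((((p ^ c : ℕ) : ℝ) ^ (-(M : ℤ)) : ℝ) : ℂ) • fun ξ => S.fint μ f (S.𝔭 ^ (M : ℤ) * ξ) := by
    funext ξ
    rw [fint_dilation, neg_neg, Pi.smul_apply, Complex.coe_smul]
  rw [h2, eLpNorm_const_smul, S.eLpNorm_dilation μ, S.eLpNorm_dilation μ, ← mul_assoc,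
    ← ofReal_norm, Complex.norm_real, Real.norm_of_nonneg (by positivity),
    ← ENNReal.ofReal_mul (by positivity), ← Real.rpow_intCast, ← Real.rpow_add hq] at h1
  have h3 : ((-(M : ℤ) : ℤ) : ℝ) + ((M : ℤ) : ℝ) / 2 = ((-(M : ℤ) : ℤ) : ℝ) / 2 := by
    push_cast; ring
  rw [h3] at h1
  exact (ENNReal.mul_right_inj (ENNReal.ofReal_pos.2 (by positivity)).ne'
    ENNReal.ofReal_ne_top).1 h1

theorem memLp_fint {f : K → ℂ} (hf : MemLp f 2 μ) {r : ℝ} (hr : ∀ x, r < ‖x‖ → f x = 0) :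
    MemLp (S.fint μ f) 2 μ :=
  ⟨(S.continuous_fint μ (integrable_of_bounded_support μ hf hr)).aestronglyMeasurable, by
    rw [S.eLpNorm_fint μ hf hr]; exact hf.2⟩

theorem tendsto_eLpNorm_of_sq {f : ℕ → K → ℂ} {ν : Measure K}
    (h : Tendsto (fun n => ∫⁻ x, ‖f n x‖ₑ ^ 2 ∂ν) atTop (𝓝 0)) :
    Tendsto (fun n => eLpNorm (f n) 2 ν) atTop (𝓝 0) := by
  have h1 := (ENNReal.continuous_rpow_const (y := (1 / 2 : ℝ))).tendsto 0 |>.comp h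
  rw [ENNReal.zero_rpow_of_pos (by norm_num)] at h1
  refine h1.congr fun n => ?_
  simp only [Function.comp]
  rw [← eLpNorm_two_sq, ← ENNReal.rpow_natCast, ← ENNReal.rpow_mul]
  norm_num

theorem tendsto_eLpNorm_sub_indicator {f : K → ℂ} (hf : MemLp f 2 μ) :
    Tendsto (fun n : ℕ => eLpNorm (fun x => f x - (Metric.closedBall (0 : K) n).indicator f x) 2 μ)
      atTop (𝓝 0) := by
  refine tendsto_eLpNorm_of_sq ?_
  have := tendsto_lintegral_of_dominated_convergence' (μ := μ)
    (F := fun (n : ℕ) x => ‖f x - (Metric.closedBall (0 : K) n).indicator f x‖ₑ ^ 2)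
    (f := fun _ => 0) (fun x => ‖f x‖ₑ ^ 2)
    (fun n => ((hf.1.sub (memLp_indicator_closedBall μ hf n).1).enorm).pow_const 2)
    (fun n => ae_of_all _ fun x => ?_) ?_ (ae_of_all _ fun x => ?_)
  · simpa using this
  · by_cases hx : x ∈ Metric.closedBall (0 : K) n <;> simp [hx]
  · rw [← eLpNorm_two_sq]
    exact (ENNReal.pow_lt_top hf.2).ne
  · refine tendsto_const_nhds.congr' ?_
    filter_upwards [eventually_ge_atTop ⌈‖x‖⌉₊] with n hn
    have : x ∈ Metric.closedBall (0 : K) n := by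
      simpa using (Nat.le_ceil ‖x‖).trans (Nat.cast_le.2 hn)
    simp [this]

theorem memLp_fint_indicator {f : K → ℂ} (hf : MemLp f 2 μ) (r : ℝ) :
    MemLp (S.fint μ ((Metric.closedBall (0 : K) r).indicator f)) 2 μ :=
  S.memLp_fint μ (memLp_indicator_closedBall μ hf r) (r := r)
    fun x hx => Set.indicator_of_notMem (by simpa using hx) _

/-- The Fourier transform of the truncation of `f` to the ball of radius `n`. -/
def truncFourier (n : ℕ) : Lp ℂ 2 μ →ₗ[ℂ] Lp ℂ 2 μ where
  toFun f := (S.memLp_fint_indicator μ (Lp.memLp f) n).toLp _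
  map_add' f g := by
    rw [← MemLp.toLp_add, MemLp.toLp_eq_toLp_iff]
    refine Eventually.of_forall fun ξ => ?_
    rw [← S.fint_add μ (integrable_indicator_closedBall μ (Lp.memLp f) n)
      (integrable_indicator_closedBall μ (Lp.memLp g) n), ← Set.indicator_add']
    refine congrFun (S.fint_congr μ ?_) ξ
    filter_upwards [Lp.coeFn_add f g] with x hx
    by_cases h : x ∈ Metric.closedBall (0 : K) n
    · simp only [Set.indicator_of_mem h, hx]
    · simp only [Set.indicator_of_notMem h]
  map_smul' a f := by
    rw [RingHom.id_apply, ← MemLp.toLp_const_smul, MemLp.toLp_eq_toLp_iff]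
    refine Eventually.of_forall fun ξ => ?_
    rw [← Fourier.fourierIntegral_const_smul]
    refine congrFun (S.fint_congr μ ?_) ξ
    filter_upwards [Lp.coeFn_smul a f] with x hx
    by_cases h : x ∈ Metric.closedBall (0 : K) n
    · simp only [Pi.smul_apply, Set.indicator_of_mem h, hx]
    · simp only [Pi.smul_apply, Set.indicator_of_notMem h, smul_zero]

theorem norm_truncFourier (n : ℕ) (f : Lp ℂ 2 μ) : ‖S.truncFourier μ n f‖ =
    ‖(memLp_indicator_closedBall μ (Lp.memLp f) n).toLp _‖ := by
  change ‖MemLp.toLp _ (S.memLp_fint_indicator μ (Lp.memLp f) n)‖ = _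
  rw [Lp.norm_toLp, Lp.norm_toLp, S.eLpNorm_fint μ (memLp_indicator_closedBall μ (Lp.memLp f) n)
    (r := n) fun x hx => Set.indicator_of_notMem (by simpa using hx) _]

end Fourier


/-! ### The Fourier transform as a unitary operator on $L^2(K)$, and a dense space of test
functions. -/

section Plancherel

set_option linter.unusedSectionVars false

variable {K : Type*} [NontriviallyNormedField K] {p c : ℕ} [NeZero c] (S : FieldData K p c)
  [Fact p.Prime] [IsUltrametricDist K] [ProperSpace K] [MeasurableSpace K] [BorelSpace K]
  (μ : Measure K) [μ.IsAddHaarMeasure] [hμ : Fact (μ (Metric.closedBall 0 1) = 1)]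

theorem fint_sub {f g : K → ℂ} (hf : Integrable f μ) (hg : Integrable g μ) :
    S.fint μ (f - g) = S.fint μ f - S.fint μ g :=
  eq_sub_of_add_eq (by rw [← S.fint_add μ (hf.sub hg) hg, sub_add_cancel])

/-- The truncation of `f` to the ball of radius `n`. -/
def truncLp (n : ℕ) (f : Lp ℂ 2 μ) : Lp ℂ 2 μ :=
  (memLp_indicator_closedBall μ (Lp.memLp f) n).toLp _

theorem tendsto_truncLp (f : Lp ℂ 2 μ) : Tendsto (fun n => truncLp μ n f) atTop (𝓝 f) := by
  conv in 𝓝 f => rw [← Lp.toLp_coeFn f (Lp.memLp f)]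
  refine (Lp.tendsto_Lp_iff_tendsto_eLpNorm'' _ _ _ _).2 ?_
  refine (tendsto_eLpNorm_sub_indicator μ (Lp.memLp f)).congr fun n => ?_
  rw [← eLpNorm_neg]
  congr 1
  funext x
  simp

/-- The difference of two truncations has bounded support, so Plancherel applies to it. Hence the
transforms of the truncations form a Cauchy sequence. -/
theorem dist_truncFourier (m n : ℕ) (f : Lp ℂ 2 μ) :
    dist (S.truncFourier μ m f) (S.truncFourier μ n f) = dist (truncLp μ m f) (truncLp μ n f) := by
  have hm := memLp_indicator_closedBall μ (Lp.memLp f) m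
  have hn := memLp_indicator_closedBall μ (Lp.memLp f) n
  rw [dist_eq_norm, dist_eq_norm]
  change ‖MemLp.toLp _ (S.memLp_fint_indicator μ (Lp.memLp f) m) -
    MemLp.toLp _ (S.memLp_fint_indicator μ (Lp.memLp f) n)‖ = ‖hm.toLp _ - hn.toLp _‖
  rw [← MemLp.toLp_sub, ← MemLp.toLp_sub, Lp.norm_toLp, Lp.norm_toLp,
    ← S.fint_sub μ (integrable_indicator_closedBall μ (Lp.memLp f) m)
      (integrable_indicator_closedBall μ (Lp.memLp f) n),
    S.eLpNorm_fint μ (hm.sub hn) (r := max m n)]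
  intro x hx
  rw [Pi.sub_apply, Set.indicator_of_notMem, Set.indicator_of_notMem, sub_zero]
  · simpa using (le_max_right _ _).trans_lt hx
  · simpa using (le_max_left _ _).trans_lt hx

theorem exists_tendsto_truncFourier (f : Lp ℂ 2 μ) :
    ∃ g, Tendsto (fun n => S.truncFourier μ n f) atTop (𝓝 g) := by
  refine cauchySeq_tendsto_of_complete ?_
  have h := (tendsto_truncLp μ f).cauchySeq
  rw [Metric.cauchySeq_iff] at h ⊢
  simpa only [S.dist_truncFourier μ] using h

/-- The Fourier transform on `L²(K)`. -/
def fourierLp : Lp ℂ 2 μ →ₗᵢ[ℂ] Lp ℂ 2 μ where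
  toFun f := (S.exists_tendsto_truncFourier μ f).choose
  map_add' f g := by
    refine tendsto_nhds_unique (S.exists_tendsto_truncFourier μ (f + g)).choose_spec ?_
    simp only [map_add]
    exact (S.exists_tendsto_truncFourier μ f).choose_spec.add
      (S.exists_tendsto_truncFourier μ g).choose_spec
  map_smul' a f := by
    refine tendsto_nhds_unique (S.exists_tendsto_truncFourier μ (a • f)).choose_spec ?_
    simp only [map_smul]
    exact (S.exists_tendsto_truncFourier μ f).choose_spec.const_smul a
  norm_map' f := by
    refine tendsto_nhds_unique (S.exists_tendsto_truncFourier μ f).choose_spec.norm ?_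
    simp only [S.norm_truncFourier μ]
    exact (tendsto_truncLp μ f).norm

theorem tendsto_truncFourier (f : Lp ℂ 2 μ) :
    Tendsto (fun n => S.truncFourier μ n f) atTop (𝓝 (S.fourierLp μ f)) :=
  (S.exists_tendsto_truncFourier μ f).choose_spec

theorem truncFourier_toLp {f : K → ℂ} (hf : MemLp f 2 μ) (n : ℕ) :
    S.truncFourier μ n (hf.toLp f) = (S.memLp_fint_indicator μ hf n).toLp _ := by
  change MemLp.toLp _ (S.memLp_fint_indicator μ (Lp.memLp (hf.toLp f)) n) = _
  rw [MemLp.toLp_eq_toLp_iff]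
  refine Eventually.of_forall fun ξ => congrFun (S.fint_congr μ ?_) ξ
  filter_upwards [hf.coeFn_toLp] with x hx
  by_cases h : x ∈ Metric.closedBall (0 : K) n
  · simp only [Set.indicator_of_mem h, hx]
  · simp only [Set.indicator_of_notMem h]

/-- This turns the defining limit into an equation for a linear isometry, from which linearity,
Plancherel's and Parseval's formulas are read off. -/
theorem isFourierL2_iff {f g : K → ℂ} (hf : MemLp f 2 μ) (hg : MemLp g 2 μ) :
    S.IsFourierL2 μ f g ↔ S.fourierLp μ (hf.toLp f) = hg.toLp g := by
  have key : Tendsto (fun n : ℕ => eLpNorm (fun ξ => g ξ -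
      Fourier.fourierIntegral S.χ μ ((Metric.closedBall (0 : K) n).indicator f) ξ) 2 μ)
      atTop (𝓝 0) ↔ Tendsto (fun n => S.truncFourier μ n (hf.toLp f)) atTop (𝓝 (hg.toLp g)) := by
    simp only [S.truncFourier_toLp μ hf]
    rw [Lp.tendsto_Lp_iff_tendsto_eLpNorm'']
    refine tendsto_congr fun n => ?_
    rw [← eLpNorm_neg]
    congr 1
    funext x
    simp
  constructor
  · rintro ⟨-, -, h⟩
    exact tendsto_nhds_unique (S.tendsto_truncFourier μ _) (key.1 h)
  · intro h
    exact ⟨hf, hg, key.2 (h ▸ S.tendsto_truncFourier μ _)⟩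

theorem fourierLp_toLp {f : K → ℂ} (hf : MemLp f 2 μ) {r : ℝ} (hr : ∀ x, r < ‖x‖ → f x = 0) :
    S.fourierLp μ (hf.toLp f) = (S.memLp_fint μ hf hr).toLp _ := by
  refine tendsto_nhds_unique (S.tendsto_truncFourier μ _) (tendsto_const_nhds.congr' ?_)
  filter_upwards [eventually_ge_atTop ⌈r⌉₊] with n hn
  rw [truncFourier_toLp, MemLp.toLp_eq_toLp_iff]
  refine Eventually.of_forall fun ξ => congrFun (congrArg _ ?_) ξ
  refine (Set.indicator_eq_self.2 fun x hx => ?_).symm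
  by_contra h
  refine hx (hr x (((Nat.le_ceil r).trans (Nat.cast_le.2 hn)).trans_lt ?_))
  simpa using h

/-! ### Balls and density -/

/-- Exhaust $K$ by the balls $\mathfrak p^{-M}\mathfrak D$. Two balls are nested or disjoint, so
restricting to one of these leaves only integrals over balls. -/
theorem ae_eq_zero_of_forall_ball {f : K → ℂ} (hf : MemLp f 2 μ)
    (h : ∀ (a : K) (n : ℤ), ∫ x in Metric.closedBall a (‖S.𝔭‖ ^ n), f x ∂μ = 0) :
    f =ᵐ[μ] 0 := by
  have key : ∀ M : ℕ, f =ᵐ[μ.restrict (Metric.closedBall 0 (‖S.𝔭‖ ^ (-(M : ℤ))))] 0 := by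
    intro M
    have : IsFiniteMeasure (μ.restrict (Metric.closedBall (0 : K) (‖S.𝔭‖ ^ (-(M : ℤ))))) :=
      ⟨by simpa using (isCompact_closedBall (0 : K) _).measure_lt_top⟩
    refine S.ae_eq_zero_of_setIntegral_closedBall ((hf.restrict _).integrable (by norm_num))
      (h 0 _) fun a n => ?_
    rw [Measure.restrict_restrict measurableSet_closedBall]
    rcases IsUltrametricDist.closedBall_subset_trichotomy (x := a) (r := ‖S.𝔭‖ ^ n) (y := 0)
      (s := ‖S.𝔭‖ ^ (-(M : ℤ))) with h1 | h1 | h1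
    · rw [Set.inter_eq_left.2 h1, ← zpow_natCast]
      exact h a n
    · rw [Set.inter_eq_right.2 h1]
      exact h 0 _
    · rw [h1.inter_eq]
      simp
  have huniv : ⋃ M : ℕ, Metric.closedBall (0 : K) (‖S.𝔭‖ ^ (-(M : ℤ))) = Set.univ := by
    refine Set.eq_univ_of_forall fun x => ?_
    obtain ⟨M, hM⟩ := S.exists_le_zpow_neg ‖x‖
    exact Set.mem_iUnion.2 ⟨M, by simpa using hM⟩
  rw [← Measure.restrict_univ (μ := μ), ← huniv]
  exact (ae_restrict_iUnion_iff _ _).2 key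

/-- The modulation $b$ becomes the centre of a ball under the Fourier transform; $b=0$ gives the
plain indicators. -/
theorem memLp_ball (a b : K) (n : ℤ) :
    MemLp ((Metric.closedBall a (‖S.𝔭‖ ^ n)).indicator
      fun x => ((S.χ (b * x) : Circle) : ℂ)) 2 μ := by
  have : IsFiniteMeasure (μ.restrict (Metric.closedBall a (‖S.𝔭‖ ^ n))) :=
    ⟨by simpa using (isCompact_closedBall a _).measure_lt_top⟩
  rw [memLp_indicator_iff_restrict measurableSet_closedBall]
  refine MemLp.of_bound (C := 1) ?_ (ae_of_all _ fun x => (Circle.norm_coe _).le)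
  exact (continuous_subtype_val.comp (S.continuous_char.comp
    (continuous_const.mul continuous_id))).aestronglyMeasurable

theorem indicator_ball_eq_zero (a : K) (f : K → ℂ) (n : ℤ) (x : K)
    (hx : max ‖a‖ (‖S.𝔭‖ ^ n) < ‖x‖) :
    (Metric.closedBall a (‖S.𝔭‖ ^ n)).indicator f x = 0 := by
  refine Set.indicator_of_notMem (fun h => hx.not_ge ?_) _
  rw [mem_closedBall_iff_norm] at h
  simpa using norm_add_le' (h.trans (le_max_right ‖a‖ _)) (le_max_left ‖a‖ (‖S.𝔭‖ ^ n))

theorem fint_ball (b : K) (n : ℤ) (ξ : K) :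
    S.fint μ ((Metric.closedBall 0 (‖S.𝔭‖ ^ n)).indicator
      fun x => ((S.χ (b * x) : Circle) : ℂ)) ξ =
    ((((p ^ c : ℕ) : ℝ) ^ (-n) : ℝ) : ℂ) *
      (Metric.closedBall b (‖S.𝔭‖ ^ (-n))).indicator (fun _ => 1) ξ := by
  have h := S.integral_dilation μ n fun x => ((S.χ (-(x * ξ)) : Circle) : ℂ) *
    (Metric.closedBall 0 (‖S.𝔭‖ ^ n)).indicator (fun x => ((S.χ (b * x) : Circle) : ℂ)) x
  have hn := zpow_pos S.norm_prime_pos n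
  have h1 : ∀ x, ((S.χ (-(S.𝔭 ^ n * x * ξ)) : Circle) : ℂ) *
      (Metric.closedBall 0 (‖S.𝔭‖ ^ n)).indicator
        (fun x => ((S.χ (b * x) : Circle) : ℂ)) (S.𝔭 ^ n * x) =
      (Metric.closedBall 0 1).indicator
        (fun x => ((S.χ ((S.𝔭 ^ n * (b - ξ)) * x) : Circle) : ℂ)) x := by
    intro x
    by_cases hx : x ∈ Metric.closedBall (0 : K) 1
    · rw [Set.indicator_of_mem hx, Set.indicator_of_mem, ← Circle.coe_mul,
        ← AddChar.map_add_eq_mul]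
      · congr 3; ring
      · rw [mem_closedBall_iff_norm, sub_zero] at hx ⊢
        rw [norm_mul, norm_zpow]
        exact mul_le_of_le_one_right hn.le hx
    · rw [Set.indicator_of_notMem hx, Set.indicator_of_notMem, mul_zero]
      rw [mem_closedBall_iff_norm, sub_zero] at hx ⊢
      rw [norm_mul, norm_zpow]
      exact fun h => hx (le_of_mul_le_mul_left (by simpa using h) hn)
  simp only [h1] at h
  rw [integral_indicator measurableSet_closedBall, S.setIntegral_char μ] at h
  have hq := S.q_real_pos
  have h2 : S.fint μ ((Metric.closedBall 0 (‖S.𝔭‖ ^ n)).indicator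
      fun x => ((S.χ (b * x) : Circle) : ℂ)) ξ = (((p ^ c : ℕ) : ℝ) ^ (-n) : ℝ) •
        (if ‖S.𝔭 ^ n * (b - ξ)‖ ≤ 1 then 1 else 0 : ℂ) := by
    rw [h, smul_smul, ← zpow_add₀ hq.ne', neg_add_cancel, zpow_zero, one_smul]
    rfl
  rw [h2, Complex.real_smul]
  congr 1
  have h3 : ‖S.𝔭 ^ n * (b - ξ)‖ ≤ 1 ↔ ξ ∈ Metric.closedBall b (‖S.𝔭‖ ^ (-n)) := by
    rw [mem_closedBall_iff_norm, norm_sub_rev, norm_mul, norm_zpow, zpow_neg,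
      ← le_inv_mul_iff₀ hn, mul_one]
  split_ifs with h4
  · rw [Set.indicator_of_mem (h3.1 h4)]
  · rw [Set.indicator_of_notMem fun h' => h4 (h3.2 h')]

theorem ae_eq_zero_of_inner_ball {f : Lp ℂ 2 μ}
    (h : ∀ (a : K) (n : ℤ), inner ℂ ((S.memLp_ball μ a 0 n).toLp _) f = 0) : f = 0 := by
  refine (Lp.eq_zero_iff_ae_eq_zero).2 (S.ae_eq_zero_of_forall_ball μ (Lp.memLp f) fun a n => ?_)
  have h1 := h a n
  rw [← Lp.toLp_coeFn f (Lp.memLp f), inner_toLp] at h1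
  rw [← h1, ← integral_indicator measurableSet_closedBall]
  congr 1
  funext x
  by_cases hx : x ∈ Metric.closedBall a (‖S.𝔭‖ ^ n) <;> simp [hx]

/-- The range of an isometry on a complete space is closed. It contains a nonzero multiple of the
indicator of every ball, so its orthogonal complement is zero. -/
theorem surjective_fourierLp : Function.Surjective (S.fourierLp μ) := by
  set R := LinearMap.range (S.fourierLp μ).toLinearMap with hR
  have hclosed : IsClosed (R : Set (Lp ℂ 2 μ)) := by
    have := (S.fourierLp μ).isometry.isClosedEmbedding.isClosed_range
    have h1 : (R : Set (Lp ℂ 2 μ)) = Set.range (S.fourierLp μ) := rfl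
    rw [h1]
    exact this
  have hbot : Rᗮ = ⊥ := by
    rw [Submodule.eq_bot_iff]
    intro f hf
    refine S.ae_eq_zero_of_inner_ball μ fun a n => ?_
    have h1 : S.fourierLp μ ((S.memLp_ball μ 0 a (-n)).toLp _) =
        ((((p ^ c : ℕ) : ℝ) ^ n : ℝ) : ℂ) • (S.memLp_ball μ a 0 n).toLp _ := by
      rw [S.fourierLp_toLp μ (S.memLp_ball μ 0 a (-n)) (S.indicator_ball_eq_zero 0 _ (-n)),
        ← MemLp.toLp_const_smul, MemLp.toLp_eq_toLp_iff]
      refine Eventually.of_forall fun ξ => ?_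
      rw [S.fint_ball μ, neg_neg, Pi.smul_apply, smul_eq_mul]
      simp
    have h2 := hf _ ⟨_, h1⟩
    rw [inner_smul_left] at h2
    refine (mul_eq_zero.1 h2).resolve_left ?_
    have hq := S.q_real_pos
    rw [Complex.conj_ofReal]
    exact_mod_cast (zpow_pos hq n).ne'
  have htop : R = ⊤ := by
    rw [← hclosed.submodule_topologicalClosure_eq, Submodule.topologicalClosure_eq_top_iff, hbot]
  exact LinearMap.range_eq_top.1 htop

/-- The `L²` functions that vanish outside some ball. -/
def bddSupport : Submodule ℂ (Lp ℂ 2 μ) where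
  carrier := {f | ∃ r : ℝ, ∀ᵐ x ∂μ, r < ‖x‖ → f x = 0}
  add_mem' := by
    rintro f g ⟨r, hr⟩ ⟨s, hs⟩
    refine ⟨max r s, ?_⟩
    filter_upwards [hr, hs, Lp.coeFn_add f g] with x h1 h2 h3 hx
    rw [h3, Pi.add_apply, h1 ((le_max_left _ _).trans_lt hx), h2 ((le_max_right _ _).trans_lt hx),
      add_zero]
  zero_mem' := ⟨0, by filter_upwards [Lp.coeFn_zero ℂ 2 μ] with x hx _; rw [hx]; rfl⟩
  smul_mem' := by
    rintro a f ⟨r, hr⟩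
    refine ⟨r, ?_⟩
    filter_upwards [hr, Lp.coeFn_smul a f] with x h1 h2 hx
    rw [h2, Pi.smul_apply, h1 hx, smul_zero]

theorem toLp_mem_bddSupport {f : K → ℂ} (hf : MemLp f 2 μ) {r : ℝ}
    (hr : ∀ x, r < ‖x‖ → f x = 0) : hf.toLp f ∈ bddSupport μ :=
  ⟨r, by filter_upwards [hf.coeFn_toLp] with x hx h; rw [hx, hr x h]⟩

/-- The `L²` functions of bounded support whose Fourier transform has bounded support. -/
def testFunctions : Submodule ℂ (Lp ℂ 2 μ) :=
  bddSupport μ ⊓ (bddSupport μ).comap (S.fourierLp μ).toLinearMap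

/-- Translating the ball to the origin only modulates the transform, which keeps its support in
$\mathfrak p^{-n}\mathfrak D$. -/
theorem ball_mem_testFunctions (a : K) (n : ℤ) :
    (S.memLp_ball μ a 0 n).toLp _ ∈ S.testFunctions μ := by
  refine ⟨toLp_mem_bddSupport μ _ (S.indicator_ball_eq_zero a _ n), ?_⟩
  change S.fourierLp μ _ ∈ bddSupport μ
  rw [S.fourierLp_toLp μ (S.memLp_ball μ a 0 n) (S.indicator_ball_eq_zero a _ n)]
  refine toLp_mem_bddSupport μ _ (r := ‖S.𝔭‖ ^ (-n)) fun ξ hξ => ?_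
  have : (Metric.closedBall a (‖S.𝔭‖ ^ n)).indicator (fun x => ((S.χ (0 * x) : Circle) : ℂ)) =
      fun x => (Metric.closedBall 0 (‖S.𝔭‖ ^ n)).indicator
        (fun x => ((S.χ (0 * x) : Circle) : ℂ)) (x - a) := by
    funext x
    by_cases h : x ∈ Metric.closedBall a (‖S.𝔭‖ ^ n)
    · rw [Set.indicator_of_mem h, Set.indicator_of_mem (by
        rwa [mem_closedBall_iff_norm, sub_zero, ← mem_closedBall_iff_norm])]
      simp
    · rw [Set.indicator_of_notMem h, Set.indicator_of_notMem (by
        rwa [mem_closedBall_iff_norm, sub_zero, ← mem_closedBall_iff_norm])]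
  rw [this, S.fint_translate μ a ((Metric.closedBall 0 (‖S.𝔭‖ ^ n)).indicator
    (fun x => ((S.χ (0 * x) : Circle) : ℂ))), S.fint_ball μ, Set.indicator_of_notMem, mul_zero,
    mul_zero]
  simpa using hξ

theorem dense_testFunctions : (S.testFunctions μ).topologicalClosure = ⊤ := by
  rw [Submodule.topologicalClosure_eq_top_iff, Submodule.eq_bot_iff]
  intro f hf
  exact S.ae_eq_zero_of_inner_ball μ fun a n => hf _ (S.ball_mem_testFunctions μ a n)

end Plancherel


/-! ### Fourier transforms of dilates and translates. -/

section Wavelet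

set_option linter.unusedSectionVars false

variable {K : Type*} [NontriviallyNormedField K] {p c : ℕ} [NeZero c] (S : FieldData K p c)
  [Fact p.Prime] [IsUltrametricDist K] [ProperSpace K] [MeasurableSpace K] [BorelSpace K]
  (μ : Measure K) [μ.IsAddHaarMeasure] [hμ : Fact (μ (Metric.closedBall 0 1) = 1)]

/-- The Fourier transform of `ψ_{j,k}` in terms of the Fourier transform `θ` of `ψ`. -/
def waveletHat (S : FieldData K p c) (θ : K → ℂ) (j : ℤ) (k : ℕ) (ξ : K) : ℂ :=
  (((S.q : ℝ) ^ (-((j : ℝ) / 2)) : ℝ) : ℂ) * (conj (S.chi k (S.𝔭 ^ j * ξ)) * θ (S.𝔭 ^ j * ξ))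

theorem memLp_translate {f : K → ℂ} (hf : MemLp f 2 μ) (a : K) :
    MemLp (fun x => f (x - a)) 2 μ :=
  hf.comp_measurePreserving (measurePreserving_sub_right μ a)

theorem eLpNorm_wavelet {f : K → ℂ} (hf : MemLp f 2 μ) (j : ℤ) (k : ℕ) :
    eLpNorm (S.wavelet f j k) 2 μ = eLpNorm f 2 μ := by
  have hq := S.q_real_pos
  have h1 := S.eLpNorm_dilation μ (-j) fun x => f (x - S.u k)
  have h2 : S.wavelet f j k =
      ((((p ^ c : ℕ) : ℝ) ^ ((j : ℝ) / 2) : ℝ) : ℂ) • fun x => f (S.𝔭 ^ (-j) * x - S.u k) := rfl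
  have h3 : eLpNorm (fun x => f (x - S.u k)) 2 μ = eLpNorm f 2 μ :=
    eLpNorm_comp_measurePreserving hf.1 (measurePreserving_sub_right μ (S.u k))
  rw [h2, eLpNorm_const_smul, h1, h3, ← ofReal_norm, Complex.norm_real,
    Real.norm_of_nonneg (by positivity), ← mul_assoc, ← ENNReal.ofReal_mul (by positivity),
    ← Real.rpow_add hq]
  simp [← add_div]

theorem memLp_wavelet {f : K → ℂ} (hf : MemLp f 2 μ) (j : ℤ) (k : ℕ) :
    MemLp (S.wavelet f j k) 2 μ :=
  (S.memLp_dilation μ (-j) (memLp_translate μ hf (S.u k))).const_mul _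

theorem eLpNorm_waveletHat (f : K → ℂ) (j : ℤ) (k : ℕ) :
    eLpNorm (S.waveletHat f j k) 2 μ = eLpNorm f 2 μ := by
  have hq := S.q_real_pos
  have h2 : eLpNorm (S.waveletHat f j k) 2 μ = eLpNorm
      (((((p ^ c : ℕ) : ℝ) ^ (-((j : ℝ) / 2)) : ℝ) : ℂ) • fun x => f (S.𝔭 ^ j * x)) 2 μ := by
    refine eLpNorm_congr_norm_ae (ae_of_all _ fun x => ?_)
    simp [waveletHat, norm_chi]
  rw [h2, eLpNorm_const_smul, S.eLpNorm_dilation μ, ← ofReal_norm, Complex.norm_real,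
    Real.norm_of_nonneg (by positivity), ← mul_assoc, ← ENNReal.ofReal_mul (by positivity),
    ← Real.rpow_add hq]
  simp

theorem memLp_waveletHat {f : K → ℂ} (hf : MemLp f 2 μ) (j : ℤ) (k : ℕ) :
    MemLp (S.waveletHat f j k) 2 μ := by
  refine ⟨?_, by rw [S.eLpNorm_waveletHat μ]; exact hf.2⟩
  refine AEStronglyMeasurable.const_mul (AEStronglyMeasurable.mul ?_ (S.memLp_dilation μ j hf).1) _
  exact (Complex.continuous_conj.comp ((S.continuous_chi k).comp
    (continuous_const.mul continuous_id))).aestronglyMeasurable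

theorem wavelet_sub (f g : K → ℂ) (j : ℤ) (k : ℕ) :
    S.wavelet (f - g) j k = S.wavelet f j k - S.wavelet g j k := by
  funext x; simp [wavelet, mul_sub]

theorem waveletHat_sub (f g : K → ℂ) (j : ℤ) (k : ℕ) :
    S.waveletHat (f - g) j k = S.waveletHat f j k - S.waveletHat g j k := by
  funext x; simp [waveletHat, mul_sub]

theorem fint_wavelet (f : K → ℂ) (j : ℤ) (k : ℕ) :
    S.fint μ (S.wavelet f j k) = S.waveletHat (S.fint μ f) j k := by
  have hq := S.q_real_pos
  funext ξ
  have h2 : S.wavelet f j k =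
      ((((p ^ c : ℕ) : ℝ) ^ ((j : ℝ) / 2) : ℝ) : ℂ) • fun x => f (S.𝔭 ^ (-j) * x - S.u k) := rfl
  have h3 := S.fint_dilation μ (-j) (fun x => f (x - S.u k)) ξ
  rw [S.fint_translate μ, neg_neg] at h3
  rw [h2]
  refine (congrFun (Fourier.fourierIntegral_const_smul _ _ _ _) ξ).trans ?_
  rw [Pi.smul_apply]
  refine (congrArg _ h3).trans ?_
  rw [waveletHat, Complex.real_smul, smul_eq_mul, ← mul_assoc, ← Complex.ofReal_mul,
    ← Real.rpow_intCast, ← Real.rpow_add hq, AddChar.map_neg_eq_inv, Circle.coe_inv_eq_conj]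
  congr 3
  push_cast; ring_nf

theorem isFourierL2_wavelet {f g : K → ℂ} (h : S.IsFourierL2 μ f g) (j : ℤ) (k : ℕ) :
    S.IsFourierL2 μ (S.wavelet f j k) (S.waveletHat g j k) := by
  have hf := h.1
  have hg := h.2.1
  set F : ℕ → K → ℂ := fun n => (Metric.closedBall (0 : K) n).indicator f with hF
  have hFm : ∀ n, MemLp (F n) 2 μ := fun n => memLp_indicator_closedBall μ hf n
  have hGm : ∀ n, MemLp (S.fint μ (F n)) 2 μ := fun n => S.memLp_fint_indicator μ hf n
  have h1 : Tendsto (fun n => (S.memLp_wavelet μ (hFm n) j k).toLp _) atTop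
      (𝓝 ((S.memLp_wavelet μ hf j k).toLp _)) := by
    refine (Lp.tendsto_Lp_iff_tendsto_eLpNorm'' _ _ _ _).2 ?_
    refine (tendsto_eLpNorm_sub_indicator μ hf).congr fun n => ?_
    rw [← wavelet_sub, S.eLpNorm_wavelet μ ((hFm n).sub hf), eLpNorm_sub_comm]
    rfl
  have h2 : Tendsto (fun n => (S.memLp_waveletHat μ (hGm n) j k).toLp _) atTop
      (𝓝 ((S.memLp_waveletHat μ hg j k).toLp _)) := by
    refine (Lp.tendsto_Lp_iff_tendsto_eLpNorm'' _ _ _ _).2 ?_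
    refine h.2.2.congr fun n => ?_
    rw [← waveletHat_sub, S.eLpNorm_waveletHat μ, eLpNorm_sub_comm]
    rfl
  have h3 : ∀ n, S.fourierLp μ ((S.memLp_wavelet μ (hFm n) j k).toLp _) =
      (S.memLp_waveletHat μ (hGm n) j k).toLp _ := by
    intro n
    -- For truncated $f$ the wavelet has bounded support: $|\mathfrak p^{-j}x-u(k)|\le n$ gives
    -- $|x|\le|\mathfrak p|^j\max(n,|u(k)|)$. So its transform is the integral.
    rw [S.fourierLp_toLp μ (S.memLp_wavelet μ (hFm n) j k)
      (r := ‖S.𝔭‖ ^ j * max (n : ℝ) ‖S.u k‖)]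
    · rw [MemLp.toLp_eq_toLp_iff, S.fint_wavelet μ]
    · intro x hx
      rw [wavelet]
      refine mul_eq_zero_of_right _ (Set.indicator_of_notMem (fun hmem => hx.not_ge ?_) _)
      rw [mem_closedBall_iff_norm, sub_zero] at hmem
      have h4 := norm_add_le' (hmem.trans (le_max_left (n : ℝ) ‖S.u k‖)) (le_max_right (n : ℝ) _)
      rw [sub_add_cancel, norm_mul, norm_zpow, zpow_neg] at h4
      rwa [inv_mul_le_iff₀ (zpow_pos S.norm_prime_pos j)] at h4
  rw [S.isFourierL2_iff μ (S.memLp_wavelet μ hf j k) (S.memLp_waveletHat μ hg j k)]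
  refine tendsto_nhds_unique (((S.fourierLp μ).continuous.tendsto _).comp h1) ?_
  exact h2.congr fun n => (h3 n).symm

/-- Parseval's formula. -/
theorem integral_mul_conj_eq {f g f' g' : K → ℂ} (h : S.IsFourierL2 μ f g)
    (h' : S.IsFourierL2 μ f' g') :
    ∫ x, f x * conj (f' x) ∂μ = ∫ ξ, g ξ * conj (g' ξ) ∂μ := by
  rw [← inner_toLp h'.1 h.1, ← inner_toLp h'.2.1 h.2.1, ← (S.isFourierL2_iff μ h.1 h.2.1).1 h,
    ← (S.isFourierL2_iff μ h'.1 h'.2.1).1 h', LinearIsometry.inner_map_map]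

end Wavelet

end FieldData

/-! ### Isometric matrices and products of limits. -/

theorem sum_normSq_mulVec {m n : ℕ} {M : Matrix (Fin m) (Fin n) ℂ} (hM : Mᴴ * M = 1)
    (w : Fin n → ℂ) : ∑ i, ‖(M *ᵥ w) i‖ ^ 2 = ∑ r, ‖w r‖ ^ 2 := by
  have key : ∀ {k : ℕ} (v : Fin k → ℂ), star v ⬝ᵥ v = ((∑ r, ‖v r‖ ^ 2 : ℝ) : ℂ) := by
    intro k v
    simp only [dotProduct, Pi.star_apply, Complex.ofReal_sum]
    refine Finset.sum_congr rfl fun r _ => ?_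
    rw [← Complex.normSq_eq_norm_sq, Complex.normSq_eq_conj_mul_self]; rfl
  have h : star (M *ᵥ w) ⬝ᵥ (M *ᵥ w) = star w ⬝ᵥ w := by
    rw [Matrix.star_mulVec, ← Matrix.dotProduct_mulVec, Matrix.mulVec_mulVec, hM,
      Matrix.one_mulVec]
  rw [key, key] at h
  exact_mod_cast h

theorem norm_mulVec_le {m n : ℕ} {M : Matrix (Fin m) (Fin n) ℂ} (hM : Mᴴ * M = 1)
    (w : Fin n → ℂ) (hw : ∑ r, ‖w r‖ ^ 2 ≤ 1) (i : Fin m) : ‖(M *ᵥ w) i‖ ≤ 1 := by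
  have h := Finset.single_le_sum (f := fun i => ‖(M *ᵥ w) i‖ ^ 2) (fun i _ => by positivity)
    (Finset.mem_univ i)
  rw [sum_normSq_mulVec hM] at h
  exact (sq_le_one_iff₀ (norm_nonneg _)).1 (h.trans hw)

theorem eLpNorm_sum_mul_le {α ι : Type*} {m : MeasurableSpace α} {ν : Measure α} [Fintype ι]
    {a b : ι → α → ℂ} (ha : ∀ i, AEStronglyMeasurable (a i) ν)
    (hb : ∀ i, AEStronglyMeasurable (b i) ν) {C : ℂ} (hC : ∀ i x, ‖a i x‖ = ‖C‖) :
    eLpNorm (fun x => ∑ i, a i x * b i x) 2 ν ≤ ∑ i, ‖C‖ₑ * eLpNorm (b i) 2 ν := by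
  have h1 : (fun x => ∑ i, a i x * b i x) = ∑ i, fun x => a i x * b i x := by
    funext x; simp
  rw [h1]
  refine (eLpNorm_sum_le (fun i _ => (ha i).mul (hb i)) (by norm_num)).trans
    (Finset.sum_le_sum fun i _ => ?_)
  rw [← eLpNorm_const_smul]
  refine (eLpNorm_congr_norm_ae (ae_of_all _ fun x => ?_)).le
  rw [Pi.smul_apply, norm_smul, Pi.mul_apply, norm_mul, hC]

/-- The factor $t$ need not be bounded, so multiplication by it need not be continuous on $L^2$; the
limits are compared a.e. along a common subsequence. -/
theorem ae_eq_mul_of_tendsto {α : Type*} {m : MeasurableSpace α} {ν : Measure α}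
    {M : ℕ → α → ℂ} {a t g : α → ℂ} (hM : ∀ N, AEStronglyMeasurable (M N) ν)
    (ha : AEStronglyMeasurable a ν) (ht : AEStronglyMeasurable t ν)
    (hg : AEStronglyMeasurable g ν)
    (h1 : Tendsto (fun N => eLpNorm (M N - a) 2 ν) atTop (𝓝 0))
    (h2 : Tendsto (fun N => eLpNorm ((fun x => M N x * t x) - g) 2 ν) atTop (𝓝 0)) :
    ∀ᵐ x ∂ν, g x = a x * t x := by
  obtain ⟨ns, hns, hns'⟩ :=
    (tendstoInMeasure_of_tendsto_eLpNorm two_ne_zero hM ha h1).exists_seq_tendsto_ae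
  obtain ⟨ms, hms, hms'⟩ := (tendstoInMeasure_of_tendsto_eLpNorm two_ne_zero
    (fun N => (hM (ns N)).mul ht) hg (h2.comp hns.tendsto_atTop)).exists_seq_tendsto_ae
  filter_upwards [hns', hms'] with x hx hx'
  exact tendsto_nhds_unique hx' ((hx.comp hms.tendsto_atTop).mul_const _)

namespace FieldData

/-! ### From UEP systems to extension pairs on the Fourier side. -/

section UEP

set_option linter.unusedSectionVars false

variable {K : Type*} [NontriviallyNormedField K] {p c : ℕ} [NeZero c] (S : FieldData K p c)
  [Fact p.Prime] [IsUltrametricDist K] [ProperSpace K] [MeasurableSpace K] [BorelSpace K]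
  (μ : Measure K) [μ.IsAddHaarMeasure] [hμ : Fact (μ (Metric.closedBall 0 1) = 1)]

/-- A periodic polyphase matrix whose values are isometries, with a refinable function given by its
Fourier transform `θ`, whose mask is the mask of row `0`. -/
structure IsExtensionPair (S : FieldData K p c) (μ : Measure K) {n : ℕ} (θ : K → ℂ)
    (Γ : K → Matrix (Fin (n + 1)) (Fin (p ^ c)) ℂ) : Prop where
  memLp : MemLp θ 2 μ
  measurable : ∀ i r, AEStronglyMeasurable (fun ξ => Γ ξ i r) μ
  periodic : ∀ n, ∀ᵐ ξ ∂μ, Γ (ξ + S.u n) = Γ ξ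
  isometry : ∀ᵐ ξ ∂μ, (Γ ξ)ᴴ * Γ ξ = 1
  refinement : ∀ᵐ ξ ∂μ, θ ξ = S.mask Γ 0 (S.𝔭 * ξ) * θ (S.𝔭 * ξ)
  tendsto_one : ∀ᵐ ξ ∂μ, Tendsto (fun j : ℕ => ‖θ (S.𝔭 ^ j * ξ)‖) atTop (𝓝 1)

/-- The masks at $\mathfrak p\xi$ are the image under $\Gamma(\xi)$ of the vector with entries
$q^{-1/2}\overline{\chi_r(\mathfrak p\xi)}$, a unit vector by `sum_normSq_chi`. So an isometric
$\Gamma$ has masks bounded by $1$. -/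
theorem mask_prime_mul {n : ℕ} (Γ : K → Matrix (Fin n) (Fin (p ^ c)) ℂ) (i : Fin n) (ξ : K) :
    S.mask Γ i (S.𝔭 * ξ) =
      (Γ ξ *ᵥ fun r => ((1 / Real.sqrt S.q : ℝ) : ℂ) * conj (S.chi r (S.𝔭 * ξ))) i := by
  rw [mask, inv_mul_cancel_left₀ S.prime_ne_zero, Matrix.mulVec, dotProduct, Finset.mul_sum]
  exact Finset.sum_congr rfl fun r _ => by ring

theorem sum_normSq_chi (x : K) :
    ∑ r : Fin (p ^ c), ‖((1 / Real.sqrt S.q : ℝ) : ℂ) * conj (S.chi r x)‖ ^ 2 = 1 := by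
  have hq := S.q_real_pos
  have : ∀ r : Fin (p ^ c),
      ‖((1 / Real.sqrt S.q : ℝ) : ℂ) * conj (S.chi r x)‖ ^ 2 = ((p ^ c : ℕ) : ℝ)⁻¹ := by
    intro r
    rw [norm_mul, RCLike.norm_conj, norm_chi, mul_one, Complex.norm_real, Real.norm_eq_abs, sq_abs,
      one_div, inv_pow, Real.sq_sqrt hq.le]
  simp only [this, Finset.sum_const, Finset.card_univ, Fintype.card_fin, nsmul_eq_mul]
  exact mul_inv_cancel₀ hq.ne'

theorem ae_of_forall_closedBall {P : K → Prop}
    (h : ∀ R : ℕ, ∀ᵐ x ∂μ.restrict (Metric.closedBall 0 R), P x) : ∀ᵐ x ∂μ, P x := by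
  have huniv : ⋃ R : ℕ, Metric.closedBall (0 : K) R = Set.univ :=
    Metric.iUnion_closedBall_nat _
  rw [← Measure.restrict_univ (μ := μ), ← huniv]
  exact (ae_restrict_iUnion_iff _ _).2 h

theorem aestronglyMeasurable_charSum (d : ℕ → ℂ) (N : ℕ) (ν : Measure K) :
    AEStronglyMeasurable (fun ξ => ∑ k ∈ Finset.range N, d k * conj (S.chi k ξ)) ν :=
  (continuous_finsetSum _ fun k _ => continuous_const.mul
    (Complex.continuous_conj.comp (S.continuous_chi k))).aestronglyMeasurable

/-- The partial sums are exactly periodic, so on each ball around $0$ both $f$ and its translate are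
$L^2$ limits of the same sequence; for the translate this uses convergence on the ball around
$u(n)$. -/
theorem isCharSeries_periodic {d : ℕ → ℂ} {f : K → ℂ} (h : S.IsCharSeries μ d f) (n : ℕ) :
    ∀ᵐ ξ ∂μ, f (ξ + S.u n) = f ξ := by
  set s : ℕ → K → ℂ := fun N ξ => ∑ k ∈ Finset.range N, d k * conj (S.chi k ξ) with hs
  have hsm : ∀ N (ν : Measure K), AEStronglyMeasurable (s N) ν :=
    fun N ν => S.aestronglyMeasurable_charSum d N ν
  have hsp : ∀ N ξ, s N (ξ + S.u n) = s N ξ := fun N ξ => by simp only [hs, chi_periodic]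
  have hmp := measurePreserving_add_right μ (S.u n)
  refine ae_of_forall_closedBall μ fun R => ?_
  have hpre : (fun x => x + S.u n) ⁻¹' Metric.closedBall (S.u n) R =
      Metric.closedBall 0 R := by
    ext x
    simp
  have hmp' := hmp.restrict_preimage_emb
    (MeasurableEquiv.addRight (S.u n)).measurableEmbedding (Metric.closedBall (S.u n) R)
  rw [hpre] at hmp'
  have h1 : Tendsto (fun N => eLpNorm (f - s N) 2 (μ.restrict (Metric.closedBall 0 R))) atTop
    (𝓝 0) := h.2 _ (isCompact_closedBall 0 (R : ℝ))
  have h2 : Tendsto (fun N => eLpNorm (f - s N) 2 (μ.restrict (Metric.closedBall (S.u n) R))) atTop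
    (𝓝 0) := h.2 _ (isCompact_closedBall (S.u n) (R : ℝ))
  set f' : K → ℂ := fun ξ => f (ξ + S.u n) with hf'
  have h3 : ∀ N, eLpNorm (f' - s N) 2 (μ.restrict (Metric.closedBall 0 R)) =
      eLpNorm (f - s N) 2 (μ.restrict (Metric.closedBall (S.u n) R)) := by
    intro N
    rw [← eLpNorm_comp_measurePreserving (h.1.restrict.sub (hsm N _)) hmp']
    congr 1
    funext ξ
    simp [hsp, hf']
  have hfm : AEStronglyMeasurable f' μ := h.1.comp_measurePreserving hmp
  have h4 : eLpNorm (f' - f) 2 (μ.restrict (Metric.closedBall 0 R)) = 0 := by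
    refine le_antisymm (ge_of_tendsto' (x := atTop) (by simpa using h2.add h1) fun N => ?_)
      zero_le
    rw [← sub_sub_sub_cancel_right f' f (s N)]
    refine (eLpNorm_sub_le (hfm.restrict.sub (hsm N _)) (h.1.restrict.sub (hsm N _))
      (by norm_num)).trans_eq ?_
    rw [h3]
  rw [eLpNorm_eq_zero_iff (hfm.restrict.sub h.1.restrict) two_ne_zero] at h4
  filter_upwards [h4] with ξ hξ
  exact sub_eq_zero.1 hξ

variable {μ} {S}

theorem isFourierL2_add {f g f' g' : K → ℂ} (h : S.IsFourierL2 μ f g)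
    (h' : S.IsFourierL2 μ f' g') : S.IsFourierL2 μ (f + f') (g + g') := by
  rw [S.isFourierL2_iff μ (h.1.add h'.1) (h.2.1.add h'.2.1), MemLp.toLp_add h.1 h'.1,
    MemLp.toLp_add h.2.1 h'.2.1,
    map_add, (S.isFourierL2_iff μ h.1 h.2.1).1 h, (S.isFourierL2_iff μ h'.1 h'.2.1).1 h']

theorem isFourierL2_smul {f g : K → ℂ} (h : S.IsFourierL2 μ f g) (a : ℂ) :
    S.IsFourierL2 μ (a • f) (a • g) := by
  rw [S.isFourierL2_iff μ (h.1.const_smul a) (h.2.1.const_smul a), MemLp.toLp_const_smul a h.1,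
    MemLp.toLp_const_smul a h.2.1, map_smul, (S.isFourierL2_iff μ h.1 h.2.1).1 h]

theorem isFourierL2_zero : S.IsFourierL2 μ 0 0 := by
  have h0 : MemLp (0 : K → ℂ) 2 μ := MemLp.zero
  rw [S.isFourierL2_iff μ h0 h0, MemLp.toLp_zero, map_zero]

theorem isFourierL2_sum {f g : ℕ → K → ℂ} (h : ∀ n, S.IsFourierL2 μ (f n) (g n))
    (s : Finset ℕ) : S.IsFourierL2 μ (∑ n ∈ s, f n) (∑ n ∈ s, g n) := by
  classical
  induction s using Finset.induction_on with
  | empty => simpa using isFourierL2_zero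
  | insert a s ha ih =>
    rw [Finset.sum_insert ha, Finset.sum_insert ha]
    exact isFourierL2_add (h a) ih

theorem IsFourierL2.eLpNorm_eq {f g : K → ℂ} (h : S.IsFourierL2 μ f g) :
    eLpNorm g 2 μ = eLpNorm f 2 μ := by
  rw [← Lp.enorm_toLp h.2.1, ← Lp.enorm_toLp h.1, ← (S.isFourierL2_iff μ h.1 h.2.1).1 h,
    LinearIsometry.enorm_map]

variable {L : ℕ} {φ φhat : K → ℂ} {h : Fin (L + 1) → ℕ → ℂ}
  {Γ : K → Matrix (Fin (L + 1)) (Fin (p ^ c)) ℂ}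

/-- By Plancherel the transformed partial sums of the refinement equation converge to $\hat\varphi$.
Those of length $qN$ are trigonometric polynomials times $\hat\varphi(\mathfrak p\,\cdot)$, and the
polynomials converge to the mask in $L^2$ on each ball. -/
theorem IsUEPSystem.refinement_fourier (hφ : S.IsUEPSystem μ φ φhat h Γ) :
    ∀ᵐ ξ ∂μ, φhat ξ = S.mask Γ 0 (S.𝔭 * ξ) * φhat (S.𝔭 * ξ) := by
  have hq := S.q_real_pos
  set P : ℕ → K → ℂ := fun N => ∑ k ∈ Finset.range N, h 0 k • S.wavelet φ 1 k with hP
  set Q : ℕ → K → ℂ := fun N => ∑ k ∈ Finset.range N, h 0 k • S.waveletHat φhat 1 k with hQ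
  have hPQ : ∀ N, S.IsFourierL2 μ (P N) (Q N) := fun N =>
    isFourierL2_sum (fun k => isFourierL2_smul (S.isFourierL2_wavelet μ hφ.fourier 1 k) _) _
  have hlim : Tendsto (fun N => eLpNorm (Q N - φhat) 2 μ) atTop (𝓝 0) := by
    refine hφ.refinement.congr fun N => ?_
    have h1 := isFourierL2_add (hPQ N) (isFourierL2_smul hφ.fourier (-1))
    rw [neg_one_smul, neg_one_smul, ← sub_eq_add_neg, ← sub_eq_add_neg] at h1
    rw [h1.eLpNorm_eq, eLpNorm_sub_comm]
    congr 1
    funext x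
    simp only [hP, Pi.sub_apply, Finset.sum_apply, Pi.smul_apply, wavelet, smul_eq_mul,
      Finset.mul_sum, Real.sqrt_eq_rpow, zpow_neg_one, Int.cast_one]
    congr 1
    exact Finset.sum_congr rfl fun k _ => by ring
  set M : ℕ → K → ℂ := fun N ξ => ∑ r : Fin (p ^ c), ((1 / Real.sqrt S.q : ℝ) : ℂ) *
    conj (S.chi r (S.𝔭 * ξ)) * ∑ k ∈ Finset.range N, h 0 (r + S.q * k) * conj (S.chi k ξ) with hM
  -- Sorting indices by their residue $r$ modulo $q$ and using $\chi_{r+qk}(\mathfrak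
  -- p\xi)=\chi_r(\mathfrak p\xi)\chi_k(\xi)$ produces the partial sums of the polyphase components.
  have hQM : ∀ N, Q (p ^ c * N) = fun ξ => M N ξ * φhat (S.𝔭 * ξ) := by
    intro N
    funext ξ
    have hc : ((((p ^ c : ℕ) : ℝ) ^ (-(((1 : ℤ) : ℝ) / 2)) : ℝ) : ℂ) =
        ((1 / Real.sqrt S.q : ℝ) : ℂ) := by
      rw [Real.sqrt_eq_rpow, Real.rpow_neg hq.le, one_div, Int.cast_one]
    simp only [hQ, hM, Finset.sum_apply, Pi.smul_apply, smul_eq_mul, waveletHat, hc, zpow_one]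
    rw [sum_range_mul, Finset.sum_comm, Finset.sum_mul]
    refine Finset.sum_congr rfl fun r _ => ?_
    rw [Finset.mul_sum, Finset.sum_mul]
    refine Finset.sum_congr rfl fun k _ => ?_
    rw [S.chi_add_mul r.2, inv_mul_cancel_left₀ S.prime_ne_zero, map_mul]
    ring
  have hchi : ∀ r : ℕ, Continuous fun ξ : K => ((1 / Real.sqrt S.q : ℝ) : ℂ) *
      conj (S.chi r (S.𝔭 * ξ)) := fun r => continuous_const.mul
    (Complex.continuous_conj.comp ((S.continuous_chi r).comp (continuous_const.mul continuous_id)))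
  have hMm : ∀ N (ν : Measure K), AEStronglyMeasurable (M N) ν := by
    intro N ν
    refine Finset.aestronglyMeasurable_fun_sum _ fun r _ => ?_
    exact (hchi r).aestronglyMeasurable.mul (S.aestronglyMeasurable_charSum _ N ν)
  have hmask : ∀ ξ, S.mask Γ 0 (S.𝔭 * ξ) = ∑ r : Fin (p ^ c), ((1 / Real.sqrt S.q : ℝ) : ℂ) *
      conj (S.chi r (S.𝔭 * ξ)) * Γ ξ 0 r := by
    intro ξ
    rw [mask_prime_mul, Matrix.mulVec, dotProduct]
    exact Finset.sum_congr rfl fun r _ => mul_comm _ _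
  have hmm : AEStronglyMeasurable (fun ξ => S.mask Γ 0 (S.𝔭 * ξ)) μ := by
    simp only [hmask]
    exact Finset.aestronglyMeasurable_fun_sum _ fun r _ =>
      (hchi r).aestronglyMeasurable.mul (hφ.polyphase 0 r).1
  have htm : AEStronglyMeasurable (fun ξ => φhat (S.𝔭 * ξ)) μ := by
    simpa using (S.memLp_dilation μ 1 hφ.fourier.2.1).1
  refine ae_of_forall_closedBall μ fun R => ?_
  refine ae_eq_mul_of_tendsto (fun N => hMm N _) hmm.restrict htm.restrict
    hφ.fourier.2.1.1.restrict ?_ ?_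
  · have hb : ∀ N, eLpNorm (M N - fun ξ => S.mask Γ 0 (S.𝔭 * ξ)) 2
        (μ.restrict (Metric.closedBall 0 R)) ≤ ∑ r : Fin (p ^ c),
          ‖((1 / Real.sqrt S.q : ℝ) : ℂ)‖ₑ * eLpNorm (fun ξ => Γ ξ 0 r -
            ∑ k ∈ Finset.range N, h 0 (r + S.q * k) * conj (S.chi k ξ)) 2
              (μ.restrict (Metric.closedBall 0 R)) := by
      intro N
      have he : (M N - fun ξ => S.mask Γ 0 (S.𝔭 * ξ)) = -fun ξ => ∑ r : Fin (p ^ c),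
          (((1 / Real.sqrt S.q : ℝ) : ℂ) * conj (S.chi r (S.𝔭 * ξ))) *
            (Γ ξ 0 r - ∑ k ∈ Finset.range N, h 0 (r + S.q * k) * conj (S.chi k ξ)) := by
        funext ξ
        simp only [Pi.sub_apply, Pi.neg_apply, hM, hmask, ← Finset.sum_sub_distrib,
          ← Finset.sum_neg_distrib, mul_sub, neg_sub]
      rw [he, eLpNorm_neg]
      exact eLpNorm_sum_mul_le (fun r : Fin (p ^ c) => (hchi r).aestronglyMeasurable)
        (fun r : Fin (p ^ c) => (hφ.polyphase 0 r).1.restrict.sub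
          (S.aestronglyMeasurable_charSum _ N _))
        fun r ξ => by rw [norm_mul, RCLike.norm_conj, norm_chi, mul_one]
    refine tendsto_of_tendsto_of_tendsto_of_le_of_le tendsto_const_nhds ?_ (fun _ => zero_le) hb
    have h0 : (0 : ℝ≥0∞) =
        ∑ r : Fin (p ^ c), ‖((1 / Real.sqrt S.q : ℝ) : ℂ)‖ₑ * 0 := by simp
    rw [h0]
    refine tendsto_finsetSum _ fun r _ => ENNReal.Tendsto.const_mul
      ((hφ.polyphase 0 r).2 _ (isCompact_closedBall 0 (R : ℝ))) (Or.inr enorm_ne_top)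
  · have h1 := hlim.comp (tendsto_id.const_mul_atTop' S.q_pos)
    refine tendsto_of_tendsto_of_tendsto_of_le_of_le tendsto_const_nhds h1 (fun _ => zero_le)
      fun N => ?_
    simp only [← hQM]
    exact eLpNorm_restrict_le _ _ _ _

theorem IsUEPSystem.periodic (hφ : S.IsUEPSystem μ φ φhat h Γ) (n : ℕ) :
    ∀ᵐ ξ ∂μ, Γ (ξ + S.u n) = Γ ξ := by
  have h1 : ∀ᵐ ξ ∂μ, ∀ l r, Γ (ξ + S.u n) l r = Γ ξ l r :=
    ae_all_iff.2 fun l => ae_all_iff.2 fun r => S.isCharSeries_periodic μ (hφ.polyphase l r) n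
  filter_upwards [h1] with ξ hξ
  ext l r
  exact hξ l r

/-- The UEP condition covers $\mathfrak p^{-1}\mathfrak D$, which contains $\mathfrak D$;
periodicity carries it to every coset of $\mathfrak D$. -/
theorem IsUEPSystem.isometry (hφ : S.IsUEPSystem μ φ φhat h Γ) :
    ∀ᵐ ξ ∂μ, (Γ ξ)ᴴ * Γ ξ = 1 := by
  have h1 := (ae_restrict_iff' measurableSet_closedBall).1 hφ.uep
  have h2 := (S.quasiMeasurePreserving_dilation μ 1).ae h1
  refine S.ae_of_forall_u μ fun n => (ae_restrict_iff' measurableSet_closedBall).2 ?_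
  filter_upwards [h2, hφ.periodic n] with ξ h3 h4 hξ
  rw [h4]
  rw [zpow_one, inv_mul_cancel_left₀ S.prime_ne_zero] at h3
  refine h3 ?_
  rw [mem_closedBall_iff_norm, sub_zero] at hξ ⊢
  rw [norm_mul]
  exact mul_le_one₀ S.norm_prime_lt.le (norm_nonneg _) hξ

theorem IsUEPSystem.isExtensionPair (hφ : S.IsUEPSystem μ φ φhat h Γ) :
    S.IsExtensionPair μ φhat Γ where
  memLp := hφ.fourier.2.1
  measurable i r := (hφ.polyphase i r).1
  periodic := hφ.periodic
  isometry := hφ.isometry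
  refinement := hφ.refinement_fourier
  tendsto_one := hφ.tendsto_one

variable {n : ℕ} {θ : K → ℂ} {Δ : K → Matrix (Fin (n + 1)) (Fin (p ^ c)) ℂ}

theorem IsExtensionPair.norm_mask_le (hθ : S.IsExtensionPair μ θ Δ) :
    ∀ᵐ ξ ∂μ, ∀ i, ‖S.mask Δ i (S.𝔭 * ξ)‖ ≤ 1 := by
  filter_upwards [hθ.isometry] with ξ hξ i
  rw [mask_prime_mul]
  exact norm_mulVec_le hξ _ (S.sum_normSq_chi _).le i

theorem IsExtensionPair.aestronglyMeasurable_mask (hθ : S.IsExtensionPair μ θ Δ)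
    (i : Fin (n + 1)) : AEStronglyMeasurable (fun ξ => S.mask Δ i (S.𝔭 * ξ)) μ := by
  simp only [mask_prime_mul, Matrix.mulVec, dotProduct]
  refine Finset.aestronglyMeasurable_fun_sum _ fun r _ => (hθ.measurable i r).mul ?_
  exact (continuous_const.mul (Complex.continuous_conj.comp
    ((S.continuous_chi r).comp (continuous_const.mul continuous_id)))).aestronglyMeasurable

theorem IsExtensionPair.memLp_prime_mul (hθ : S.IsExtensionPair μ θ Δ) :
    MemLp (fun ξ => θ (S.𝔭 * ξ)) 2 μ := by
  simpa using S.memLp_dilation μ 1 hθ.memLp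

theorem IsExtensionPair.memLp_mask_mul (hθ : S.IsExtensionPair μ θ Δ) (i : Fin (n + 1)) :
    MemLp (fun ξ => S.mask Δ i (S.𝔭 * ξ) * θ (S.𝔭 * ξ)) 2 μ := by
  refine hθ.memLp_prime_mul.of_le ((hθ.aestronglyMeasurable_mask i).mul hθ.memLp_prime_mul.1) ?_
  filter_upwards [hθ.norm_mask_le] with ξ hξ
  rw [norm_mul]
  exact mul_le_of_le_one_left (norm_nonneg _) (hξ i)

/-- Since the refinement mask is bounded by $1$, $|\theta(\mathfrak p^j\xi)|$ is nondecreasing in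
$j$, and its limit is $1$. -/
theorem IsExtensionPair.norm_le_one (hθ : S.IsExtensionPair μ θ Δ) : ∀ᵐ ξ ∂μ, ‖θ ξ‖ ≤ 1 := by
  have h1 : ∀ᵐ ξ ∂μ, ‖θ ξ‖ ≤ ‖θ (S.𝔭 * ξ)‖ := by
    filter_upwards [hθ.norm_mask_le, hθ.refinement] with ξ h2 h3
    rw [h3, norm_mul]
    exact mul_le_of_le_one_left (norm_nonneg _) (h2 0)
  have h2 : ∀ᵐ ξ ∂μ, ∀ j : ℕ, ‖θ (S.𝔭 ^ j * ξ)‖ ≤ ‖θ (S.𝔭 ^ (j + 1) * ξ)‖ := by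
    refine ae_all_iff.2 fun j => ?_
    filter_upwards [(S.quasiMeasurePreserving_dilation μ j).ae h1] with ξ h3
    rwa [zpow_natCast, ← mul_assoc, ← pow_succ'] at h3
  filter_upwards [h2, hθ.tendsto_one] with ξ h3 h4
  simpa using (monotone_nat_of_le_succ h3).ge_of_tendsto h4 0

end UEP


/-! ### The energy identity between consecutive levels. -/

section OneLevel

set_option linter.unusedSectionVars false

variable {K : Type*} [NontriviallyNormedField K] {p c : ℕ} [NeZero c] (S : FieldData K p c)
  [Fact p.Prime] [IsUltrametricDist K] [ProperSpace K] [MeasurableSpace K] [BorelSpace K]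
  (μ : Measure K) [μ.IsAddHaarMeasure] [hμ : Fact (μ (Metric.closedBall 0 1) = 1)]

/-- The frame coefficient `⟨f, ψ_{j,k}⟩`, in terms of the Fourier transforms `g` of `f` and `θ`
of `ψ`. -/
def coef (g θ : K → ℂ) (j : ℤ) (k : ℕ) : ℂ := ∫ ξ, g ξ * conj (S.waveletHat θ j k ξ) ∂μ

/-- The unitary dilation `q^{j/2} g(𝔭^{-j} ξ)`. -/
def dilate (S : FieldData K p c) (j : ℤ) (g : K → ℂ) (ξ : K) : ℂ :=
  (((S.q : ℝ) ^ ((j : ℝ) / 2) : ℝ) : ℂ) * g (S.𝔭 ^ (-j) * ξ)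

theorem coef_congr {g θ θ' : K → ℂ} (h : θ =ᵐ[μ] θ') (j : ℤ) (k : ℕ) :
    S.coef μ g θ j k = S.coef μ g θ' j k := by
  refine integral_congr_ae ?_
  filter_upwards [(S.quasiMeasurePreserving_dilation μ j).ae h] with ξ hξ
  simp only [waveletHat, hξ]

/-- A unitary dilation of $g$ shifts the level, so the level identities need proof only between
levels $0$ and $1$. -/
theorem coef_add (g θ : K → ℂ) (j i : ℤ) (k : ℕ) :
    S.coef μ g θ (j + i) k = S.coef μ (S.dilate j g) θ i k := by
  have hq := S.q_real_pos
  have h := S.integral_dilation μ (-j) fun ξ => g ξ * conj (S.waveletHat θ (j + i) k ξ)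
  have h1 : S.coef μ g θ (j + i) k = (((p ^ c : ℕ) : ℝ) ^ j : ℝ) • ∫ ξ, g (S.𝔭 ^ (-j) * ξ) *
      conj (S.waveletHat θ (j + i) k (S.𝔭 ^ (-j) * ξ)) ∂μ := by
    rw [h, smul_smul, ← zpow_add₀ hq.ne', add_neg_cancel, zpow_zero, one_smul]; rfl
  rw [h1, ← integral_smul, coef]
  refine integral_congr_ae (ae_of_all _ fun ξ => ?_)
  have h2 : S.𝔭 ^ (j + i) * (S.𝔭 ^ (-j) * ξ) = S.𝔭 ^ i * ξ := by
    rw [← mul_assoc, ← zpow_add₀ S.prime_ne_zero]; congr 2; ring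
  have h3 : ((p ^ c : ℕ) : ℝ) ^ j * ((p ^ c : ℕ) : ℝ) ^ (-(((j + i : ℤ) : ℝ) / 2)) =
      ((p ^ c : ℕ) : ℝ) ^ ((j : ℝ) / 2) * ((p ^ c : ℕ) : ℝ) ^ (-((i : ℝ) / 2)) := by
    rw [← Real.rpow_intCast, ← Real.rpow_add hq, ← Real.rpow_add hq]
    congr 1; push_cast; ring
  simp only [waveletHat, dilate, h2, map_mul, Complex.conj_ofReal, Complex.real_smul]
  calc _ = ((((p ^ c : ℕ) : ℝ) ^ j * ((p ^ c : ℕ) : ℝ) ^ (-(((j + i : ℤ) : ℝ) / 2)) : ℝ) : ℂ) *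
        (g (S.𝔭 ^ (-j) * ξ) * (conj (conj (S.chi k (S.𝔭 ^ i * ξ))) *
          conj (θ (S.𝔭 ^ i * ξ)))) := by push_cast; ring
    _ = _ := by rw [h3]; push_cast; ring

theorem memLp_dilate {g : K → ℂ} (hg : MemLp g 2 μ) (j : ℤ) : MemLp (S.dilate j g) 2 μ :=
  (S.memLp_dilation μ (-j) hg).const_mul _

theorem dilate_eq_zero {g : K → ℂ} {r : ℝ} (hr : ∀ ξ, r < ‖ξ‖ → g ξ = 0) (j : ℤ) (ξ : K)
    (hξ : ‖S.𝔭‖ ^ j * r < ‖ξ‖) : S.dilate j g ξ = 0 := by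
  rw [dilate, hr, mul_zero]
  rw [norm_mul, norm_zpow, zpow_neg]
  exact (lt_inv_mul_iff₀ (zpow_pos S.norm_prime_pos j)).2 hξ

/-- Periodization of a product with a periodic factor. -/
theorem integral_mul_periodic {F a : K → ℂ} (hF : MemLp F 2 μ) (M : ℕ)
    (hM : ∀ ξ, ‖S.𝔭‖ ^ (-(M : ℤ)) < ‖ξ‖ → F ξ = 0) (ha : AEStronglyMeasurable a μ)
    (hb : ∀ᵐ ξ ∂μ, ‖a ξ‖ ≤ 1) (hper : ∀ n, ∀ᵐ ξ ∂μ, a (ξ + S.u n) = a ξ) :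
    ∫ ξ, F ξ * a ξ ∂μ = ∫ ξ, (∑ n ∈ Finset.range ((p ^ c) ^ M), F (ξ + S.u n)) * a ξ
      ∂(unitMeasure μ) := by
  have hFi := integrable_of_bounded_support μ hF hM
  have hFa : Integrable (fun ξ => F ξ * a ξ) μ := hFi.mul_bdd (c := 1) ha hb
  have h1 : ∫ ξ, F ξ * a ξ ∂μ =
      ∫ ξ in Metric.closedBall 0 (‖S.𝔭‖ ^ (-(M : ℤ))), F ξ * a ξ ∂μ := by
    rw [setIntegral_eq_integral_of_forall_compl_eq_zero]
    intro ξ hξ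
    rw [hM ξ (by simpa using hξ), zero_mul]
  have hp : ∀ᵐ ξ ∂μ, ∀ n, a (ξ + S.u n) = a ξ := ae_all_iff.2 hper
  rw [h1, S.setIntegral_eq_sum_u μ M hFa, ← integral_finsetSum]
  · refine integral_congr_ae ?_
    filter_upwards [ae_restrict_of_ae hp] with ξ hξ
    simp only [hξ, Finset.sum_mul]
  · intro n _
    exact (hFa.comp_add_right (S.u n)).integrableOn

theorem norm_entry_le {m n : ℕ} {M : Matrix (Fin m) (Fin n) ℂ} (hM : Mᴴ * M = 1) (i : Fin m)
    (r : Fin n) : ‖M i r‖ ≤ 1 := by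
  have := norm_mulVec_le hM (Pi.single r 1) (by
    rw [Finset.sum_eq_single r] <;> simp +contextual) i
  simpa using this

variable {S μ} {n : ℕ} {θ : K → ℂ} {Δ : K → Matrix (Fin (n + 1)) (Fin (p ^ c)) ℂ}

/-- The Fourier transforms of the generators that belong to the rows of a polyphase matrix. -/
def genHat (S : FieldData K p c) {n : ℕ} (θ : K → ℂ) (Δ : K → Matrix (Fin n) (Fin (p ^ c)) ℂ)
    (i : Fin n) (ξ : K) : ℂ := S.mask Δ i (S.𝔭 * ξ) * θ (S.𝔭 * ξ)

theorem IsExtensionPair.genHat_zero (hθ : S.IsExtensionPair μ θ Δ) : S.genHat θ Δ 0 =ᵐ[μ] θ := by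
  filter_upwards [hθ.refinement] with ξ hξ
  exact hξ.symm

/-- The coefficients of one level are Fourier coefficients on the ring of integers. -/
theorem IsExtensionPair.exists_bracket (hθ : S.IsExtensionPair μ θ Δ) {g : K → ℂ}
    (hg : MemLp g 2 μ) {R : ℝ} (hR : ∀ ξ, R < ‖ξ‖ → g ξ = 0) :
    ∃ W : Fin (p ^ c) → K → ℂ, (∀ r, MemLp (W r) 2 (unitMeasure μ)) ∧
      (∀ (r : Fin (p ^ c)) k, S.coef μ g θ 1 (r + p ^ c * k) =
        ∫ ξ, W r ξ * S.chi k ξ ∂(unitMeasure μ)) ∧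
      (∀ i, MemLp (fun ξ => conj ((Δ ξ *ᵥ fun r => conj (W r ξ)) i)) 2 (unitMeasure μ)) ∧
      ∀ i k, S.coef μ g (S.genHat θ Δ i) 0 k =
        ∫ ξ, conj ((Δ ξ *ᵥ fun r => conj (W r ξ)) i) * S.chi k ξ ∂(unitMeasure μ) := by
  have hq := S.q_real_pos
  obtain ⟨M, hM⟩ := S.exists_le_zpow_neg R
  set a : ℂ := ((1 / Real.sqrt S.q : ℝ) : ℂ) with ha
  -- The factor $a=q^{-1/2}$ is the normalization of level one. As $g$ has bounded support, the
  -- periodization $W_r$ of $F_r$ is a finite sum.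
  set F : Fin (p ^ c) → K → ℂ := fun r ξ =>
    g ξ * (a * (conj (θ (S.𝔭 * ξ)) * S.chi r (S.𝔭 * ξ))) with hF
  have hchi : ∀ r : ℕ, Continuous fun ξ : K => S.chi r (S.𝔭 * ξ) := fun r =>
    (S.continuous_chi r).comp (continuous_const.mul continuous_id)
  have hFm : ∀ r, MemLp (F r) 2 μ := by
    intro r
    refine (hg.const_mul a).of_le (hg.1.mul (((Complex.continuous_conj.comp_aestronglyMeasurable
      hθ.memLp_prime_mul.1).mul (hchi r).aestronglyMeasurable).const_mul a)) ?_
    have h1 := (S.quasiMeasurePreserving_dilation μ 1).ae hθ.norm_le_one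
    rw [zpow_one] at h1
    filter_upwards [h1] with ξ hξ
    simp only [hF, norm_mul, norm_chi, RCLike.norm_conj, mul_one]
    rw [← mul_assoc, mul_comm ‖a‖]
    exact mul_le_of_le_one_right (by positivity) hξ
  have hFs : ∀ r ξ, ‖S.𝔭‖ ^ (-(M : ℤ)) < ‖ξ‖ → F r ξ = 0 := fun r ξ hξ => by
    simp only [hF, hR ξ (hM.trans_lt hξ), zero_mul]
  set W : Fin (p ^ c) → K → ℂ := fun r ξ =>
    ∑ n ∈ Finset.range ((p ^ c) ^ M), F r (ξ + S.u n) with hW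
  have hWm : ∀ r, MemLp (W r) 2 (unitMeasure μ) := by
    intro r
    refine memLp_finsetSum _ fun n _ => ?_
    exact ((hFm r).comp_measurePreserving (measurePreserving_add_right μ (S.u n))).restrict _
  have hent : ∀ i r, ∀ᵐ ξ ∂μ, ‖conj (Δ ξ i r)‖ ≤ 1 := fun i r => by
    filter_upwards [hθ.isometry] with ξ hξ
    rw [RCLike.norm_conj]
    exact norm_entry_le hξ i r
  have hentm : ∀ i r, AEStronglyMeasurable (fun ξ => conj (Δ ξ i r)) μ := fun i r =>
    Complex.continuous_conj.comp_aestronglyMeasurable (hθ.measurable i r)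
  -- The generator enters its coefficient conjugated, hence so do the entries of $\Delta$; the outer
  -- and inner conjugates make the sum a matrix product with $\Delta$ itself, to which the isometry
  -- property applies.
  have hX : ∀ i ξ, conj ((Δ ξ *ᵥ fun r => conj (W r ξ)) i) = ∑ r, W r ξ * conj (Δ ξ i r) := by
    intro i ξ
    simp only [Matrix.mulVec, dotProduct, map_sum, map_mul, Complex.conj_conj]
    exact Finset.sum_congr rfl fun r _ => mul_comm _ _
  have hWD : ∀ i r, MemLp (fun ξ => W r ξ * conj (Δ ξ i r)) 2 (unitMeasure μ) := by
    intro i r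
    refine (hWm r).of_le ((hWm r).1.mul (hentm i r).restrict) ?_
    filter_upwards [ae_restrict_of_ae (hent i r)] with ξ hξ
    rw [norm_mul]
    exact mul_le_of_le_one_right (norm_nonneg _) hξ
  refine ⟨W, hWm, fun r k => ?_, fun i => ?_, fun i k => ?_⟩
  · rw [← S.integral_mul_periodic μ (hFm r) M (hFs r) (S.continuous_chi k).aestronglyMeasurable
      (ae_of_all _ fun ξ => (S.norm_chi k ξ).le)
      fun n => ae_of_all _ fun ξ => S.chi_periodic k n ξ]
    refine integral_congr_ae (ae_of_all _ fun ξ => ?_)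
    have hc : ((((p ^ c : ℕ) : ℝ) ^ (-(((1 : ℤ) : ℝ) / 2)) : ℝ) : ℂ) = a := by
      rw [ha, Real.sqrt_eq_rpow, Real.rpow_neg hq.le, one_div, Int.cast_one]
    simp only [hF, waveletHat, hc, zpow_one, map_mul, Complex.conj_conj, S.chi_add_mul r.2,
      inv_mul_cancel_left₀ S.prime_ne_zero, ha, Complex.conj_ofReal]
    ring
  · simp only [hX]
    exact memLp_finsetSum _ fun r _ => hWD i r
  · have hbd : IsFiniteMeasure (unitMeasure μ) := ⟨by simp [hμ.out]⟩
    simp only [hX, Finset.sum_mul]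
    rw [integral_finsetSum]
    · have h1 : ∀ r, ∫ ξ, W r ξ * conj (Δ ξ i r) * S.chi k ξ ∂(unitMeasure μ) =
          ∫ ξ, F r ξ * (conj (Δ ξ i r) * S.chi k ξ) ∂μ := by
        intro r
        rw [S.integral_mul_periodic μ (a := fun ξ => conj (Δ ξ i r) * S.chi k ξ) (hFm r) M (hFs r)
          ((hentm i r).mul (S.continuous_chi k).aestronglyMeasurable)]
        · exact integral_congr_ae (ae_of_all _ fun ξ => by simp only [hW]; ring)
        · filter_upwards [hent i r] with ξ hξ
          rw [norm_mul, norm_chi, mul_one]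
          exact hξ
        · intro n
          filter_upwards [hθ.periodic n] with ξ hξ
          rw [hξ, chi_periodic]
      simp only [h1]
      rw [← integral_finsetSum, coef]
      · refine integral_congr_ae (ae_of_all _ fun ξ => ?_)
        simp only [hF, waveletHat, genHat, mask_prime_mul, Matrix.mulVec, dotProduct, zpow_zero,
          one_mul, Int.cast_zero, zero_div, neg_zero, Real.rpow_zero, Complex.ofReal_one, map_mul,
          map_sum, Complex.conj_conj, Complex.conj_ofReal, Finset.mul_sum, Finset.sum_mul]
        exact Finset.sum_congr rfl fun r _ => by ring
      · intro r _
        refine (integrable_of_bounded_support μ (hFm r) (hFs r)).mul_bdd (c := 1)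
          ((hentm i r).mul (S.continuous_chi k).aestronglyMeasurable) ?_
        filter_upwards [hent i r] with ξ hξ
        rw [norm_mul, norm_chi, mul_one]
        exact hξ
    · intro r _
      exact ((hWD i r).integrable (by norm_num)).mul_bdd (c := 1)
        (S.continuous_chi k).aestronglyMeasurable (ae_of_all _ fun ξ => (S.norm_chi k ξ).le)

/-- The energy of the coefficients `⟨f, ψ_{j,k}⟩`, `k ∈ ℕ`. -/
def energy (S : FieldData K p c) (μ : Measure K) (g θ : K → ℂ) (j : ℤ) : ℝ≥0∞ :=
  ∑' k, ‖S.coef μ g θ j k‖ₑ ^ 2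

theorem IsExtensionPair.energy_one (hθ : S.IsExtensionPair μ θ Δ) {g : K → ℂ}
    (hg : MemLp g 2 μ) {R : ℝ} (hR : ∀ ξ, R < ‖ξ‖ → g ξ = 0) :
    S.energy μ g θ 1 = ∑ i, S.energy μ g (S.genHat θ Δ i) 0 := by
  obtain ⟨W, hW, h1, hX, h2⟩ := hθ.exists_bracket hg hR
  have hne : NeZero (p ^ c) := ⟨S.q_pos.ne'⟩
  have e1 : S.energy μ g θ 1 = ∑ r, ∑' k, ‖∫ ξ, W r ξ * S.chi k ξ ∂(unitMeasure μ)‖ₑ ^ 2 := by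
    simp only [← h1]
    rw [energy, ← (Nat.divModEquiv (p ^ c)).symm.tsum_eq, ENNReal.tsum_prod', ENNReal.tsum_comm,
      tsum_fintype]
    refine Finset.sum_congr rfl fun r _ => tsum_congr fun k => ?_
    congr 3
    simp [Nat.divModEquiv, mul_comm, add_comm]
  -- Parseval on $\mathfrak D$ turns both sides into integrals; these agree because $\Delta(\xi)$
  -- preserves the norm of $\overline{W(\xi)}$.
  rw [e1]
  simp only [energy, h2, S.tsum_enorm_coeff_sq μ (hW _), S.tsum_enorm_coeff_sq μ (hX _)]
  rw [← lintegral_finsetSum' _ fun r _ => ((hW r).1.enorm).pow_const 2,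
    ← lintegral_finsetSum' _ fun i _ => ((hX i).1.enorm).pow_const 2]
  refine lintegral_congr_ae ?_
  filter_upwards [ae_restrict_of_ae hθ.isometry] with ξ hξ
  have h3 := sum_normSq_mulVec hξ fun r => conj (W r ξ)
  simp only [RCLike.norm_conj] at h3
  have h4 : ∀ z : ℂ, ‖z‖ₑ ^ 2 = ENNReal.ofReal (‖z‖ ^ 2) := fun z => by
    rw [ENNReal.ofReal_pow (norm_nonneg _), ofReal_norm]
  simp only [h4, RCLike.norm_conj]
  rw [← ENNReal.ofReal_sum_of_nonneg fun _ _ => by positivity,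
    ← ENNReal.ofReal_sum_of_nonneg fun _ _ => by positivity, h3]

theorem energy_add (g θ : K → ℂ) (j i : ℤ) :
    S.energy μ g θ (j + i) = S.energy μ (S.dilate j g) θ i := by
  simp only [energy, coef_add]

/-- The energy identity between consecutive levels. -/
theorem IsExtensionPair.energy_succ (hθ : S.IsExtensionPair μ θ Δ) {g : K → ℂ}
    (hg : MemLp g 2 μ) {R : ℝ} (hR : ∀ ξ, R < ‖ξ‖ → g ξ = 0) (j : ℤ) :
    S.energy μ g θ (j + 1) =
      S.energy μ g θ j + ∑ i : Fin n, S.energy μ g (S.genHat θ Δ i.succ) j := by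
  -- Row $0$ contributes the energy of $\theta$ itself, by the refinement equation.
  rw [energy_add, hθ.energy_one (S.memLp_dilate μ hg j) (S.dilate_eq_zero hR j),
    Fin.sum_univ_succ]
  simp only [← energy_add, add_zero]
  congr 1
  simp only [energy, S.coef_congr μ hθ.genHat_zero]

end OneLevel

end FieldData

/-- Extended nonnegative values do not subtract well, so the telescoping is kept additive:
$N(-J)+\sum_{-J\le j<J}E(j)=N(J)$. -/
theorem tsum_int_of_telescope {N E : ℤ → ℝ≥0∞} {a : ℝ≥0∞} (hN : ∀ j, N (j + 1) = N j + E j)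
    (hpos : Tendsto (fun J : ℕ => N J) atTop (𝓝 a))
    (hneg : Tendsto (fun J : ℕ => N (-J)) atTop (𝓝 0)) : ∑' j, E j = a := by
  have h1 : ∀ (i : ℤ) (m : ℕ), N i + ∑ j ∈ Finset.Ico i (i + m), E j = N (i + m) := by
    intro i m
    induction m with
    | zero => simp
    | succ m ih =>
      have hI : Finset.Ico i (i + ((m + 1 : ℕ) : ℤ)) =
          insert (i + (m : ℤ)) (Finset.Ico i (i + m)) := by
        ext x; simp only [Finset.mem_Ico, Finset.mem_insert]; omega
      rw [hI, Finset.sum_insert (by simp), Nat.cast_succ, ← add_assoc i, hN, ← ih,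
        add_comm (E _), add_assoc]
  have h2 : Tendsto (fun J : ℕ => N (-J) + ∑ j ∈ Finset.Ico (-J : ℤ) J, E j) atTop
      (𝓝 (0 + ∑' j, E j)) :=
    hneg.add (ENNReal.summable.hasSum.comp Finset.tendsto_Ico_neg)
  rw [zero_add] at h2
  refine tendsto_nhds_unique h2 (hpos.congr fun J => ?_)
  have h3 := h1 (-J) (2 * J)
  have h4 : (-J + ((2 * J : ℕ) : ℤ) : ℤ) = J := by push_cast; ring
  rw [h4] at h3
  exact h3.symm

namespace FieldData

/-! ### Energies at very fine and very coarse levels; Parseval and orthogonality for test functions.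
-/

section Limits

set_option linter.unusedSectionVars false

variable {K : Type*} [NontriviallyNormedField K] {p c : ℕ} [NeZero c] {S : FieldData K p c}
  [Fact p.Prime] [IsUltrametricDist K] [ProperSpace K] [MeasurableSpace K] [BorelSpace K]
  {μ : Measure K} [μ.IsAddHaarMeasure] [hμ : Fact (μ (Metric.closedBall 0 1) = 1)]
  {n : ℕ} {θ : K → ℂ} {Δ : K → Matrix (Fin (n + 1)) (Fin (p ^ c)) ℂ}

/-- For $g$ supported in $\mathfrak D$ the level-zero coefficients are the Fourier coefficients of
$g\bar\theta$ on $\mathfrak D$, so this is Parseval there. -/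
theorem IsExtensionPair.energy_zero (hθ : S.IsExtensionPair μ θ Δ) {g : K → ℂ}
    (hg : MemLp g 2 μ) (hR : ∀ ξ, 1 < ‖ξ‖ → g ξ = 0) :
    S.energy μ g θ 0 = ∫⁻ ξ, ‖g ξ‖ₑ ^ 2 * ‖θ ξ‖ₑ ^ 2 ∂μ := by
  have hX : MemLp (fun ξ => g ξ * conj (θ ξ)) 2 μ := by
    refine hg.of_le (hg.1.mul (Complex.continuous_conj.comp_aestronglyMeasurable hθ.memLp.1)) ?_
    filter_upwards [hθ.norm_le_one] with ξ hξ
    rw [norm_mul, RCLike.norm_conj]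
    exact mul_le_of_le_one_right (norm_nonneg _) hξ
  have h1 := S.tsum_enorm_coeff_sq μ (hX.restrict (Metric.closedBall 0 1))
  have h2 : ∀ k, S.coef μ g θ 0 k = ∫ ξ, g ξ * conj (θ ξ) * S.chi k ξ ∂(unitMeasure μ) := by
    intro k
    rw [setIntegral_eq_integral_of_forall_compl_eq_zero, coef]
    · refine integral_congr_ae (ae_of_all _ fun ξ => ?_)
      simp only [waveletHat, Int.cast_zero, zero_div, neg_zero, Real.rpow_zero, Complex.ofReal_one,
        one_mul, zpow_zero, map_mul, Complex.conj_conj]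
      ring
    · intro ξ hξ
      rw [hR ξ (by simpa using hξ), zero_mul, zero_mul]
  simp only [energy, h2]
  refine h1.trans ?_
  simp only [enorm_mul, RCLike.enorm_conj, mul_pow]
  refine setLIntegral_eq_of_support_subset fun ξ hξ => ?_
  by_contra h
  exact hξ (by simp [hR ξ (by simpa using h)])

theorem IsExtensionPair.energy_eq_lintegral (hθ : S.IsExtensionPair μ θ Δ) {g : K → ℂ}
    (hg : MemLp g 2 μ) {M J : ℕ} (hMJ : M ≤ J)
    (hM : ∀ ξ, ‖S.𝔭‖ ^ (-(M : ℤ)) < ‖ξ‖ → g ξ = 0) :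
    S.energy μ g θ J = ∫⁻ ξ, ‖g ξ‖ₑ ^ 2 * ‖θ (S.𝔭 ^ J * ξ)‖ₑ ^ 2 ∂μ := by
  have hq := S.q_real_pos
  have h1 := energy_add (S := S) (μ := μ) g θ J 0
  rw [add_zero] at h1
  rw [h1, hθ.energy_zero (S.memLp_dilate μ hg J) (fun ξ hξ => S.dilate_eq_zero hM J ξ
    (lt_of_le_of_lt ?_ hξ))]
  · have h2 := S.lintegral_dilation μ J fun ξ => ‖S.dilate J g ξ‖ₑ ^ 2 * ‖θ ξ‖ₑ ^ 2
    have h3 : ∀ ξ, ‖S.dilate J g (S.𝔭 ^ (J : ℤ) * ξ)‖ₑ ^ 2 =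
        ENNReal.ofReal (((p ^ c : ℕ) : ℝ) ^ (J : ℤ)) * ‖g ξ‖ₑ ^ 2 := by
      intro ξ
      rw [dilate, ← mul_assoc (S.𝔭 ^ (-(J : ℤ))), ← zpow_add₀ S.prime_ne_zero, neg_add_cancel,
        zpow_zero, one_mul, enorm_mul, mul_pow, ← ofReal_norm, Complex.norm_real,
        Real.norm_of_nonneg (by positivity), ← ENNReal.ofReal_pow (by positivity),
        ← Real.rpow_natCast, ← Real.rpow_mul hq.le, ← Real.rpow_intCast]
      simp
    simp only [h3, mul_assoc] at h2
    simp only [zpow_natCast] at h2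
    rw [lintegral_const_mul' _ _ ENNReal.ofReal_ne_top] at h2
    exact ((ENNReal.mul_right_inj (ENNReal.ofReal_pos.2 (by positivity)).ne'
      ENNReal.ofReal_ne_top).1 h2).symm
  · rw [← zpow_add₀ S.norm_prime_pos.ne', ← sub_eq_add_neg, ← Nat.cast_sub hMJ, zpow_natCast]
    exact pow_le_one₀ S.norm_prime_pos.le S.norm_prime_lt.le

/-- At a high enough level the dilate of $g$ is supported in $\mathfrak D$, and the energy is
$\int|g|^2|\theta(\mathfrak p^J\cdot)|^2$. Dominated convergence applies because $|\theta|\le1$ and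
$|\theta(\mathfrak p^J\xi)|\to1$. -/
theorem IsExtensionPair.tendsto_energy_atTop (hθ : S.IsExtensionPair μ θ Δ) {g : K → ℂ}
    (hg : MemLp g 2 μ) {R : ℝ} (hR : ∀ ξ, R < ‖ξ‖ → g ξ = 0) :
    Tendsto (fun J : ℕ => S.energy μ g θ J) atTop (𝓝 (eLpNorm g 2 μ ^ 2)) := by
  obtain ⟨M, hM⟩ := S.exists_le_zpow_neg R
  have h1 : Tendsto (fun J : ℕ => ∫⁻ ξ, ‖g ξ‖ₑ ^ 2 * ‖θ (S.𝔭 ^ J * ξ)‖ₑ ^ 2 ∂μ) atTop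
      (𝓝 (∫⁻ ξ, ‖g ξ‖ₑ ^ 2 ∂μ)) := by
    refine tendsto_lintegral_of_dominated_convergence' (fun ξ => ‖g ξ‖ₑ ^ 2) (fun J => ?_)
      (fun J => ?_) ?_ ?_
    · have h2 := (S.memLp_dilation μ J hθ.memLp).1
      simp only [zpow_natCast] at h2
      exact (hg.1.enorm.pow_const 2).mul (h2.enorm.pow_const 2)
    · have h2 := (S.quasiMeasurePreserving_dilation μ J).ae hθ.norm_le_one
      simp only [zpow_natCast] at h2
      filter_upwards [h2] with ξ hξ
      refine mul_le_of_le_one_right' (pow_le_one' ?_ 2)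
      rw [← ofReal_norm, ← ENNReal.ofReal_one]
      exact ENNReal.ofReal_le_ofReal hξ
    · rw [← eLpNorm_two_sq]
      exact (ENNReal.pow_lt_top hg.2).ne
    · filter_upwards [hθ.tendsto_one] with ξ hξ
      have h2 : Tendsto (fun J : ℕ => ‖θ (S.𝔭 ^ J * ξ)‖ₑ) atTop (𝓝 1) := by
        have := ENNReal.tendsto_ofReal hξ
        simpa only [ofReal_norm, ENNReal.ofReal_one] using this
      have h3 := ENNReal.Tendsto.const_mul (a := ‖g ξ‖ₑ ^ 2) (ENNReal.Tendsto.pow (n := 2) h2)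
        (Or.inr (ENNReal.pow_ne_top enorm_ne_top))
      simpa using h3
  rw [eLpNorm_two_sq]
  refine h1.congr' ?_
  filter_upwards [eventually_ge_atTop M] with J hJ
  exact (hθ.energy_eq_lintegral hg hJ fun ξ hξ => hR ξ (hM.trans_lt hξ)).symm

theorem enorm_integral_mul_conj_sq_le {α : Type*} {m : MeasurableSpace α} {ν : Measure α}
    {f w : α → ℂ} (hf : MemLp f 2 ν) (hw : MemLp w 2 ν) :
    ‖∫ x, f x * conj (w x) ∂ν‖ₑ ^ 2 ≤ eLpNorm f 2 ν ^ 2 * eLpNorm w 2 ν ^ 2 := by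
  rw [← inner_toLp hw hf, ← mul_pow, ← Lp.enorm_toLp hf, ← Lp.enorm_toLp hw]
  refine pow_le_pow_left' ?_ 2
  rw [← ofReal_norm, ← ofReal_norm, ← ofReal_norm, ← ENNReal.ofReal_mul (norm_nonneg _), mul_comm]
  exact ENNReal.ofReal_le_ofReal (norm_inner_le_norm _ _)

/-- The energy of a wavelet in a ball, as a mass of the generator. -/
theorem lintegral_ball_wavelet (S : FieldData K p c) (φ : K → ℂ) (J : ℕ) (k : ℕ) (r : ℝ) :
    ∫⁻ x in Metric.closedBall 0 r, ‖S.wavelet φ (-J) k x‖ₑ ^ 2 ∂μ =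
      ∫⁻ y in Metric.closedBall (-S.u k) (‖S.𝔭‖ ^ J * r), ‖φ y‖ₑ ^ 2 ∂μ := by
  have hq := S.q_real_pos
  have hpJ : 0 < ‖S.𝔭‖ ^ J := pow_pos S.norm_prime_pos J
  set H : K → ℝ≥0∞ := (Metric.closedBall (-S.u k) (‖S.𝔭‖ ^ J * r)).indicator
    fun y => ‖φ y‖ₑ ^ 2 with hH
  have h1 := S.lintegral_dilation μ J fun y => H (y - S.u k)
  have h2 : ∫⁻ y, H (y - S.u k) ∂μ = ∫⁻ y, H y ∂μ := lintegral_sub_right_eq_self H (S.u k)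
  have h3 : ∀ x, (Metric.closedBall 0 r).indicator (fun x => ‖S.wavelet φ (-J) k x‖ₑ ^ 2) x =
      ENNReal.ofReal (((p ^ c : ℕ) : ℝ) ^ (-(J : ℤ))) * H (S.𝔭 ^ (J : ℤ) * x - S.u k) := by
    intro x
    have hmem : S.𝔭 ^ (J : ℤ) * x - S.u k ∈ Metric.closedBall (-S.u k) (‖S.𝔭‖ ^ J * r) ↔
        x ∈ Metric.closedBall (0 : K) r := by
      rw [mem_closedBall_iff_norm, mem_closedBall_iff_norm, sub_neg_eq_add, sub_add_cancel,
        norm_mul, zpow_natCast, norm_pow, mul_le_mul_iff_right₀ hpJ, sub_zero]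
    by_cases hx : x ∈ Metric.closedBall (0 : K) r
    · rw [hH, Set.indicator_of_mem hx, Set.indicator_of_mem (hmem.2 hx), wavelet, enorm_mul,
        mul_pow, neg_neg, ← ofReal_norm, Complex.norm_real, Real.norm_of_nonneg (by positivity),
        ← ENNReal.ofReal_pow (by positivity), ← Real.rpow_natCast, ← Real.rpow_mul hq.le,
        ← Real.rpow_intCast]
      simp
    · rw [hH, Set.indicator_of_notMem hx, Set.indicator_of_notMem fun h => hx (hmem.1 h), mul_zero]
  rw [← lintegral_indicator measurableSet_closedBall, lintegral_congr h3,
    lintegral_const_mul' _ _ ENNReal.ofReal_ne_top, h1, h2, ← mul_assoc,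
    ← ENNReal.ofReal_mul (by positivity), ← zpow_add₀ hq.ne', neg_add_cancel, zpow_zero,
    ENNReal.ofReal_one, one_mul, hH, lintegral_indicator measurableSet_closedBall]

/-- The union of the balls shrinks to a countable set, which is null for the finite measure
$|\varphi|^2dx$. Once the radius is below $1$ the balls are disjoint, and the sum is the measure of
the union. -/
theorem tendsto_sum_lintegral_balls (S : FieldData K p c) {φ : K → ℂ} (hφ : MemLp φ 2 μ) {r : ℝ}
    (hr0 : 0 ≤ r) :
    Tendsto (fun J : ℕ => ∑' k, ∫⁻ y in Metric.closedBall (-S.u k) (‖S.𝔭‖ ^ J * r), ‖φ y‖ₑ ^ 2 ∂μ)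
      atTop (𝓝 0) := by
  set ν := μ.withDensity fun y => ‖φ y‖ₑ ^ 2 with hν
  have hfin : IsFiniteMeasure ν := ⟨by
    rw [hν, withDensity_apply _ MeasurableSet.univ, Measure.restrict_univ, ← eLpNorm_two_sq]
    exact ENNReal.pow_lt_top hφ.2⟩
  set E : ℕ → Set K := fun J => ⋃ k, Metric.closedBall (-S.u k) (‖S.𝔭‖ ^ J * r) with hE
  have hr : Tendsto (fun J : ℕ => ‖S.𝔭‖ ^ J * r) atTop (𝓝 0) := by
    simpa using (tendsto_pow_atTop_nhds_zero_of_lt_one (norm_nonneg _) S.norm_prime_lt).mul_const r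
  have hsub : ⋂ J, E J ⊆ Set.range fun k => -S.u k := by
    intro y hy
    simp only [hE, Set.mem_iInter, Set.mem_iUnion, mem_closedBall_iff_norm] at hy
    choose k hk using hy
    -- From $J_0$ on the radius is below $1$, so the ball containing $y$ keeps the same centre, and
    -- $y$ equals that centre.
    obtain ⟨J₀, hJ₀⟩ := eventually_atTop.1 (hr.eventually (gt_mem_nhds one_pos))
    have hconst : ∀ J ≥ J₀, k J = k J₀ := by
      intro J hJ
      refine S.u_injective ?_
      have h1 := (hk J).trans (hJ₀ J hJ).le
      have h2 := (hk J₀).trans (hJ₀ J₀ le_rfl).le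
      simpa using norm_sub_le' h1 h2
    refine ⟨k J₀, ?_⟩
    have h3 : ‖y - -S.u (k J₀)‖ ≤ 0 := by
      refine ge_of_tendsto hr ?_
      filter_upwards [eventually_ge_atTop J₀] with J hJ
      have := hk J
      rwa [hconst J hJ] at this
    exact (sub_eq_zero.1 (norm_le_zero_iff.1 h3)).symm
  have hnull : ν (⋂ J, E J) = 0 := by
    have h1 : μ (⋂ J, E J) = 0 :=
      ((Set.countable_range fun k => -S.u k).mono hsub).measure_zero μ
    exact withDensity_absolutelyContinuous _ _ h1
  have hmeas : ∀ J, MeasurableSet (E J) := fun J =>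
    MeasurableSet.iUnion fun _ => measurableSet_closedBall
  have hanti : Antitone E := by
    intro I J hIJ
    refine Set.iUnion_mono fun k => Metric.closedBall_subset_closedBall ?_
    exact mul_le_mul_of_nonneg_right
      (pow_le_pow_of_le_one S.norm_prime_pos.le S.norm_prime_lt.le hIJ) hr0
  have hlim := tendsto_measure_iInter_atTop (fun J => (hmeas J).nullMeasurableSet) hanti
    ⟨0, measure_ne_top ν _⟩
  rw [hnull] at hlim
  refine hlim.congr' ?_
  filter_upwards [hr.eventually (gt_mem_nhds one_pos)] with J hJ
  simp only [Function.comp, hE]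
  rw [measure_iUnion _ fun _ => measurableSet_closedBall]
  · exact tsum_congr fun k => withDensity_apply _ measurableSet_closedBall
  · intro k l hkl
    refine Set.disjoint_left.2 fun x hx hy => hkl (S.u_injective ?_)
    rw [mem_closedBall_iff_norm] at hx hy
    simpa using norm_sub_le' (hx.trans hJ.le) (hy.trans hJ.le)

/-- Each coefficient involves $\varphi_{-J,k}$ only on a fixed ball around the support of $f$.
Cauchy–Schwarz bounds the energy by $\|f\|^2$ times the mass of $|\varphi|^2$ on the balls of
`tendsto_sum_lintegral_balls`. -/
theorem tendsto_energy_atBot {f g φ : K → ℂ} (hf : S.IsFourierL2 μ f g)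
    (hφ : S.IsFourierL2 μ φ θ) {r : ℝ} (hr : ∀ x, r < ‖x‖ → f x = 0) :
    Tendsto (fun J : ℕ => S.energy μ g θ (-J)) atTop (𝓝 0) := by
  set ρ := max r 0 with hρ
  have h1 := tendsto_sum_lintegral_balls (μ := μ) S hφ.1 (le_max_right r 0)
  have h2 := ENNReal.Tendsto.const_mul (a := eLpNorm f 2 μ ^ 2) h1
    (Or.inr (ENNReal.pow_ne_top hf.1.2.ne))
  rw [mul_zero] at h2
  refine tendsto_of_tendsto_of_tendsto_of_le_of_le tendsto_const_nhds h2 (fun _ => zero_le)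
    fun J => ?_
  simp only [energy]
  rw [← ENNReal.tsum_mul_left]
  refine ENNReal.tsum_le_tsum fun k => ?_
  have hw := S.isFourierL2_wavelet μ hφ (-J) k
  rw [coef, ← S.integral_mul_conj_eq μ hf hw]
  have h3 : ∫ x, f x * conj (S.wavelet φ (-J) k x) ∂μ = ∫ x, f x *
      conj ((Metric.closedBall (0 : K) ρ).indicator (S.wavelet φ (-J) k) x) ∂μ := by
    refine integral_congr_ae (ae_of_all _ fun x => ?_)
    by_cases hx : x ∈ Metric.closedBall (0 : K) ρ
    · simp [hx]
    · rw [mem_closedBall_zero_iff, not_le] at hx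
      have : f x = 0 := hr x ((le_max_left r 0).trans_lt hx)
      simp [this]
  rw [h3]
  refine (enorm_integral_mul_conj_sq_le hf.1 (memLp_indicator_closedBall μ hw.1 ρ)).trans ?_
  rw [eLpNorm_indicator_eq_eLpNorm_restrict measurableSet_closedBall,
    eLpNorm_two_sq (S.wavelet _ _ _),
    lintegral_ball_wavelet]

/-- Parseval's identity for test functions. -/
theorem IsExtensionPair.tsum_energy (hθ : S.IsExtensionPair μ θ Δ) {f g φ : K → ℂ}
    (hf : S.IsFourierL2 μ f g) (hφ : S.IsFourierL2 μ φ θ) {r R : ℝ}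
    (hr : ∀ x, r < ‖x‖ → f x = 0) (hR : ∀ ξ, R < ‖ξ‖ → g ξ = 0) :
    ∑' j : ℤ, ∑ i : Fin n, S.energy μ g (S.genHat θ Δ i.succ) j = eLpNorm g 2 μ ^ 2 :=
  tsum_int_of_telescope (hθ.energy_succ hf.2.1 hR) (hθ.tendsto_energy_atTop hf.2.1 hR)
    (tendsto_energy_atBot hf hφ hr)

/-- Orthogonality of the coefficients of one level. -/
theorem IsExtensionPair.hasSum_coef_mul_conj (hθ : S.IsExtensionPair μ θ Δ) {θ' : K → ℂ}
    {Δ' : K → Matrix (Fin (n + 1)) (Fin (p ^ c)) ℂ} (hθ' : S.IsExtensionPair μ θ' Δ')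
    (hcross : ∀ᵐ ξ ∂μ, ∀ w w', ∑ i : Fin n,
      conj ((Δ ξ *ᵥ w) i.succ) * (Δ' ξ *ᵥ w') i.succ = 0)
    {g g' : K → ℂ} (hg : MemLp g 2 μ) (hg' : MemLp g' 2 μ) {R R' : ℝ}
    (hR : ∀ ξ, R < ‖ξ‖ → g ξ = 0) (hR' : ∀ ξ, R' < ‖ξ‖ → g' ξ = 0) (j : ℤ) :
    HasSum (fun k => ∑ i : Fin n, S.coef μ g (S.genHat θ Δ i.succ) j k *
      conj (S.coef μ g' (S.genHat θ' Δ' i.succ) j k)) 0 := by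
  obtain ⟨W, -, -, hX, h1⟩ := hθ.exists_bracket (S.memLp_dilate μ hg j) (S.dilate_eq_zero hR j)
  obtain ⟨W', -, -, hX', h1'⟩ :=
    hθ'.exists_bracket (S.memLp_dilate μ hg' j) (S.dilate_eq_zero hR' j)
  have h2 := fun (g θ : K → ℂ) k => S.coef_add μ g θ j 0 k
  simp only [add_zero] at h2
  simp only [h2, h1, h1']
  -- Parseval on $\mathfrak D$ gives the integral of the pointwise product summed over the
  -- generators, and this integrand vanishes by `hcross`.
  have h3 := hasSum_sum (s := Finset.univ) fun (i : Fin n) _ =>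
    S.hasSum_coeff_mul_conj μ (hX i.succ) (hX' i.succ)
  convert! h3 using 1
  rw [← integral_finsetSum]
  · symm
    refine integral_eq_zero_of_ae ?_
    filter_upwards [ae_restrict_of_ae hcross] with ξ hξ
    simp only [Complex.conj_conj]
    exact hξ _ _
  · intro i _
    exact (hX i.succ).integrable_mul (hX' i.succ).star

end Limits

end FieldData

/-! ### Bessel and Parseval families in a Hilbert space: extension from a dense subspace. -/

section Analysis

variable {ι H : Type*} [NormedAddCommGroup H] [InnerProductSpace ℂ H]

theorem enorm_lp_two_sq (x : lp (fun _ : ι => ℂ) 2) : ‖x‖ₑ ^ 2 = ∑' i, ‖x i‖ₑ ^ 2 := by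
  have h : HasSum (fun i => ‖x i‖ ^ 2) (‖x‖ ^ 2) := by
    simpa using lp.hasSum_norm (p := 2) (by norm_num) x
  have h1 := ENNReal.ofReal_tsum_of_nonneg (fun i => sq_nonneg ‖x i‖) h.summable
  rw [h.tsum_eq] at h1
  simpa [ENNReal.ofReal_pow, ofReal_norm] using h1

variable {e : ι → H} {V : Submodule ℂ H}

/-- Bessel's inequality extends from a dense subspace. -/
theorem tsum_enorm_inner_sq_le_of_dense (hV : V.topologicalClosure = ⊤)
    (h : ∀ f ∈ V, ∑' i, ‖inner ℂ (e i) f‖ₑ ^ 2 ≤ ‖f‖ₑ ^ 2) (f : H) :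
    ∑' i, ‖inner ℂ (e i) f‖ₑ ^ 2 ≤ ‖f‖ₑ ^ 2 := by
  -- Each finite partial sum is continuous in $f$, so its bound passes to the closure of $V$; the
  -- whole sum is their supremum.
  rw [ENNReal.tsum_eq_iSup_sum]
  refine iSup_le fun s => ?_
  have hd : Dense (V : Set H) := Submodule.dense_iff_topologicalClosure_eq_top.2 hV
  have hc : IsClosed {f : H | ∑ i ∈ s, ‖inner ℂ (e i) f‖ₑ ^ 2 ≤ ‖f‖ₑ ^ 2} :=
    isClosed_le (continuous_finsetSum _ fun i _ => by fun_prop) (by fun_prop)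
  exact (hd.induction (P := fun f => ∑ i ∈ s, ‖inner ℂ (e i) f‖ₑ ^ 2 ≤ ‖f‖ₑ ^ 2)
    (fun f hf => (ENNReal.sum_le_tsum s).trans (h f hf)) hc) f

/-- The analysis operator of a Bessel family with bound one. -/
theorem exists_analysis (h : ∀ f, ∑' i, ‖inner ℂ (e i) f‖ₑ ^ 2 ≤ ‖f‖ₑ ^ 2) :
    ∃ T : H →L[ℂ] lp (fun _ : ι => ℂ) 2, ∀ f i, T f i = inner ℂ (e i) f := by
  have hm : ∀ f, Memℓp (fun i => inner ℂ (e i) f : ι → ℂ) 2 := fun f => by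
    refine memℓp_gen ?_
    have h1 : ∑' i, ENNReal.ofReal (‖inner ℂ (e i) f‖ ^ 2) ≠ ∞ := by
      simp only [ENNReal.ofReal_pow (norm_nonneg _), ofReal_norm]
      exact ((h f).trans_lt (ENNReal.pow_lt_top enorm_lt_top)).ne
    have h2 := ENNReal.summable_toReal h1
    simpa [ENNReal.toReal_ofReal, sq_nonneg] using h2
  let T : H →ₗ[ℂ] lp (fun _ : ι => ℂ) 2 :=
    { toFun := fun f => ⟨fun i => inner ℂ (e i) f, hm f⟩
      map_add' := fun f g => by ext i; exact inner_add_right _ _ _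
      map_smul' := fun a f => by ext i; exact inner_smul_right _ _ _ }
  refine ⟨T.mkContinuous 1 fun f => ?_, fun f i => rfl⟩
  rw [one_mul]
  have h1 : ‖T f‖ₑ ^ 2 ≤ ‖f‖ₑ ^ 2 := by
    rw [enorm_lp_two_sq]
    exact h f
  have h2 : ‖T f‖ₑ ≤ ‖f‖ₑ := by
    by_contra! hlt
    exact h1.not_gt (ENNReal.pow_lt_pow_left two_ne_zero hlt)
  exact enorm_le_iff_norm_le.1 h2

/-- Parseval's identity extends from a dense subspace. -/
theorem tsum_enorm_inner_sq_of_dense (hV : V.topologicalClosure = ⊤)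
    (h : ∀ f ∈ V, ∑' i, ‖inner ℂ (e i) f‖ₑ ^ 2 = ‖f‖ₑ ^ 2) (f : H) :
    ∑' i, ‖inner ℂ (e i) f‖ₑ ^ 2 = ‖f‖ₑ ^ 2 := by
  obtain ⟨T, hT⟩ := exists_analysis (tsum_enorm_inner_sq_le_of_dense hV fun f hf => (h f hf).le)
  have hd : Dense (V : Set H) := Submodule.dense_iff_topologicalClosure_eq_top.2 hV
  have h1 : ∀ f, ‖T f‖ₑ ^ 2 = ‖f‖ₑ ^ 2 := hd.induction
    (fun f hf => by rw [enorm_lp_two_sq]; simp only [hT]; exact h f hf)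
    (isClosed_eq (by fun_prop) (by fun_prop))
  rw [← h1, enorm_lp_two_sq]
  simp only [hT]

/-- If the analysis operators of two Bessel families have orthogonal images of a dense subspace,
then the mixed frame operator is zero. -/
theorem hasSum_inner_smul_zero_of_dense [CompleteSpace H] {e' : ι → H}
    (hV : V.topologicalClosure = ⊤)
    (h : ∀ f ∈ V, ∑' i, ‖inner ℂ (e i) f‖ₑ ^ 2 = ‖f‖ₑ ^ 2)
    (h' : ∀ f ∈ V, ∑' i, ‖inner ℂ (e' i) f‖ₑ ^ 2 = ‖f‖ₑ ^ 2)
    (ho : ∀ f ∈ V, ∀ g ∈ V, ∀ s, HasSum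
      (fun i => inner ℂ (e i) f * conj (inner ℂ (e' i) g : ℂ)) s → s = 0) (f : H) :
    HasSum (fun i => (inner ℂ (e i) f : ℂ) • e' i) 0 := by
  obtain ⟨T, hT⟩ := exists_analysis (tsum_enorm_inner_sq_le_of_dense hV fun f hf => (h f hf).le)
  obtain ⟨T', hT'⟩ := exists_analysis (tsum_enorm_inner_sq_le_of_dense hV fun f hf => (h' f hf).le)
  have hd : Dense (V : Set H) := Submodule.dense_iff_topologicalClosure_eq_top.2 hV
  -- Summability comes from the inner product of $\ell^2$; this is why `ho` need only identify the
  -- value of a sum already known to exist.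
  have h1 : ∀ g ∈ V, ∀ f ∈ V, inner ℂ (T' g) (T f) = 0 := fun g hg f hf => by
    have := lp.hasSum_inner (𝕜 := ℂ) (T' g) (T f)
    simp only [hT, hT'] at this
    exact ho f hf g hg _ this
  have h2 : ∀ g ∈ V, ∀ f, inner ℂ (T' g) (T f) = 0 := fun g hg =>
    hd.induction (h1 g hg) (isClosed_eq (by fun_prop) continuous_const)
  have h3 : ∀ f g, inner ℂ (T' g) (T f) = 0 := fun f =>
    hd.induction (fun g hg => h2 g hg f) (isClosed_eq (by fun_prop) continuous_const)
  have h4 : ContinuousLinearMap.adjoint T' (T f) = 0 := by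
    refine ext_inner_left ℂ fun g => ?_
    rw [ContinuousLinearMap.adjoint_inner_right, h3, inner_zero_right]
  classical
  -- Expand $Tf$ in the standard basis of $\ell^2$. The adjoint of $T'$ sends the basis vectors to
  -- the $e'_i$, so the mixed series converges unconditionally to $T'^*Tf=0$.
  have h5 := (lp.hasSum_single (p := 2) (by norm_num) (T f)).mapL (ContinuousLinearMap.adjoint T')
  rw [h4] at h5
  convert! h5 using 2 with i
  refine ext_inner_left ℂ fun g => ?_
  rw [ContinuousLinearMap.adjoint_inner_right, lp.inner_single_right, hT, hT', inner_smul_right]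
  simp [mul_comm]

end Analysis

/-! ### Column blocks of a paraunitary matrix. -/

section Blocks

theorem firstCols_conjTranspose_mul {L : ℕ} {A : Matrix (Fin (2 * L)) (Fin (2 * L)) ℂ}
    (hA : Aᴴ * A = 1) : (firstCols A)ᴴ * firstCols A = 1 := by
  ext i j
  have h := congrFun (congrFun hA ⟨i, by omega⟩) ⟨j, by omega⟩
  simp only [Matrix.mul_apply, Matrix.conjTranspose_apply, Matrix.one_apply, Fin.mk.injEq] at h
  simp only [Matrix.mul_apply, Matrix.conjTranspose_apply, Matrix.one_apply, firstCols,
    Matrix.of_apply, h, Fin.ext_iff]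

theorem lastCols_conjTranspose_mul {L : ℕ} {A : Matrix (Fin (2 * L)) (Fin (2 * L)) ℂ}
    (hA : Aᴴ * A = 1) : (lastCols A)ᴴ * lastCols A = 1 := by
  ext i j
  have h := congrFun (congrFun hA ⟨L + i, by omega⟩) ⟨L + j, by omega⟩
  simp only [Matrix.mul_apply, Matrix.conjTranspose_apply, Matrix.one_apply, Fin.mk.injEq,
    Nat.add_left_cancel_iff] at h
  simp only [Matrix.mul_apply, Matrix.conjTranspose_apply, Matrix.one_apply, lastCols,
    Matrix.of_apply, h, Fin.ext_iff]

theorem firstCols_conjTranspose_mul_lastCols {L : ℕ} {A : Matrix (Fin (2 * L)) (Fin (2 * L)) ℂ}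
    (hA : Aᴴ * A = 1) : (firstCols A)ᴴ * lastCols A = 0 := by
  ext i j
  have h := congrFun (congrFun hA ⟨i, by omega⟩) ⟨L + j, by omega⟩
  simp only [Matrix.mul_apply, Matrix.conjTranspose_apply, Matrix.one_apply, Fin.mk.injEq] at h
  rw [if_neg (by omega)] at h
  simpa only [Matrix.mul_apply, Matrix.conjTranspose_apply, firstCols, lastCols,
    Matrix.of_apply, Matrix.zero_apply] using h

@[simp] theorem oneBlock_zero_zero {m n : ℕ} (M : Matrix (Fin m) (Fin n) ℂ) :
    oneBlock M 0 0 = 1 := rfl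

@[simp] theorem oneBlock_zero_succ {m n : ℕ} (M : Matrix (Fin m) (Fin n) ℂ) (j : Fin n) :
    oneBlock M 0 j.succ = 0 := rfl

@[simp] theorem oneBlock_succ_zero {m n : ℕ} (M : Matrix (Fin m) (Fin n) ℂ) (i : Fin m) :
    oneBlock M i.succ 0 = 0 := rfl

@[simp] theorem oneBlock_succ_succ {m n : ℕ} (M : Matrix (Fin m) (Fin n) ℂ) (i : Fin m)
    (j : Fin n) : oneBlock M i.succ j.succ = M i j := rfl

theorem oneBlock_conjTranspose_mul {m n : ℕ} {M : Matrix (Fin m) (Fin n) ℂ} (hM : Mᴴ * M = 1) :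
    (oneBlock M)ᴴ * oneBlock M = 1 := by
  ext i j
  rw [Matrix.mul_apply, Fin.sum_univ_succ]
  simp only [Matrix.conjTranspose_apply]
  refine Fin.cases ?_ (fun i => ?_) i <;> refine Fin.cases ?_ (fun j => ?_) j
  · simp
  · simp [(Fin.succ_ne_zero j).symm]
  · simp
  · have h := congrFun (congrFun hM i) j
    rw [Matrix.mul_apply] at h
    simpa [Matrix.one_apply] using h

theorem oneBlock_mul_zero {m n : ℕ} {ι : Type*} (M : Matrix (Fin m) (Fin n) ℂ)
    (Γ : Matrix (Fin (n + 1)) ι ℂ) (r : ι) : (oneBlock M * Γ) 0 r = Γ 0 r := by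
  rw [Matrix.mul_apply, Fin.sum_univ_succ]
  simp

theorem oneBlock_mulVec_succ {m n : ℕ} (M : Matrix (Fin m) (Fin n) ℂ) (v : Fin (n + 1) → ℂ)
    (i : Fin m) : (oneBlock M *ᵥ v) i.succ = (M *ᵥ fun l => v l.succ) i := by
  simp [Matrix.mulVec, dotProduct, Fin.sum_univ_succ]

/-- Mixing the rows of two matrices by matrices with orthogonal ranges makes them orthogonal. -/
theorem sum_conj_oneBlock_mulVec_mul {m n n' : ℕ} {ι : Type*} [Fintype ι]
    {M : Matrix (Fin m) (Fin n) ℂ} {M' : Matrix (Fin m) (Fin n') ℂ} (h : Mᴴ * M' = 0)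
    (Γ : Matrix (Fin (n + 1)) ι ℂ) (Γ' : Matrix (Fin (n' + 1)) ι ℂ) (w w' : ι → ℂ) :
    ∑ i : Fin m, conj (((oneBlock M * Γ) *ᵥ w) i.succ) * ((oneBlock M' * Γ') *ᵥ w') i.succ = 0 := by
  simp only [← Matrix.mulVec_mulVec, oneBlock_mulVec_succ]
  set v := fun l : Fin n => (Γ *ᵥ w) l.succ
  set v' := fun l : Fin n' => (Γ' *ᵥ w') l.succ
  change star (M *ᵥ v) ⬝ᵥ (M' *ᵥ v') = 0
  rw [Matrix.star_mulVec, ← Matrix.dotProduct_mulVec, Matrix.mulVec_mulVec, h, Matrix.zero_mulVec,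
    dotProduct_zero]

end Blocks

namespace FieldData

/-! ### Parseval frames and orthogonal pairs from extension pairs. -/

section Frames

set_option linter.unusedSectionVars false

variable {K : Type*} [NontriviallyNormedField K] {p c : ℕ} [NeZero c] {S : FieldData K p c}
  [Fact p.Prime] [IsUltrametricDist K] [ProperSpace K] [MeasurableSpace K] [BorelSpace K]
  {μ : Measure K} [μ.IsAddHaarMeasure] [hμ : Fact (μ (Metric.closedBall 0 1) = 1)]

/-- Truncating a representative turns vanishing a.e. outside a ball into vanishing everywhere there,
the form in which the level identities are stated. -/
theorem exists_indicator_of_mem_bddSupport {F : Lp ℂ 2 μ} (hF : F ∈ bddSupport μ) :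
    ∃ (f : K → ℂ) (hf : MemLp f 2 μ), (∃ r : ℝ, ∀ x, r < ‖x‖ → f x = 0) ∧ hf.toLp f = F := by
  obtain ⟨r, hr⟩ := hF
  refine ⟨_, memLp_indicator_closedBall μ (Lp.memLp F) r, ⟨r, fun x hx => ?_⟩, ?_⟩
  · exact Set.indicator_of_notMem (by simpa using hx) _
  · refine Lp.ext ((MemLp.coeFn_toLp _).trans ?_)
    filter_upwards [hr] with x hx
    by_cases h : x ∈ Metric.closedBall (0 : K) r
    · rw [Set.indicator_of_mem h]
    · rw [Set.indicator_of_notMem h, hx (by simpa using h)]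

theorem exists_of_mem_testFunctions {F : Lp ℂ 2 μ} (hF : F ∈ S.testFunctions μ) :
    ∃ f g, ∃ h : S.IsFourierL2 μ f g, (∃ r : ℝ, ∀ x, r < ‖x‖ → f x = 0) ∧
      (∃ R : ℝ, ∀ ξ, R < ‖ξ‖ → g ξ = 0) ∧ h.1.toLp f = F := by
  obtain ⟨f, hf, hr, rfl⟩ := exists_indicator_of_mem_bddSupport hF.1
  obtain ⟨g, hg, hR, h⟩ := exists_indicator_of_mem_bddSupport hF.2
  exact ⟨f, g, (S.isFourierL2_iff μ hf hg).2 h.symm, hr, hR, rfl⟩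

/-- The wavelet system of `Ψ` as a family in `L²(K)`. -/
def waveletLp (S : FieldData K p c) (μ : Measure K) [μ.IsAddHaarMeasure]
    [Fact (μ (Metric.closedBall 0 1) = 1)] {N : ℕ} {Ψ : Fin N → K → ℂ}
    (hΨ : ∀ i, MemLp (Ψ i) 2 μ) (x : Fin N × ℤ × ℕ) : Lp ℂ 2 μ :=
  (S.memLp_wavelet μ (hΨ x.1) x.2.1 x.2.2).toLp _

variable {n : ℕ} {φ θ : K → ℂ} {Δ : K → Matrix (Fin (n + 1)) (Fin (p ^ c)) ℂ} {Ψ : Fin n → K → ℂ}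

theorem inner_waveletLp {N : ℕ} {Ψ Θ : Fin N → K → ℂ} (hΨ : ∀ i, S.IsFourierL2 μ (Ψ i) (Θ i))
    {f g : K → ℂ} (h : S.IsFourierL2 μ f g) (x : Fin N × ℤ × ℕ) :
    inner ℂ (S.waveletLp μ (fun i => (hΨ i).1) x) (h.1.toLp f) =
      S.coef μ g (Θ x.1) x.2.1 x.2.2 := by
  rw [waveletLp, inner_toLp, coef,
    S.integral_mul_conj_eq μ h (S.isFourierL2_wavelet μ (hΨ x.1) x.2.1 x.2.2)]

/-- Parseval's identity for the generators of an extension pair. -/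
theorem IsExtensionPair.tsum_enorm_inner_sq (hθ : S.IsExtensionPair μ θ Δ)
    (hφ : S.IsFourierL2 μ φ θ)
    (hΨ : ∀ i, S.IsFourierL2 μ (Ψ i) (S.genHat θ Δ i.succ)) :
    ∀ F ∈ S.testFunctions μ,
      ∑' x, ‖inner ℂ (S.waveletLp μ (fun i => (hΨ i).1) x) F‖ₑ ^ 2 = ‖F‖ₑ ^ 2 := by
  intro F hF
  obtain ⟨f, g, h, ⟨r, hr⟩, ⟨R, hR⟩, rfl⟩ := exists_of_mem_testFunctions hF
  simp only [inner_waveletLp hΨ h]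
  rw [Lp.enorm_toLp, ← h.eLpNorm_eq, ← hθ.tsum_energy h hφ hr hR, ENNReal.tsum_prod',
    tsum_fintype]
  simp only [ENNReal.tsum_prod']
  rw [← Summable.tsum_finsetSum fun _ _ => ENNReal.summable]
  rfl

theorem IsExtensionPair.isWaveletFrameWith (hθ : S.IsExtensionPair μ θ Δ)
    (hφ : S.IsFourierL2 μ φ θ)
    (hΨ : ∀ i, S.IsFourierL2 μ (Ψ i) (S.genHat θ Δ i.succ)) :
    S.IsWaveletFrameWith μ Ψ 1 1 := by
  refine ⟨fun i => (hΨ i).1, fun f hf => ?_⟩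
  have h := tsum_enorm_inner_sq_of_dense (S.dense_testFunctions μ)
    (hθ.tsum_enorm_inner_sq hφ hΨ) (hf.toLp f)
  simp only [waveletLp, inner_toLp, Lp.enorm_toLp] at h
  rw [h, ENNReal.ofReal_one, one_mul]
  exact ⟨le_rfl, le_rfl⟩

theorem IsExtensionPair.tendsto_mixed (hθ : S.IsExtensionPair μ θ Δ)
    (hφ : S.IsFourierL2 μ φ θ)
    (hΨ : ∀ i, S.IsFourierL2 μ (Ψ i) (S.genHat θ Δ i.succ))
    {φ' θ' : K → ℂ} {Δ' : K → Matrix (Fin (n + 1)) (Fin (p ^ c)) ℂ} {Φ : Fin n → K → ℂ}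
    (hθ' : S.IsExtensionPair μ θ' Δ') (hφ' : S.IsFourierL2 μ φ' θ')
    (hΦ : ∀ i, S.IsFourierL2 μ (Φ i) (S.genHat θ' Δ' i.succ))
    (hcross : ∀ᵐ ξ ∂μ, ∀ w w', ∑ i : Fin n,
      conj ((Δ ξ *ᵥ w) i.succ) * (Δ' ξ *ᵥ w') i.succ = 0) {f : K → ℂ} (hf : MemLp f 2 μ) :
    Tendsto (fun s : Finset (Fin n × ℤ × ℕ) => eLpNorm (fun x => ∑ i ∈ s,
        (∫ y, f y * conj (S.wavelet (Ψ i.1) i.2.1 i.2.2 y) ∂μ) *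
          S.wavelet (Φ i.1) i.2.1 i.2.2 x) 2 μ) atTop (𝓝 0) := by
  have h := hasSum_inner_smul_zero_of_dense (S.dense_testFunctions μ)
    (hθ.tsum_enorm_inner_sq hφ hΨ) (hθ'.tsum_enorm_inner_sq hφ' hΦ) (fun F hF F' hF' s hs => ?_)
    (hf.toLp f)
  · have h1 := (continuous_enorm.tendsto (0 : Lp ℂ 2 μ)).comp h
    rw [enorm_zero] at h1
    refine h1.congr fun s => ?_
    rw [Function.comp_apply, Lp.enorm_def]
    refine eLpNorm_congr_ae ?_
    refine (Lp.coeFn_finsetSum _ _).trans ?_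
    have h2 : ∀ i : Fin n × ℤ × ℕ, (((inner ℂ (S.waveletLp μ (fun i => (hΨ i).1) i)
        (hf.toLp f) : ℂ) • S.waveletLp μ (fun i => (hΦ i).1) i : Lp ℂ 2 μ) : K → ℂ) =ᵐ[μ] fun x =>
        (∫ y, f y * conj (S.wavelet (Ψ i.1) i.2.1 i.2.2 y) ∂μ) *
          S.wavelet (Φ i.1) i.2.1 i.2.2 x := fun i => by
      refine (Lp.coeFn_smul _ _).trans ?_
      filter_upwards [(S.memLp_wavelet μ (hΦ i.1).1 i.2.1 i.2.2).coeFn_toLp] with x hx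
      rw [Pi.smul_apply, waveletLp, waveletLp, inner_toLp, hx, smul_eq_mul]
    filter_upwards [ae_all_iff.2 h2] with x hx
    rw [Finset.sum_apply]
    exact Finset.sum_congr rfl fun i _ => hx i
  · obtain ⟨f, g, h, -, ⟨R, hR⟩, rfl⟩ := exists_of_mem_testFunctions hF
    obtain ⟨f', g', h', -, ⟨R', hR'⟩, rfl⟩ := exists_of_mem_testFunctions hF'
    simp only [inner_waveletLp hΨ h, inner_waveletLp hΦ h'] at hs
    -- The index is regrouped with the level outermost. The sum is known to converge, so it may be
    -- computed level by level, where `hasSum_coef_mul_conj` gives $0$.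
    have h1 := (Equiv.prodAssoc ℤ ℕ (Fin n)).symm.hasSum_iff.2
      ((Equiv.prodComm (ℤ × ℕ) (Fin n)).hasSum_iff.2 hs)
    refine (h1.prod_fiberwise fun j => ?_).unique hasSum_zero
    have h2 := h1.summable.prod_factor j
    have h3 := h2.hasSum.prod_fiberwise fun k => hasSum_fintype _
    have h4 := hθ.hasSum_coef_mul_conj hθ' hcross h.2.1 h'.2.1 hR hR' j
    rw [← h3.unique h4]
    exact h2.hasSum

/-- An extension pair stays one when the rows of its matrix, except the first, are mixed by an
isometry. -/
theorem IsExtensionPair.oneBlock_mul (hθ : S.IsExtensionPair μ θ Δ) {m : ℕ}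
    {M : K → Matrix (Fin m) (Fin n) ℂ} (hm : ∀ i j, Measurable fun ξ => M ξ i j)
    (hper : ∀ k ξ, M (ξ + S.u k) = M ξ) (hM : ∀ᵐ ξ ∂μ, (M ξ)ᴴ * M ξ = 1) :
    S.IsExtensionPair μ θ fun ξ => oneBlock (M ξ) * Δ ξ where
  memLp := hθ.memLp
  measurable i r := by
    simp only [Matrix.mul_apply]
    refine Finset.aestronglyMeasurable_fun_sum _ fun l _ => ?_
    refine AEStronglyMeasurable.mul ?_ (hθ.measurable l r)
    refine Fin.cases ?_ (fun i => ?_) i <;> refine Fin.cases ?_ (fun l => ?_) l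
    · exact aestronglyMeasurable_const
    · exact aestronglyMeasurable_const
    · exact aestronglyMeasurable_const
    · exact (hm i l).aestronglyMeasurable
  periodic k := by
    filter_upwards [hθ.periodic k] with ξ hξ
    rw [hξ, hper]
  isometry := by
    filter_upwards [hθ.isometry, hM] with ξ h1 h2
    rw [Matrix.conjTranspose_mul, Matrix.mul_assoc, ← Matrix.mul_assoc (oneBlock (M ξ))ᴴ,
      oneBlock_conjTranspose_mul h2, Matrix.one_mul, h1]
  -- Mixing by $\operatorname{diag}(1,M)$ leaves row $0$ unchanged, so the refinement mask stays the
  -- same.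
  refinement := by
    filter_upwards [hθ.refinement] with ξ h
    rw [h]
    simp only [mask, oneBlock_mul_zero]
  tendsto_one := hθ.tendsto_one

/-- The prescribed transform is a bounded mask times a dilate of $\theta$, hence in $L^2$, and the
Fourier transform is onto. -/
theorem IsExtensionPair.exists_generator (hθ : S.IsExtensionPair μ θ Δ) (i : Fin (n + 1)) :
    ∃ f, S.IsFourierL2 μ f (S.genHat θ Δ i) := by
  have hg : MemLp (S.genHat θ Δ i) 2 μ := hθ.memLp_mask_mul i
  obtain ⟨F, hF⟩ := S.surjective_fourierLp μ (hg.toLp _)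
  refine ⟨F, (S.isFourierL2_iff μ (Lp.memLp F) hg).2 ?_⟩
  rw [Lp.toLp_coeFn, hF]

end Frames

end FieldData

end LocalFieldWavelet

end

open LocalFieldWavelet in
theorem theorem3p4 {K : Type*} [NontriviallyNormedField K] [IsUltrametricDist K]
    [LocallyCompactSpace K] [MeasurableSpace K] [BorelSpace K]
    (p c : ℕ) [Fact p.Prime] [CharP K p] [NeZero c] (S : FieldData K p c)
    (μ : MeasureTheory.Measure K) [μ.IsAddHaarMeasure] (hμ : μ (Metric.closedBall 0 1) = 1)
    (L : ℕ)
    -- two systems from the unitary extension principle, possibly equal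
    (φ φhat : K → ℂ) (h : Fin (L + 1) → ℕ → ℂ) (Γ : K → Matrix (Fin (L + 1)) (Fin S.q) ℂ)
    (hφ : S.IsUEPSystem μ φ φhat h Γ)
    (φ' φhat' : K → ℂ) (h' : Fin (L + 1) → ℕ → ℂ) (Γ' : K → Matrix (Fin (L + 1)) (Fin S.q) ℂ)
    (hφ' : S.IsUEPSystem μ φ' φhat' h' Γ')
    (A : K → Matrix (Fin (2 * L)) (Fin (2 * L)) ℂ) (hA : S.IsParaunitary μ A)
    -- the new polyphase matrices, and the new masks
    (Γ₁ Γ₂ : K → Matrix (Fin (2 * L + 1)) (Fin S.q) ℂ)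
    (hΓ₁ : ∀ η, Γ₁ η = oneBlock (firstCols (A η)) * Γ η)
    (hΓ₂ : ∀ η, Γ₂ η = oneBlock (lastCols (A η)) * Γ' η)
    (G G' : Fin (2 * L) → K → ℂ)
    (hG : ∀ k, G k = S.mask Γ₁ k.succ) (hG' : ∀ k, G' k = S.mask Γ₂ k.succ) :
    -- the generators exist in L²(K)
    (∃ Ψ Φ : Fin (2 * L) → K → ℂ,
      (∀ k, S.IsFourierL2 μ (Ψ k) fun ξ => G k (S.𝔭 * ξ) * φhat (S.𝔭 * ξ)) ∧
      ∀ k, S.IsFourierL2 μ (Φ k) fun ξ => G' k (S.𝔭 * ξ) * φhat' (S.𝔭 * ξ)) ∧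
    -- and they generate a pair of orthogonal wavelet frames, with frame bounds 1
    ∀ Ψ Φ : Fin (2 * L) → K → ℂ,
      (∀ k, S.IsFourierL2 μ (Ψ k) fun ξ => G k (S.𝔭 * ξ) * φhat (S.𝔭 * ξ)) →
      (∀ k, S.IsFourierL2 μ (Φ k) fun ξ => G' k (S.𝔭 * ξ) * φhat' (S.𝔭 * ξ)) →
      S.IsOrthogonalFramePair μ Ψ Φ ∧
        S.IsWaveletFrameWith μ Ψ 1 1 ∧ S.IsWaveletFrameWith μ Φ 1 1 := by
  have : ProperSpace K := ProperSpace.of_nontriviallyNormedField_of_weaklyLocallyCompactSpace K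
  have : Fact (μ (Metric.closedBall 0 1) = 1) := ⟨hμ⟩
  obtain rfl : G = fun k => S.mask Γ₁ k.succ := funext hG
  obtain rfl : G' = fun k => S.mask Γ₂ k.succ := funext hG'
  obtain rfl : Γ₁ = fun η => oneBlock (firstCols (A η)) * Γ η := funext hΓ₁
  obtain rfl : Γ₂ = fun η => oneBlock (lastCols (A η)) * Γ' η := funext hΓ₂
  -- Each column block of $A$ is itself an isometry, so each mixed polyphase matrix is again an
  -- extension pair with its old refinable function.
  have h₁ := hφ.isExtensionPair.oneBlock_mul (M := fun η => firstCols (A η))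
    (fun i j => hA.measurable _ _) (fun k ξ => by rw [hA.periodic])
    (hA.unitary.mono fun ξ h => firstCols_conjTranspose_mul h)
  have h₂ := hφ'.isExtensionPair.oneBlock_mul (M := fun η => lastCols (A η))
    (fun i j => hA.measurable _ _) (fun k ξ => by rw [hA.periodic])
    (hA.unitary.mono fun ξ h => lastCols_conjTranspose_mul h)
  refine ⟨?_, fun Ψ Φ hΨ hΦ => ?_⟩
  · choose Ψ hΨ using fun k : Fin (2 * L) => h₁.exists_generator k.succ
    choose Φ hΦ using fun k : Fin (2 * L) => h₂.exists_generator k.succ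
    exact ⟨Ψ, Φ, hΨ, hΦ⟩
  · have hF₁ := h₁.isWaveletFrameWith hφ.fourier hΨ
    have hF₂ := h₂.isWaveletFrameWith hφ'.fourier hΦ
    refine ⟨⟨⟨1, 1, one_pos, one_pos, hF₁⟩, ⟨1, 1, one_pos, one_pos, hF₂⟩, fun f hf => ?_⟩,
      hF₁, hF₂⟩
    -- Only $A_1^*A_2=0$ is used for the cross terms; the two refinable functions need not be
    -- related.
    exact h₁.tendsto_mixed hφ.fourier hΨ h₂ hφ'.fourier hΦ (hA.unitary.mono fun ξ h =>
      sum_conj_oneBlock_mulVec_mul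
        (firstCols_conjTranspose_mul_lastCols h) _ _) hf
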